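/- Let $(a_n)_{n\ge 0}$ be a sequence of strictly positive reals with $a_0=1$, $a_n/a_{n+1}\to 1$ and $\sum_n a_n<\infty$, and let $H$ be the Hilbert space of all analytic functions $f(z)=\sum_{n\ge0}\hat f(n)z^n$ on the open unit disc with $\|f\|^2=\sum_n |\hat f(n)|^2/a_n<\infty$. Assume that either $a_n=(n+1)^s$ for all $n$, for some real $s<-1$ (so that $H=\mathcal H_s$ is the space with norm $\|f\|^2=\sum_n (n+1)^{-s}|\hat f(n)|^2$), or, more generally, that $H$ is a complete Pick space, i.e. the coefficients $b_n$ in the power series identity $\sum_{n\ge1}b_nz^n=1-1/\sum_{n\ge0}a_nz^n$ satisfy $b_n\ge0$ for all $n\ge1$. Every polynomial $p$ defines a bounded multiplication operator $M_pf=pf$ on $H$. Let $\mathcal T\subset B(H)$ be the unital C*-algebra generated by $M_z$, and let $S\subset\mathcal T$ be the operator system given by the norm-closed linear span of $\{M_pM_q^*: p,q\in\mathbb C[z]\}$. Let $k_1(z)=\sum_n a_nz^n\in H$ be the kernel function at the boundary point $1$, let $\hat k_1=k_1/\|k_1\|$, and let $\psi(x)=\langle x\hat k_1,\hat k_1\rangle$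 for $x\in\mathcal T$. Then $\mathcal T$ contains all compact operators, and there is a unique surjective unital $*$-homomorphism $\rho:\mathcal T\to C(\mathbb T)$ whose kernel is the ideal of compact operators and which satisfies $\rho(M_p)=p|_{\mathbb T}$ for all polynomials $p$. Let $\delta(x)=\rho(x)(1)$, a character of $\mathcal T$, and let $\varphi=\delta|_S$. Then: (1) $\mathcal T$ is the C*-envelope of $S$: $S$ generates $\mathcal T$, and for every unital completely isometric linear map $j$ from $S$ into a unital C*-algebra $B$ generated by $j(S)$ there is a surjective unital $*$-homomorphism $\pi:B\to\mathcal T$ with $\pi(j(x))=x$ for all $x\in S$; (2) $\varphi$ is a pure state of $S$, i.e. a state such that every positive functional $\theta$ on $S$ with $\theta\le\varphi$ is $t\varphi$ for some $t\in[0,1]$; (3) the set of states of $\mathcal T$ extending $\varphi$ is exactly $\{t\psi+(1-t)\delta: 0\le t\le1\}$; (4) the GNS representation of $\psi$ is unitarily equivalent to the identity representation of $\mathcal T$ on $H$, by a unitary that maps the GNS cyclic vector to $\hat k_1$, and it (equivalently, the identity representation) is a boundary representation for $S$; (5) $\delta$ is a character of $\mathcal T$ that is not a boundary representation for $S$. Here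 a boundary representation for $S$ is an irreducible representation $\pi:\mathcal T\to B(K)$ on a Hilbert space $K$ such that $\pi$ is the only completely positive map $\mathcal T\to B(K)$ which agrees with $\pi$ on $S$. -/

import Mathlib

open Filter Topology Polynomial
open scoped ComplexOrder CStarAlgebra InnerProductSpace

universe u v w

noncomputable section

/-! ### Operator systems, states, boundary representations and C*-envelopes -/

/-- A (concrete) operator system: a closed, self-adjoint linear subspace of a unital C*-algebra
containing the unit. -/
structure OperatorSystem (A : Type v) [CStarAlgebra A] extends Submodule ℂ A where
  one_mem' : (1 : A) ∈ carrier
  star_mem' : ∀ {x : A}, x ∈ carrier → star x ∈ carrier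
  isClosed' : IsClosed carrier

namespace OperatorSystem

variable {A : Type v} [CStarAlgebra A]

/-- The unit of an operator system. -/
def unit (S : OperatorSystem A) : S.toSubmodule := ⟨1, S.one_mem'⟩

/-- The C*-algebra generated by the operator system is the whole ambient C*-algebra. -/
def Generates (S : OperatorSystem A) : Prop :=
  (StarAlgebra.adjoin ℂ (S.toSubmodule : Set A)).topologicalClosure = ⊤

/-- A linear map from an operator system into a C*-algebra is unital. -/
def IsUnitalMap (S : OperatorSystem A) {B : Type u} [CStarAlgebra B]
    (j : S.toSubmodule →ₗ[ℂ] B) : Prop :=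
  j S.unit = 1

/-- A linear map `j` from an operator system into a C*-algebra is completely isometric: for every
`n`, the entrywise application of `j` to `n × n` matrices with entries in `S` preserves the
C*-norm. -/
def IsCompletelyIsometric [PartialOrder A] [StarOrderedRing A] (S : OperatorSystem A)
    {B : Type u} [CStarAlgebra B] [PartialOrder B] [StarOrderedRing B]
    (j : S.toSubmodule →ₗ[ℂ] B) : Prop :=
  ∀ (n : ℕ) (M : Matrix (Fin n) (Fin n) S.toSubmodule),
    ‖CStarMatrix.ofMatrix (M.map fun x => j x)‖ =
      ‖CStarMatrix.ofMatrix (M.map fun x => (x : A))‖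

/-- `A` is the C*-envelope of the operator system `S ⊆ A`: `S` generates `A` and, for every
C*-algebra `B` generated by the image of a unital completely isometric map `j : S → B`, there is a
surjective *-homomorphism `π : B → A` with `π (j x) = x` for all `x ∈ S`. -/
def IsCStarEnvelope [PartialOrder A] [StarOrderedRing A] (S : OperatorSystem A) : Prop :=
  S.Generates ∧
    ∀ (B : Type u) [CStarAlgebra B] [PartialOrder B] [StarOrderedRing B]
      (j : S.toSubmodule →ₗ[ℂ] B),
      S.IsUnitalMap j → S.IsCompletelyIsometric j →
      (StarAlgebra.adjoin ℂ (Set.range j)).topologicalClosure = ⊤ →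
      ∃ π : B →⋆ₐ[ℂ] A, Function.Surjective π ∧ ∀ x : S.toSubmodule, π (j x) = (x : A)

variable [PartialOrder A]

/-- A linear functional on an operator system is positive. -/
def IsPositiveFunctional (S : OperatorSystem A) (τ : S.toSubmodule →ₗ[ℂ] ℂ) : Prop :=
  ∀ x : S.toSubmodule, 0 ≤ (x : A) → 0 ≤ τ x

/-- States of an operator system: unital positive functionals. -/
def IsState (S : OperatorSystem A) (τ : S.toSubmodule →ₗ[ℂ] ℂ) : Prop :=
  S.IsPositiveFunctional τ ∧ τ S.unit = 1

/-- A state `τ` is pure if every functional `θ` with `0 ≤ θ ≤ τ` is of the form `t τ`, with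
`0 ≤ t ≤ 1`. (For functionals, positivity and complete positivity are the same.) -/
def IsPureState (S : OperatorSystem A) (τ : S.toSubmodule →ₗ[ℂ] ℂ) : Prop :=
  S.IsState τ ∧ ∀ θ : S.toSubmodule →ₗ[ℂ] ℂ,
    S.IsPositiveFunctional θ → S.IsPositiveFunctional (τ - θ) →
      ∃ t : ℝ, 0 ≤ t ∧ t ≤ 1 ∧ θ = (t : ℂ) • τ

end OperatorSystem

/-- States of a unital C*-algebra: unital positive functionals. -/
def IsCStarState {A : Type v} [CStarAlgebra A] [PartialOrder A] (τ : A →ₗ[ℂ] ℂ) : Prop :=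
  (∀ x : A, 0 ≤ x → 0 ≤ τ x) ∧ τ 1 = 1

section Representations

variable {A : Type v} [CStarAlgebra A]
  {K : Type w} [NormedAddCommGroup K] [InnerProductSpace ℂ K] [CompleteSpace K]

/-- A representation on a Hilbert space is irreducible: the space is nonzero and has no nontrivial
closed invariant subspaces. -/
def IsIrreducibleRep (π : A →⋆ₐ[ℂ] (K →L[ℂ] K)) : Prop :=
  Nontrivial K ∧ ∀ V : Submodule ℂ K, IsClosed (V : Set K) →
    (∀ (x : A), ∀ ξ ∈ V, π x ξ ∈ V) → V = ⊥ ∨ V = ⊤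

/-- A boundary representation for `S`: an irreducible representation `π` of the ambient C*-algebra
such that `π` is the only completely positive extension of `π|_S`. -/
def IsBoundaryRep [PartialOrder A] [StarOrderedRing A] (S : OperatorSystem A)
    (π : A →⋆ₐ[ℂ] (K →L[ℂ] K)) : Prop :=
  IsIrreducibleRep π ∧
    ∀ Φ : A →CP (K →L[ℂ] K), (∀ x ∈ S.toSubmodule, Φ x = π x) → ∀ x : A, Φ x = π x

/-- A character of a C*-algebra, regarded as a representation on the one-dimensional Hilbert
space `ℂ`. -/
def characterRep (χ : A →⋆ₐ[ℂ] ℂ) : A →⋆ₐ[ℂ] (ℂ →L[ℂ] ℂ) :=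
  (StarAlgHom.ofId ℂ (ℂ →L[ℂ] ℂ)).comp χ

end Representations

theorem exists_eq_star_mul_self_of_spectrum {B : Type v} [CStarAlgebra B] {x : B}
    (hx : IsSelfAdjoint x) (h : ∀ r ∈ spectrum ℝ x, 0 ≤ r) : ∃ s : B, x = star s * s := by
  let _ : PartialOrder B := CStarAlgebra.spectralOrder B
  have _ : StarOrderedRing B := CStarAlgebra.spectralOrderedRing B
  exact CStarAlgebra.nonneg_iff_eq_star_mul_self.1
    ((StarOrderedRing.nonneg_iff_spectrum_nonneg (R := ℝ) x hx).2 h)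

/-- With the order inherited from the ambient C*-algebra, a closed unital *-subalgebra is a
star-ordered ring. -/
instance StarSubalgebra.instStarOrderedRingOfIsClosed {A : Type v} [CStarAlgebra A]
    [PartialOrder A] [StarOrderedRing A] (T : StarSubalgebra ℂ A) [hT : IsClosed (T : Set A)] :
    StarOrderedRing T := by
  refine StarOrderedRing.of_nonneg_iff' ?_ ?_
  · intro x y h z
    exact add_le_add_right (show (x : A) ≤ y from h) (z : A)
  · intro x
    constructor
    · intro hx
      have hx' : (0 : A) ≤ (x : A) := hx
      refine exists_eq_star_mul_self_of_spectrum
        (Subtype.ext (IsSelfAdjoint.of_nonneg hx').star_eq) fun r hr => ?_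
      refine (StarOrderedRing.nonneg_iff_spectrum_nonneg (R := ℝ) (x : A)
        (IsSelfAdjoint.of_nonneg hx')).1 hx' r ?_
      rw [← spectrum.preimage_algebraMap (S := ℂ) (R := ℝ), Set.mem_preimage] at hr ⊢
      rwa [← StarSubalgebra.spectrum_eq T]
    · rintro ⟨s, rfl⟩
      exact star_mul_self_nonneg (s : A)

/-! ### Rotationally invariant spaces on the disc -/

/-- The open unit disc. -/
abbrev Disc : Type := Metric.ball (0 : ℂ) 1

/-- A sequence of strictly positive reals with `a 0 = 1`, `a n / a (n + 1) → 1` and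
`∑ a n < ∞`. These are the sequences which define the regular rotationally invariant spaces on the
disc with bounded kernel `K(z, w) = ∑ a n (z conj w)^n`. -/
structure DiscWeight where
  a : ℕ → ℝ
  pos : ∀ n, 0 < a n
  zero : a 0 = 1
  ratio : Tendsto (fun n => a n / a (n + 1)) atTop (𝓝 1)
  summable : Summable a

/-- The weight `a n = (n + 1)^s`, for `s < -1`, which defines the space `H_s`. -/
def powerWeight (s : ℝ) (hs : s < -1) : DiscWeight where
  a n := ((n : ℝ) + 1) ^ s
  pos n := by positivity
  zero := by simp
  ratio := by
    have h : Tendsto (fun n : ℕ => (((n : ℝ) + 1) / ((n : ℝ) + 1 + 1)) ^ s) atTop (𝓝 1) := by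
      have h1 : Tendsto (fun n : ℕ => ((n : ℝ) + 1) / ((n : ℝ) + 1 + 1)) atTop (𝓝 1) := by
        have h2 := (tendsto_natCast_div_add_atTop (1 : ℝ)).comp (tendsto_add_atTop_nat 1)
        refine h2.congr fun n => ?_
        simp
      simpa using h1.rpow_const (p := s) (Or.inl one_ne_zero)
    refine h.congr fun n => ?_
    rw [Real.div_rpow (by positivity) (by positivity)]
    push_cast
    rfl
  summable := by
    have h := (summable_nat_add_iff 1).2 (Real.summable_nat_rpow.2 hs)
    refine h.congr fun n => ?_
    push_cast
    rfl

namespace DiscWeight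

/-- The complete Pick property, in terms of coefficients: in the power series identity
`∑_{n ≥ 1} b n z^n = 1 - 1 / ∑_{n ≥ 0} a n z^n`, one has `b n ≥ 0` for all `n ≥ 1`. -/
def IsCompletePick (W : DiscWeight) : Prop :=
  ∀ n : ℕ, 1 ≤ n → 0 ≤ PowerSeries.coeff n (1 - (PowerSeries.mk W.a)⁻¹)

variable (W : DiscWeight)

/-- The linear space of all functions `f(z) = ∑ c n z^n` on the disc with
`∑ |c n|^2 / a n < ∞`. -/
def funSpace : Submodule ℂ (Disc → ℂ) where
  carrier := {f | ∃ c : ℕ → ℂ, Summable (fun n => ‖c n‖ ^ 2 / W.a n) ∧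
    ∀ z : Disc, HasSum (fun n => c n * (z : ℂ) ^ n) (f z)}
  zero_mem' := ⟨0, by simp, fun z => by simp⟩
  add_mem' := by
    rintro f g ⟨c, hc, hf⟩ ⟨d, hd, hg⟩
    refine ⟨c + d, ?_, fun z => ?_⟩
    · refine Summable.of_nonneg_of_le (fun n => div_nonneg (by positivity) (W.pos n).le)
        (fun n => ?_) ((hc.add hd).mul_left 2)
      have h1 : ‖(c + d) n‖ ^ 2 ≤ 2 * (‖c n‖ ^ 2 + ‖d n‖ ^ 2) := by
        have h2 : ‖(c + d) n‖ ≤ ‖c n‖ + ‖d n‖ := norm_add_le _ _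
        nlinarith [norm_nonneg ((c + d) n), sq_nonneg (‖c n‖ - ‖d n‖)]
      calc ‖(c + d) n‖ ^ 2 / W.a n ≤ (2 * (‖c n‖ ^ 2 + ‖d n‖ ^ 2)) / W.a n :=
            div_le_div_of_nonneg_right h1 (W.pos n).le
        _ = _ := by ring
    · simpa [add_mul] using (hf z).add (hg z)
  smul_mem' := by
    rintro t f ⟨c, hc, hf⟩
    refine ⟨t • c, ?_, fun z => ?_⟩
    · refine (hc.mul_left (‖t‖ ^ 2)).congr fun n => ?_
      simp [mul_pow, mul_div_assoc]
    · simpa [mul_assoc] using (hf z).mul_left t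

/-- The Hilbert space `H` of all functions `f(z) = ∑ c n z^n` on the disc with
`‖f‖^2 = ∑ |c n|^2 / a n < ∞`. -/
def H : Type := W.funSpace

instance : AddCommGroup W.H := inferInstanceAs (AddCommGroup W.funSpace)
instance : Module ℂ W.H := inferInstanceAs (Module ℂ W.funSpace)
instance : CoeFun W.H (fun _ => Disc → ℂ) := ⟨fun f => f.1⟩

/-- Power series coefficients are unique. -/
theorem coeff_unique {c d : ℕ → ℂ} {f : Disc → ℂ}
    (hc : ∀ z : Disc, HasSum (fun n => c n * (z : ℂ) ^ n) (f z))
    (hd : ∀ z : Disc, HasSum (fun n => d n * (z : ℂ) ^ n) (f z)) : c = d := by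
  have h : HasFPowerSeriesAt (fun _ : ℂ => (0 : ℂ))
      (FormalMultilinearSeries.ofScalars ℂ (fun n => c n - d n)) 0 := by
    rw [hasFPowerSeriesAt_iff]
    filter_upwards [Metric.ball_mem_nhds (0 : ℂ) one_pos] with z hz
    have := (hc ⟨z, hz⟩).sub (hd ⟨z, hz⟩)
    simpa [mul_sub, mul_comm] using this
  have h0 := h.eq_zero
  funext n
  have := congrArg (fun p => FormalMultilinearSeries.coeff p n) h0
  simp only [FormalMultilinearSeries.coeff_ofScalars] at this
  exact sub_eq_zero.1 (this.trans (by simp [FormalMultilinearSeries.coeff]))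

variable {W}

/-- The Taylor coefficients of an element of `H`. -/
def taylor (f : W.H) : ℕ → ℂ := f.2.choose

theorem summable_taylor (f : W.H) : Summable (fun n => ‖taylor f n‖ ^ 2 / W.a n) :=
  f.2.choose_spec.1

theorem hasSum_taylor (f : W.H) (z : Disc) : HasSum (fun n => taylor f n * (z : ℂ) ^ n) (f z) :=
  f.2.choose_spec.2 z

theorem taylor_eq {f : W.H} {c : ℕ → ℂ}
    (hc : ∀ z : Disc, HasSum (fun n => c n * (z : ℂ) ^ n) (f z)) : taylor f = c :=
  coeff_unique (hasSum_taylor f) hc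

theorem taylor_add (f g : W.H) : taylor (f + g) = taylor f + taylor g :=
  taylor_eq fun z => by
    have h := (hasSum_taylor f z).add (hasSum_taylor g z)
    simp only [← add_mul] at h
    exact h

theorem taylor_smul (t : ℂ) (f : W.H) : taylor (t • f) = t • taylor f :=
  taylor_eq fun z => by
    have h := (hasSum_taylor f z).mul_left t
    simp only [← mul_assoc] at h
    exact h

theorem norm_div_sqrt_sq (c : ℂ) (n : ℕ) :
    ‖c / (Real.sqrt (W.a n) : ℂ)‖ ^ 2 = ‖c‖ ^ 2 / W.a n := by
  rw [norm_div, div_pow, Complex.norm_real, Real.norm_eq_abs, sq_abs, Real.sq_sqrt (W.pos n).le]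

theorem sqrt_ne_zero (n : ℕ) : (Real.sqrt (W.a n) : ℂ) ≠ 0 :=
  Complex.ofReal_ne_zero.2 (Real.sqrt_ne_zero'.2 (W.pos n))

/-- The linear map `f ↦ (taylor f n / √(a n))_n` from `H` to `ℓ²`. -/
def toL2 : W.H →ₗ[ℂ] lp (fun _ : ℕ => ℂ) 2 where
  toFun f := ⟨fun n => taylor f n / (Real.sqrt (W.a n) : ℂ), by
    refine memℓp_gen ?_
    refine (summable_taylor f).congr fun n => ?_
    rw [← norm_div_sqrt_sq]
    simp⟩
  map_add' f g := by
    refine lp.ext (funext fun n => ?_)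
    simp only [taylor_add, Pi.add_apply, add_div]
    rfl
  map_smul' t f := by
    refine lp.ext (funext fun n => ?_)
    simp only [taylor_smul, Pi.smul_apply, smul_eq_mul, mul_div_assoc]
    rfl

theorem toL2_apply (f : W.H) (n : ℕ) : toL2 f n = taylor f n / (Real.sqrt (W.a n) : ℂ) := rfl

theorem toL2_injective : Function.Injective (toL2 (W := W)) := by
  intro f g h
  have h1 : taylor f = taylor g := by
    funext n
    have h2 := congrArg (fun x : lp (fun _ : ℕ => ℂ) 2 => x n) h
    simp only [toL2_apply] at h2
    exact (div_left_inj' (sqrt_ne_zero n)).1 h2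
  refine Subtype.ext (funext fun z => ?_)
  have h2 := hasSum_taylor f z
  rw [h1] at h2
  exact h2.unique (hasSum_taylor g z)

instance : NormedAddCommGroup W.H := NormedAddCommGroup.induced _ _ (toL2 (W := W)) toL2_injective

/-- The inner product of `H`; see `inner_eq` and `norm_sq_eq` for explicit formulas. -/
instance : InnerProductSpace ℂ W.H where
  norm_smul_le t f := by
    change ‖toL2 (t • f)‖ ≤ ‖t‖ * ‖toL2 f‖
    rw [map_smul, norm_smul]
  inner f g := inner ℂ (toL2 f) (toL2 g)
  norm_sq_eq_re_inner f := norm_sq_eq_re_inner (𝕜 := ℂ) (toL2 f)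
  conj_inner_symm f g := inner_conj_symm (toL2 f) (toL2 g)
  add_left f g h := by rw [map_add, inner_add_left]
  smul_left f g t := by rw [map_smul, inner_smul_left]

theorem inner_eq (f g : W.H) :
    inner ℂ f g = ∑' n, (starRingEnd ℂ) (taylor f n) * taylor g n / (W.a n : ℂ) := by
  change inner ℂ (toL2 f) (toL2 g) = _
  rw [lp.inner_eq_tsum]
  congr 1
  funext n
  have h : (Real.sqrt (W.a n) : ℂ) * (Real.sqrt (W.a n) : ℂ) = (W.a n : ℂ) := by
    rw [← Complex.ofReal_mul, Real.mul_self_sqrt (W.pos n).le]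
  simp only [toL2_apply, RCLike.inner_apply, map_div₀, Complex.conj_ofReal]
  rw [div_mul_div_comm, h, mul_comm]

theorem norm_sq_eq (f : W.H) : ‖f‖ ^ 2 = ∑' n, ‖taylor f n‖ ^ 2 / W.a n := by
  change ‖toL2 f‖ ^ 2 = _
  have h := lp.norm_rpow_eq_tsum (p := 2) (by simp) (toL2 f)
  simp only [ENNReal.toReal_ofNat, Real.rpow_ofNat] at h
  rw [h]
  congr 1
  funext n
  rw [toL2_apply, norm_div_sqrt_sq]

/-- Power series with `|c n|^2 / a n` summable converge absolutely on the closed disc. -/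
theorem summable_coeff {c : ℕ → ℂ} (hc : Summable (fun n => ‖c n‖ ^ 2 / W.a n)) :
    Summable (fun n => ‖c n‖) := by
  refine Summable.of_nonneg_of_le (fun n => norm_nonneg _) (fun n => ?_) (hc.add W.summable)
  have h := W.pos n
  rw [div_add' _ _ _ h.ne', le_div_iff₀ h]
  nlinarith [sq_nonneg (‖c n‖ - W.a n), norm_nonneg (c n)]

/-- The element `∑ c n z^n` of `H`. -/
def ofCoeff (c : ℕ → ℂ) (hc : Summable (fun n => ‖c n‖ ^ 2 / W.a n)) : W.H :=
  ⟨fun z => ∑' n, c n * (z : ℂ) ^ n, c, hc, fun z => by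
    refine Summable.hasSum (Summable.of_norm_bounded (summable_coeff hc) fun n => ?_)
    rw [norm_mul, norm_pow]
    refine mul_le_of_le_one_right (norm_nonneg _) (pow_le_one₀ (norm_nonneg _) ?_)
    exact (mem_ball_zero_iff.1 z.2).le⟩

theorem taylor_ofCoeff (c : ℕ → ℂ) (hc : Summable (fun n => ‖c n‖ ^ 2 / W.a n)) :
    taylor (ofCoeff c hc) = c := by
  refine taylor_eq fun z => ?_
  refine Summable.hasSum (Summable.of_norm_bounded (summable_coeff hc) fun n => ?_)
  rw [norm_mul, norm_pow]
  refine mul_le_of_le_one_right (norm_nonneg _) (pow_le_one₀ (norm_nonneg _) ?_)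
  exact (mem_ball_zero_iff.1 z.2).le

theorem toL2_surjective : Function.Surjective (toL2 (W := W)) := by
  intro x
  have hx : Summable (fun n => ‖(Real.sqrt (W.a n) : ℂ) * x n‖ ^ 2 / W.a n) := by
    have h := (lp.memℓp x).summable (by simp)
    simp only [ENNReal.toReal_ofNat, Real.rpow_ofNat] at h
    refine h.congr fun n => ?_
    rw [← norm_div_sqrt_sq, mul_div_cancel_left₀ _ (sqrt_ne_zero n)]
  refine ⟨ofCoeff _ hx, ?_⟩
  ext n
  rw [toL2_apply, taylor_ofCoeff, mul_div_cancel_left₀ _ (sqrt_ne_zero n)]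

/-- `H` is isometrically isomorphic to `ℓ²`, through `f ↦ (taylor f n / √(a n))_n`. -/
def l2Equiv : W.H ≃ₗᵢ[ℂ] lp (fun _ : ℕ => ℂ) 2 where
  toLinearEquiv := LinearEquiv.ofBijective toL2 ⟨toL2_injective, toL2_surjective⟩
  norm_map' _ := rfl

instance : CompleteSpace W.H :=
  (l2Equiv (W := W)).toIsometryEquiv.completeSpace_iff.2 inferInstance

theorem summable_kernel {w : ℂ} (hw : ‖w‖ ≤ 1) :
    Summable (fun n => ‖(W.a n : ℂ) * (starRingEnd ℂ w) ^ n‖ ^ 2 / W.a n) := by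
  refine Summable.of_nonneg_of_le (fun n => div_nonneg (by positivity) (W.pos n).le)
    (fun n => ?_) W.summable
  rw [div_le_iff₀ (W.pos n), norm_mul, norm_pow, RCLike.norm_conj, Complex.norm_real,
    Real.norm_eq_abs, abs_of_pos (W.pos n), ← sq]
  exact pow_le_pow_left₀ (mul_nonneg (W.pos n).le (by positivity))
    (mul_le_of_le_one_right (W.pos n).le (pow_le_one₀ (norm_nonneg _) hw)) 2

/-- The kernel function `k_w(z) = ∑ a n (z conj w)^n`, as an element of `H`, for any `w` in the
closed disc. -/
def kernel (W : DiscWeight) (w : ℂ) (hw : ‖w‖ ≤ 1) : W.H :=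
  ofCoeff (fun n => (W.a n : ℂ) * (starRingEnd ℂ w) ^ n) (summable_kernel hw)

/-- The reproducing property of the kernel, for points of the closed disc: the value
`f(w) = ∑ c n w^n` is given by the inner product with `k_w`. -/
theorem inner_kernel (f : W.H) {w : ℂ} (hw : ‖w‖ ≤ 1) :
    inner ℂ (kernel W w hw) f = ∑' n, taylor f n * w ^ n := by
  rw [kernel, inner_eq, taylor_ofCoeff]
  congr 1
  funext n
  have : (W.a n : ℂ) ≠ 0 := Complex.ofReal_ne_zero.2 (W.pos n).ne'
  simp only [map_mul, map_pow, Complex.conj_ofReal, Complex.conj_conj]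
  field_simp

/-- Point evaluations on `H` are bounded. -/
theorem continuous_eval (z : Disc) : Continuous (fun f : W.H => f z) := by
  have h : (fun f : W.H => f z) =
      fun f => inner ℂ (kernel W (z : ℂ) (mem_ball_zero_iff.1 z.2).le) f := by
    funext f
    rw [inner_kernel, (hasSum_taylor f z).tsum_eq]
  rw [h]
  fun_prop

/-- The normalized kernel function at the boundary point `1`. -/
def normalizedKernelOne (W : DiscWeight) : W.H :=
  ((‖kernel W 1 (by simp)‖⁻¹ : ℝ) : ℂ) • kernel W 1 (by simp)

/-! ### Multiplication operators -/

/-- `H` is invariant under multiplication by the coordinate function. -/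
theorem X_mul_mem {f : Disc → ℂ} (hf : f ∈ W.funSpace) :
    (fun z : Disc => (z : ℂ) * f z) ∈ W.funSpace := by
  obtain ⟨c, hc, hf⟩ := hf
  obtain ⟨C, hC⟩ := W.ratio.bddAbove_range
  refine ⟨fun n => Nat.casesOn n 0 c, ?_, fun z => ?_⟩
  · rw [← summable_nat_add_iff 1]
    refine Summable.of_nonneg_of_le (fun n => div_nonneg (by positivity) (W.pos _).le)
      (fun n => ?_) (hc.mul_left C)
    have h1 : W.a n / W.a (n + 1) ≤ C := hC ⟨n, rfl⟩
    calc ‖c n‖ ^ 2 / W.a (n + 1) = W.a n / W.a (n + 1) * (‖c n‖ ^ 2 / W.a n) := by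
          have := (W.pos n).ne'
          field_simp
      _ ≤ _ := mul_le_mul_of_nonneg_right h1 (div_nonneg (by positivity) (W.pos n).le)
  · rw [← hasSum_nat_add_iff' 1]
    have h := (hf z).mul_left (z : ℂ)
    have h2 : HasSum (fun n => c n * (z : ℂ) ^ (n + 1)) ((z : ℂ) * f z) := by
      have h3 : (fun n => c n * (z : ℂ) ^ (n + 1)) = fun n => (z : ℂ) * (c n * (z : ℂ) ^ n) :=
        funext fun n => by ring
      rw [h3]
      exact h
    simpa using h2

/-- `H` is invariant under multiplication by polynomials. -/
theorem poly_mul_mem (p : ℂ[X]) {f : Disc → ℂ} (hf : f ∈ W.funSpace) :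
    (fun z : Disc => p.eval (z : ℂ) * f z) ∈ W.funSpace := by
  induction p using Polynomial.induction_on' with
  | add p q hp hq =>
    have h := W.funSpace.add_mem hp hq
    convert h using 1
    funext z
    simp [add_mul]
  | monomial n t =>
    induction n generalizing f with
    | zero =>
      have h := W.funSpace.smul_mem t hf
      convert h using 1
      funext z
      simp
    | succ n ih =>
      have h := ih (X_mul_mem hf)
      convert h using 1
      funext z
      simp
      ring

/-- The multiplication operator `M_p f = p f` on `H`, for a polynomial `p`. -/
def mulOp (W : DiscWeight) (p : ℂ[X]) : W.H →L[ℂ] W.H where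
  toFun f := ⟨fun z => p.eval (z : ℂ) * f z, poly_mul_mem p f.2⟩
  map_add' f g := Subtype.ext (funext fun z => mul_add (p.eval (z : ℂ)) (f z) (g z))
  map_smul' t f := Subtype.ext (funext fun z => mul_left_comm (p.eval (z : ℂ)) t (f z))
  cont := by
    refine LinearMap.continuous_of_seq_closed_graph (E := W.H) (F := W.H)
      ⟨⟨fun f => ⟨fun z => p.eval (z : ℂ) * f z, poly_mul_mem p f.2⟩,
        fun f g => Subtype.ext (funext fun z => mul_add (p.eval (z : ℂ)) (f z) (g z))⟩,
        fun t f => Subtype.ext (funext fun z => mul_left_comm (p.eval (z : ℂ)) t (f z))⟩ ?_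
    intro F f g hf hg
    refine Subtype.ext (funext fun z => ?_)
    have h1 := ((continuous_eval z).tendsto g).comp hg
    have h2 := (((continuous_eval z).tendsto f).comp hf).const_mul (p.eval (z : ℂ))
    exact tendsto_nhds_unique h1 h2

theorem mulOp_apply (p : ℂ[X]) (f : W.H) (z : Disc) :
    mulOp W p f z = p.eval (z : ℂ) * f z := rfl

theorem mulOp_eq_aeval (p : ℂ[X]) : mulOp W p = aeval (mulOp W X) p := by
  have hmul : ∀ p q : ℂ[X], mulOp W (p * q) = mulOp W p * mulOp W q := fun p q =>
    ContinuousLinearMap.ext fun f => Subtype.ext (funext fun z => by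
      change (p * q).eval (z : ℂ) * f z = p.eval (z : ℂ) * (q.eval (z : ℂ) * f z)
      rw [eval_mul, mul_assoc])
  have hadd : ∀ p q : ℂ[X], mulOp W (p + q) = mulOp W p + mulOp W q := fun p q =>
    ContinuousLinearMap.ext fun f => Subtype.ext (funext fun z => by
      change (p + q).eval (z : ℂ) * f z = p.eval (z : ℂ) * f z + q.eval (z : ℂ) * f z
      rw [eval_add, add_mul])
  have hC : ∀ t : ℂ, mulOp W (C t) = algebraMap ℂ _ t := fun t =>
    ContinuousLinearMap.ext fun f => Subtype.ext (funext fun z => by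
      change (C t).eval (z : ℂ) * f z = t * f z
      rw [eval_C])
  induction p using Polynomial.induction_on with
  | C t => rw [hC, aeval_C]
  | add p q hp hq => rw [hadd, hp, hq, map_add]
  | monomial n t h => rw [pow_succ, ← mul_assoc, hmul, h, map_mul (aeval (mulOp W X)) (C t * X ^ n), aeval_X]

/-! ### The algebra, the operator system and the functionals -/

variable (W)

/-- The unital C*-algebra `T` generated by the multiplication operator `M_z` on `H`. -/
def T : StarSubalgebra ℂ (W.H →L[ℂ] W.H) := StarAlgebra.elemental ℂ (mulOp W X)

instance : IsClosed (W.T : Set (W.H →L[ℂ] W.H)) := StarAlgebra.elemental.isClosed ℂ (mulOp W X)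

theorem mulOp_mem (p : ℂ[X]) : mulOp W p ∈ W.T := by
  rw [mulOp_eq_aeval]
  have h : Algebra.adjoin ℂ {mulOp W X} ≤ W.T.toSubalgebra :=
    Algebra.adjoin_le (Set.singleton_subset_iff.2 (StarAlgebra.elemental.self_mem ℂ (mulOp W X)))
  exact h (aeval_mem_adjoin_singleton ℂ (mulOp W X))

/-- The multiplication operator `M_p` as an element of `T`. -/
def M (p : ℂ[X]) : W.T := ⟨mulOp W p, mulOp_mem W p⟩

/-- The operator system `S`: the closed linear span of all operators `M_p M_q^*`. -/
def S : OperatorSystem W.T where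
  toSubmodule := (Submodule.span ℂ {x | ∃ p q : ℂ[X], x = W.M p * star (W.M q)}).topologicalClosure
  one_mem' := by
    refine Submodule.le_topologicalClosure _ (Submodule.subset_span ⟨1, 1, ?_⟩)
    have h : W.M 1 = 1 := Subtype.ext (by
      change mulOp W 1 = 1
      rw [mulOp_eq_aeval, map_one])
    rw [h, star_one, mul_one]
  star_mem' := by
    intro x hx
    refine map_mem_closure (s := (Submodule.span ℂ {x | ∃ p q : ℂ[X], x = W.M p * star (W.M q)} :
      Set W.T)) continuous_star hx fun y hy => ?_
    induction hy using Submodule.span_induction with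
    | mem y hy =>
      obtain ⟨p, q, rfl⟩ := hy
      exact Submodule.subset_span ⟨q, p, by simp⟩
    | zero => simp
    | add y z _ _ hy hz => rw [star_add]; exact Submodule.add_mem _ hy hz
    | smul t y _ hy => rw [star_smul]; exact Submodule.smul_mem _ _ hy
  isClosed' := Submodule.isClosed_topologicalClosure _

/-- The identity representation of `T` on `H`. -/
def idRep : W.T →⋆ₐ[ℂ] (W.H →L[ℂ] W.H) := W.T.subtype

/-- `ρ : T → C(𝕋)` is the symbol homomorphism: it is surjective, its kernel consists of all compact
operators on `H` (all of which belong to `T`), and it maps `M_p` to `p|_𝕋`. -/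
def IsSymbolMap (ρ : W.T →⋆ₐ[ℂ] C(Circle, ℂ)) : Prop :=
  (∀ (p : ℂ[X]) (ζ : Circle), ρ (W.M p) ζ = p.eval (ζ : ℂ)) ∧
  Function.Surjective ρ ∧
  (∀ x : W.T, ρ x = 0 ↔ IsCompactOperator (x : W.H →L[ℂ] W.H)) ∧
  (∀ x : W.H →L[ℂ] W.H, IsCompactOperator x → x ∈ W.T)

variable {W} in
/-- The character `δ` of `T`: evaluation of the symbol at `1`. -/
def evalOne (ρ : W.T →⋆ₐ[ℂ] C(Circle, ℂ)) : W.T →⋆ₐ[ℂ] ℂ :=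
  (ContinuousMap.evalStarAlgHom ℂ ℂ (1 : Circle)).comp ρ

/-- The functional `φ = δ|_S`. -/
def phi (ρ : W.T →⋆ₐ[ℂ] C(Circle, ℂ)) : W.S.toSubmodule →ₗ[ℂ] ℂ :=
  (evalOne ρ).toAlgHom.toLinearMap.comp W.S.toSubmodule.subtype

/-- The vector state `ψ` of `T` at the normalized kernel function at `1`. (Mathlib's inner product
is conjugate-linear in the first variable.) -/
def psi : W.T →ₚ[ℂ] ℂ := PositiveLinearMap.mk₀
  { toFun := fun x => inner ℂ (normalizedKernelOne W)
      ((x : W.H →L[ℂ] W.H) (normalizedKernelOne W))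
    map_add' := fun x y => inner_add_right _ _ _
    map_smul' := fun t x => inner_smul_right _ _ _ }
  (fun x hx => by
    have h : (0 : W.H →L[ℂ] W.H) ≤ (x : W.H →L[ℂ] W.H) := hx
    exact ((ContinuousLinearMap.nonneg_iff_isPositive _).1 h).inner_nonneg_right _)

end DiscWeight

end

/-! Write `e n = √(a n) z^n`. In this orthonormal basis `A = M_z` is a weighted shift with weights
`√(a n / a (n+1))`, which are bounded below and tend to 1. Hence `A*A` is invertible, `1 - A (A*A)⁻¹
A*` is the projection onto `e 0`, and conjugating it by powers of `A` puts every rank one operator,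
so every compact operator, into `T`. Moreover `A` is a compact perturbation of the unilateral shift,
so each element of `T` is a Toeplitz operator with continuous symbol plus a compact operator. The
symbol is determined because Toeplitz operators have approximate eigenvectors that compact operators
do not see (`HasSymbol.norm_le`).

Summability of `a` puts the kernel `k_1` in `H`, where `A* k_1 = k_1`. In `M_p M_q^*` the adjoint
stands on the right, so `ψ` and `δ` agree on `S`; they differ on the projection onto `k_1`, which
`δ` kills. Thus `δ` is not a boundary representation. A state extending `φ` vanishes at `(A - 1)(A -
1)*`. By Cauchy–Schwarz it absorbs `A` on the left and `A*` on the right. Since the fixed space of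
`A*` is spanned by `k_1`, it is a multiple of `ψ` on compact operators, and the remainder factors
through the symbol and is a multiple of `δ` (`eq_psi_add_evalOne`). Purity of `φ` is the same
Cauchy–Schwarz argument inside `S`.

For the boundary property, let `b` be the Pick coefficients and `R_N = 1 - ∑ b m A^(m+1) A*^(m+1)`,
summed over `m < N`. These lie in `S`, are diagonal with eigenvalues in `[0, 1]`, dominate the
projection `E` onto `e 0`, and decrease to it in quadratic form. Also `1 - c⁻¹ A A* ≤ E` for a
suitable `c`. Conjugating by `M_p` squeezes `Φ (v ⊗ v)` to `v ⊗ v` for every positive map `Φ` fixing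
`S` and every `v = p e 0`. Density and monotone approximation of `s* s` by finite rank operators
then give `Φ x ≥ x` for `x ≥ 0`, and applying this to `‖x‖ - x` gives equality
(`map_eq_of_eq_on_S`). The coefficients are nonnegative by hypothesis, or for power weights by
Kaluza's lemma.

For the C*-envelope, let `j : S → B` be unital and completely isometric. The matrix state of `e 0,
…, e N` on `M_(N+1)(T)` is transported along `j` and extended by Hahn–Banach to `M_(N+1)(B)`; its
GNS space carries a representation `σ` of `B` and vectors `ξ i` with the same matrix coefficients.
Equal coefficients alone do not determine `σ (j x) ξ i`. The missing norm bound comes from the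
positive contractions `a k A^k R_L A*^k` of `S`: these fix `e k`, and their further compressions by
`A^m` have norm no larger than their value at `e (m+k)`. Equality in Cauchy–Schwarz then forces `σ
(j (A^m A*^n))` to act on `ξ i` exactly as `A^m A*^n` acts on `e i`. As `N → ∞`, the pairs in `B ×
T` intertwined by `e i ↦ ξ i` form a closed *-algebra on which the first component dominates the
second in norm. It is the graph of the required homomorphism (`isCStarEnvelope_S`). -/

noncomputable section

open InnerProductSpace ContinuousLinearMap

namespace DiscWeight

variable {W : DiscWeight}

/-! ### The orthonormal basis and the weighted shift -/

/-- The orthonormal basis `√(a n) z^n` of `H`. -/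
def basis (W : DiscWeight) : HilbertBasis ℕ ℂ W.H := HilbertBasis.ofRepr l2Equiv

theorem inner_basis (n : ℕ) (f : W.H) :
    ⟪W.basis n, f⟫_ℂ = taylor f n / (Real.sqrt (W.a n) : ℂ) := by
  rw [← HilbertBasis.repr_apply_apply]
  rfl

theorem ext_basis {f g : W.H} (h : ∀ n, ⟪W.basis n, f⟫_ℂ = ⟪W.basis n, g⟫_ℂ) : f = g := by
  refine W.basis.repr.injective (lp.ext (funext fun n => ?_))
  rw [HilbertBasis.repr_apply_apply, HilbertBasis.repr_apply_apply, h]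

theorem inner_basis_basis (m n : ℕ) : ⟪W.basis m, W.basis n⟫_ℂ = if m = n then 1 else 0 :=
  orthonormal_iff_ite.1 W.basis.orthonormal m n

theorem norm_basis (n : ℕ) : ‖W.basis n‖ = 1 := W.basis.orthonormal.1 n

theorem hasSum_norm_sq (f : W.H) : HasSum (fun n => ‖⟪W.basis n, f⟫_ℂ‖ ^ 2) (‖f‖ ^ 2) := by
  have h := W.basis.hasSum_inner_mul_inner f f
  have h2 : HasSum (fun n => ((‖⟪W.basis n, f⟫_ℂ‖ ^ 2 : ℝ) : ℂ)) ((‖f‖ ^ 2 : ℝ) : ℂ) := by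
    have e1 : (fun n => ((‖⟪W.basis n, f⟫_ℂ‖ ^ 2 : ℝ) : ℂ)) =
        fun n => ⟪f, W.basis n⟫_ℂ * ⟪W.basis n, f⟫_ℂ := funext fun n => by
      rw [← inner_conj_symm f (W.basis n), Complex.conj_mul']
      push_cast; rfl
    have e2 : ((‖f‖ ^ 2 : ℝ) : ℂ) = ⟪f, f⟫_ℂ := by
      rw [inner_self_eq_norm_sq_to_K]; push_cast; rfl
    rw [e1, e2]
    exact h
  exact Complex.hasSum_ofReal.1 h2

theorem basis_induction {p : W.H → Prop} (hc : IsClosed {f | p f}) (hb : ∀ n, p (W.basis n))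
    (hadd : ∀ f g, p f → p g → p (f + g)) (hsmul : ∀ (t : ℂ) f, p f → p (t • f)) (f : W.H) :
    p f := by
  have h0 : p 0 := by simpa using hsmul 0 _ (hb 0)
  have h : (Submodule.span ℂ (Set.range W.basis) : Set W.H) ⊆ {f | p f} := fun g hg => by
    induction hg using Submodule.span_induction with
    | mem x hx => obtain ⟨n, rfl⟩ := hx; exact hb n
    | zero => exact h0
    | add x y _ _ hx hy => exact hadd x y hx hy
    | smul t x _ hx => exact hsmul t x hx
  have h2 := closure_minimal h hc
  rw [← Submodule.topologicalClosure_coe, W.basis.dense_span] at h2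
  exact h2 trivial

theorem taylor_mulOp_X (f : W.H) :
    taylor (mulOp W X f) = fun n => Nat.casesOn n 0 (taylor f) := by
  refine taylor_eq fun z => ?_
  rw [← hasSum_nat_add_iff' 1]
  have h := (hasSum_taylor f z).mul_left (z : ℂ)
  have h2 : HasSum (fun n => taylor f n * (z : ℂ) ^ (n + 1)) ((z : ℂ) * f z) := by
    have h3 : (fun n => taylor f n * (z : ℂ) ^ (n + 1)) =
        fun n => (z : ℂ) * (taylor f n * (z : ℂ) ^ n) := funext fun n => by ring
    rw [h3]
    exact h
  simpa [mulOp_apply] using h2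

/-- The weight quotient `√(a k / a (k + m))`. -/
def wt (W : DiscWeight) (k m : ℕ) : ℝ := Real.sqrt (W.a k / W.a (k + m))

theorem wt_pos (k m : ℕ) : 0 < W.wt k m := Real.sqrt_pos.2 (div_pos (W.pos _) (W.pos _))

theorem wt_sq (k m : ℕ) : W.wt k m ^ 2 = W.a k / W.a (k + m) :=
  Real.sq_sqrt (div_pos (W.pos _) (W.pos _)).le

theorem wt_eq (k m : ℕ) : W.wt k m = Real.sqrt (W.a k) / Real.sqrt (W.a (k + m)) :=
  Real.sqrt_div (W.pos _).le _

theorem wt_zero (k : ℕ) : W.wt k 0 = 1 := by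
  simp [wt, div_self (W.pos k).ne']

theorem wt_mul (k m n : ℕ) : W.wt k m * W.wt (k + m) n = W.wt k (m + n) := by
  have h : Real.sqrt (W.a (k + m)) ≠ 0 := Real.sqrt_ne_zero'.2 (W.pos _)
  rw [wt_eq, wt_eq, wt_eq, div_mul_div_cancel₀ h, add_assoc]

theorem mulOp_X_basis (n : ℕ) : mulOp W X (W.basis n) = (W.wt n 1 : ℂ) • W.basis (n + 1) := by
  have hb : taylor (W.basis n) = fun k => if k = n then (Real.sqrt (W.a n) : ℂ) else 0 := by
    funext k
    have h := inner_basis k (W.basis n)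
    rw [inner_basis_basis, eq_div_iff (sqrt_ne_zero k)] at h
    rw [← h]
    split_ifs with h1
    · rw [h1, one_mul]
    · rw [zero_mul]
  refine ext_basis fun k => ?_
  rw [inner_basis, taylor_mulOp_X, inner_smul_right, inner_basis_basis, hb]
  cases k with
  | zero => simp
  | succ k =>
    by_cases h : k = n
    · subst h
      simp [wt_eq]
    · simp [h]

theorem mulOp_mul (p q : ℂ[X]) : mulOp W (p * q) = mulOp W p * mulOp W q := by
  rw [mulOp_eq_aeval, map_mul, ← mulOp_eq_aeval, ← mulOp_eq_aeval]

theorem mulOp_X_pow (m : ℕ) : mulOp W (X ^ m) = mulOp W X ^ m := by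
  rw [mulOp_eq_aeval, map_pow, aeval_X]

theorem mulOp_pow_basis (m n : ℕ) :
    (mulOp W X ^ m) (W.basis n) = (W.wt n m : ℂ) • W.basis (n + m) := by
  induction m with
  | zero => simp [wt_zero]
  | succ m ih =>
    rw [pow_succ', mul_apply_eq_comp, ih, map_smul, mulOp_X_basis, smul_smul, ← wt_mul]
    push_cast
    rfl

theorem inner_basis_star_pow (k m : ℕ) (f : W.H) :
    ⟪W.basis k, (star (mulOp W X ^ m)) f⟫_ℂ = W.wt k m * ⟪W.basis (k + m), f⟫_ℂ := by
  rw [star_eq_adjoint, adjoint_inner_right, mulOp_pow_basis, inner_smul_left, Complex.conj_ofReal]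

theorem star_pow_basis_add (m n : ℕ) :
    (star (mulOp W X ^ m)) (W.basis (n + m)) = (W.wt n m : ℂ) • W.basis n := by
  refine ext_basis fun k => ?_
  rw [inner_basis_star_pow, inner_smul_right, inner_basis_basis, inner_basis_basis]
  by_cases h : k = n
  · simp [h]
  · simp [h]

theorem star_pow_basis_of_lt {m n : ℕ} (h : n < m) :
    (star (mulOp W X ^ m)) (W.basis n) = 0 := by
  refine ext_basis fun k => ?_
  rw [inner_basis_star_pow, inner_basis_basis, if_neg (by omega)]
  simp

/-- The inverse ratios converge, hence are bounded above. This makes `M_z` bounded below and also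
supplies the constant in `exists_one_sub_le_rankOne`. -/
theorem exists_ratio_lower : ∃ c : ℝ, 0 < c ∧ ∀ n, c ≤ W.a n / W.a (n + 1) := by
  have h : Tendsto (fun n => (W.a n / W.a (n + 1))⁻¹) atTop (𝓝 1⁻¹) := W.ratio.inv₀ one_ne_zero
  obtain ⟨C, hC⟩ := h.bddAbove_range
  have hp : ∀ n, 0 < W.a n / W.a (n + 1) := fun n => div_pos (W.pos _) (W.pos _)
  have hC' : ∀ n, (W.a n / W.a (n + 1))⁻¹ ≤ C := fun n => hC ⟨n, rfl⟩
  have h0 : 0 < C := (inv_pos.2 (hp 0)).trans_le (hC' 0)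
  exact ⟨C⁻¹, inv_pos.2 h0, fun n => inv_le_of_inv_le₀ (hp n) (hC' n)⟩

theorem inner_basis_zero_mulOp_X (f : W.H) : ⟪W.basis 0, mulOp W X f⟫_ℂ = 0 := by
  rw [← adjoint_inner_left, ← star_eq_adjoint]
  have := star_pow_basis_of_lt (W := W) (m := 1) (n := 0) one_pos
  rw [pow_one] at this
  rw [this, inner_zero_left]

theorem inner_basis_succ_mulOp_X (k : ℕ) (f : W.H) :
    ⟪W.basis (k + 1), mulOp W X f⟫_ℂ = W.wt k 1 * ⟪W.basis k, f⟫_ℂ := by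
  rw [← adjoint_inner_left, ← star_eq_adjoint]
  have := star_pow_basis_add (W := W) 1 k
  rw [pow_one] at this
  rw [this, inner_smul_left, Complex.conj_ofReal]

theorem norm_sq_le_norm_mulOp_X_sq {c : ℝ} (hc : ∀ n, c ≤ W.a n / W.a (n + 1)) (f : W.H) :
    c * ‖f‖ ^ 2 ≤ ‖mulOp W X f‖ ^ 2 := by
  have h1 := (hasSum_norm_sq f).mul_left c
  have h2 := hasSum_norm_sq (mulOp W X f)
  rw [← hasSum_nat_add_iff' 1] at h2
  simp only [Finset.range_one, Finset.sum_singleton, inner_basis_zero_mulOp_X,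
    inner_basis_succ_mulOp_X] at h2
  rw [norm_zero, zero_pow two_ne_zero, sub_zero] at h2
  refine hasSum_le (fun n => ?_) h1 h2
  rw [norm_mul, mul_pow, Complex.norm_real, Real.norm_eq_abs, sq_abs, wt_sq]
  exact mul_le_mul_of_nonneg_right (hc n) (by positivity)

/-- `A` is bounded below, so `A*A` is invertible and `1 - A (A*A)⁻¹ A*` is the projection onto the
complement of the range of `A`, which is spanned by `e 0`. -/
theorem rankOne_basis_zero_mem : rankOne ℂ (W.basis 0) (W.basis 0) ∈ W.T := by
  obtain ⟨c, hc0, hc⟩ := exists_ratio_lower (W := W)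
  set A := mulOp W X with hA
  have hAT : A ∈ W.T := StarAlgebra.elemental.self_mem ℂ A
  have hu : IsUnit (star A * A) := by
    refine isUnit_of_forall_le_norm_inner_map _ (c := ⟨c, hc0.le⟩) hc0 fun f => ?_
    rw [mul_apply_eq_comp, star_eq_adjoint, adjoint_inner_left, inner_self_eq_norm_sq_to_K]
    have := norm_sq_le_norm_mulOp_X_sq hc f
    rw [mul_comm]
    simpa using! this
  -- Spectral permanence: the inverse of `A*A` taken in all bounded operators already lies in the
  -- C*-subalgebra.
  obtain ⟨v, hv⟩ : IsUnit (⟨star A * A, mul_mem (star_mem hAT) hAT⟩ : W.T) :=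
    (StarSubalgebra.coe_isUnit W.T).1 hu
  have hv1 : (((v⁻¹ : W.Tˣ) : W.T) : W.H →L[ℂ] W.H) * (star A * A) = 1 := by
    have := congrArg (fun x : W.T => (x : W.H →L[ℂ] W.H)) (v.inv_mul)
    rw [hv] at this
    exact this
  set B : W.H →L[ℂ] W.H := (((v⁻¹ : W.Tˣ) : W.T) : W.H →L[ℂ] W.H) with hB
  have hBT : B ∈ W.T := ((v⁻¹ : W.Tˣ) : W.T).2
  have key : rankOne ℂ (W.basis 0) (W.basis 0) = 1 - A * B * star A := by
    ext1 f
    induction f using basis_induction with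
    | hc => exact isClosed_eq (by fun_prop) (by fun_prop)
    | hb n =>
      cases n with
      | zero =>
        have := star_pow_basis_of_lt (W := W) (m := 1) (n := 0) one_pos
        rw [pow_one, ← hA] at this
        rw [sub_apply, mul_apply_eq_comp, this, (A * B).map_zero, sub_zero, rankOne_apply,
          inner_basis_basis, if_pos rfl, one_smul]
        rfl
      | succ n =>
        have h1 : W.basis (n + 1) = ((W.wt n 1 : ℂ)⁻¹) • A (W.basis n) := by
          rw [hA, mulOp_X_basis, smul_smul, inv_mul_cancel₀, one_smul]
          exact Complex.ofReal_ne_zero.2 (wt_pos n 1).ne'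
        have h2 : (A * B * star A) (A (W.basis n)) = A (W.basis n) := by
          change (A * B * star A * A) (W.basis n) = _
          rw [mul_assoc, mul_assoc, hv1, mul_one]
        rw [rankOne_apply, inner_basis_basis, if_neg (by omega), zero_smul, h1, map_smul,
          sub_apply, h2]
        simp
    | hadd f g hf hg => rw [map_add, map_add, hf, hg]
    | hsmul t f hf => rw [map_smul, map_smul, hf]
  rw [key]
  exact sub_mem (one_mem _) (mul_mem (mul_mem hAT hBT) (star_mem hAT))

theorem rankOne_conj {E : Type*} [NormedAddCommGroup E] [InnerProductSpace ℂ E] [CompleteSpace E]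
    (a b : E →L[ℂ] E) (f g : E) : a * rankOne ℂ f g * star b = rankOne ℂ (a f) (b g) := by
  ext h
  simp [star_eq_adjoint, adjoint_inner_right]

theorem star_rankOne {E : Type*} [NormedAddCommGroup E] [InnerProductSpace ℂ E] [CompleteSpace E]
    (f g : E) : star (rankOne ℂ f g) = rankOne ℂ g f := by
  rw [star_eq_adjoint, eq_comm, eq_adjoint_iff]
  intro x y
  simp [inner_smul_left, inner_smul_right, mul_comm]

/-- `A^m (e 0 ⊗ e 0) A*^n` is a nonzero multiple of `e m ⊗ e n`; the rest is linearity and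
closedness in each variable. -/
theorem rankOne_mem (f g : W.H) : rankOne ℂ f g ∈ W.T := by
  have hcl : IsClosed (W.T : Set (W.H →L[ℂ] W.H)) := inferInstance
  have hb : ∀ m n, rankOne ℂ (W.basis m) (W.basis n) ∈ W.T := fun m n => by
    have h := mul_mem (mul_mem (pow_mem (mulOp_mem W X) m) rankOne_basis_zero_mem)
      (star_mem (pow_mem (mulOp_mem W X) n))
    rw [rankOne_conj, mulOp_pow_basis, mulOp_pow_basis, zero_add, zero_add] at h
    have h0 : ∀ k, (W.wt 0 k : ℂ) ≠ 0 := fun k => Complex.ofReal_ne_zero.2 (wt_pos 0 k).ne'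
    have h1 := W.T.smul_mem h ((W.wt 0 m : ℂ)⁻¹ * (W.wt 0 n : ℂ)⁻¹)
    have h2 := h0 m
    have h3 := h0 n
    convert h1 using 1
    ext x
    simp only [smul_apply, rankOne_apply, inner_smul_left, Complex.conj_ofReal, smul_smul]
    congr 1
    field_simp
  have h1 : ∀ m g, rankOne ℂ (W.basis m) g ∈ W.T := fun m g => by
    induction g using basis_induction with
    | hc => exact hcl.preimage (by fun_prop)
    | hb n => exact hb m n
    | hadd f g hf hg => rw [map_add]; exact add_mem hf hg
    | hsmul t f hf => rw [map_smulₛₗ]; exact W.T.smul_mem hf _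
  induction f using basis_induction with
  | hc => exact hcl.preimage (by fun_prop)
  | hb n => exact h1 n g
  | hadd f g hf hg => rw [map_add, add_apply]; exact add_mem hf hg
  | hsmul t f hf => rw [map_smul, smul_apply]; exact W.T.smul_mem hf _

/-! ### Compact operators -/

/-- The truncation `∑ n < N, e n ⊗ e n`. -/
def trunc (W : DiscWeight) (N : ℕ) : W.H →L[ℂ] W.H :=
  ∑ n ∈ Finset.range N, rankOne ℂ (W.basis n) (W.basis n)

theorem trunc_apply (N : ℕ) (f : W.H) :
    W.trunc N f = ∑ n ∈ Finset.range N, ⟪W.basis n, f⟫_ℂ • W.basis n := by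
  simp [trunc, sum_apply]

theorem tendsto_trunc (f : W.H) : Tendsto (fun N => W.trunc N f) atTop (𝓝 f) := by
  simp only [trunc_apply, ← HilbertBasis.repr_apply_apply]
  exact (W.basis.hasSum_repr f).tendsto_sum_nat

theorem inner_basis_trunc (N k : ℕ) (f : W.H) :
    ⟪W.basis k, W.trunc N f⟫_ℂ = if k < N then ⟪W.basis k, f⟫_ℂ else 0 := by
  rw [trunc_apply, inner_sum]
  simp [inner_basis_basis]

theorem hasSum_norm_sq_trunc_sub (N : ℕ) (f : W.H) :
    HasSum (fun k => if k < N then 0 else ‖⟪W.basis k, f⟫_ℂ‖ ^ 2) (‖f - W.trunc N f‖ ^ 2) := by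
  have h := hasSum_norm_sq (f - W.trunc N f)
  convert h using 1
  funext k
  rw [inner_sub_right, inner_basis_trunc]
  split_ifs <;> simp

theorem norm_sub_trunc_le (N : ℕ) (f : W.H) : ‖f - W.trunc N f‖ ≤ ‖f‖ := by
  refine le_of_sq_le_sq ?_ (norm_nonneg _)
  refine hasSum_le (fun k => ?_) (hasSum_norm_sq_trunc_sub N f) (hasSum_norm_sq f)
  split_ifs
  · positivity
  · exact le_rfl

/-- Truncations converge strongly and `1 - trunc N` is a contraction, so the convergence is uniform
on the relatively compact image of the unit ball. -/
theorem tendsto_trunc_mul {k : W.H →L[ℂ] W.H} (hk : IsCompactOperator k) :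
    Tendsto (fun N => W.trunc N * k) atTop (𝓝 k) := by
  obtain ⟨K, hK, hKs⟩ := hk.image_closedBall_subset_compact (f := (k : W.H →ₗ[ℂ] W.H)) 1
  rw [tendsto_iff_norm_sub_tendsto_zero, Metric.tendsto_atTop]
  intro ε hε
  -- On a net of mesh `ε / 4`, the distance to the nearest centre and the error at that centre each
  -- contribute at most `ε / 4`.
  obtain ⟨t, -, ht, hcov⟩ := hK.finite_cover_balls (e := ε / 4) (by positivity)
  have h1 : ∀ᶠ N in atTop, ∀ c ∈ t, ‖W.trunc N c - c‖ < ε / 4 :=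
    (eventually_all_finite ht).2 fun c _ =>
      (tendsto_iff_norm_sub_tendsto_zero.1 (tendsto_trunc c)).eventually_lt_const (by positivity)
  obtain ⟨N₀, hN₀⟩ := eventually_atTop.1 h1
  refine ⟨N₀, fun N hN => ?_⟩
  rw [Real.dist_eq, sub_zero, abs_of_nonneg (norm_nonneg _)]
  refine lt_of_le_of_lt (b := ε / 2) ?_ (by linarith)
  refine opNorm_le_of_unit_norm (by positivity) fun x hx => ?_
  have hkx : k x ∈ K := hKs ⟨x, by simp [hx], rfl⟩
  obtain ⟨c, hc, hxc⟩ := Set.mem_iUnion₂.1 (hcov hkx)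
  rw [Metric.mem_ball, dist_eq_norm] at hxc
  have h2 := norm_sub_trunc_le N (k x - c)
  have h3 := hN₀ N hN c hc
  have h4 : (W.trunc N * k - k) x = -(k x - c - W.trunc N (k x - c)) + (W.trunc N c - c) := by
    simp only [sub_apply, mul_apply_eq_comp, map_sub]
    abel
  rw [h4]
  refine (norm_add_le _ _).trans ?_
  rw [norm_neg]
  linarith

theorem trunc_mul (N : ℕ) (k : W.H →L[ℂ] W.H) :
    W.trunc N * k = ∑ n ∈ Finset.range N, rankOne ℂ (W.basis n) (star k (W.basis n)) := by
  rw [trunc, Finset.sum_mul]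
  refine Finset.sum_congr rfl fun n _ => ?_
  have h := rankOne_conj 1 (star k) (W.basis n) (W.basis n)
  rwa [one_mul, star_star, one_apply_eq_self] at h

theorem mem_T_of_isCompactOperator {k : W.H →L[ℂ] W.H} (hk : IsCompactOperator k) : k ∈ W.T := by
  have hcl : IsClosed (W.T : Set (W.H →L[ℂ] W.H)) := inferInstance
  refine hcl.mem_of_tendsto (tendsto_trunc_mul hk) (Eventually.of_forall fun N => ?_)
  rw [trunc_mul]
  exact sum_mem fun n _ => rankOne_mem _ _

theorem isCompactOperator_rankOne {E F : Type*} [NormedAddCommGroup E] [InnerProductSpace ℂ E]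
    [NormedAddCommGroup F] [InnerProductSpace ℂ F] (f : E) (g : F) :
    IsCompactOperator (rankOne ℂ f g) := by
  exact (isCompactOperator_of_locallyCompactSpace_rng
    (toSpanSingleton ℂ f : ℂ →L[ℂ] E)).comp_clm (innerSL ℂ g)

theorem isCompactOperator_sum {ι E F : Type*} [NormedAddCommGroup E] [InnerProductSpace ℂ E]
    [NormedAddCommGroup F] [InnerProductSpace ℂ F] (s : Finset ι) (k : ι → E →L[ℂ] F)
    (h : ∀ i ∈ s, IsCompactOperator (k i)) :
    IsCompactOperator (∑ i ∈ s, k i : E →L[ℂ] F) := by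
  classical
  induction s using Finset.induction_on with
  | empty => simpa using isCompactOperator_zero
  | insert i s hi ih =>
    rw [Finset.sum_insert hi]
    exact (h i (Finset.mem_insert_self i s)).add
      (ih fun j hj => h j (Finset.mem_insert_of_mem hj))

/-- A compact operator is the norm limit of its truncations, and the adjoints of these have finite
rank. -/
theorem isCompactOperator_star {k : W.H →L[ℂ] W.H} (hk : IsCompactOperator k) :
    IsCompactOperator (star k : W.H →L[ℂ] W.H) := by
  refine isCompactOperator_of_tendsto ((continuous_star.tendsto _).comp (tendsto_trunc_mul hk))
    (Eventually.of_forall fun N => ?_)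
  simp only [Function.comp, trunc_mul, star_sum, star_rankOne]
  exact isCompactOperator_sum _ _ fun n _ => isCompactOperator_rankOne _ _

/-- An operator which is a norm limit of its truncations is compact. -/
theorem isCompactOperator_of_tendsto_trunc {k : W.H →L[ℂ] W.H}
    (h : Tendsto (fun N => W.trunc N * k) atTop (𝓝 k)) : IsCompactOperator k := by
  refine isCompactOperator_of_tendsto h (Eventually.of_forall fun N => ?_)
  rw [trunc_mul]
  exact isCompactOperator_sum _ _ fun n _ => isCompactOperator_rankOne _ _

end DiscWeight

/-! ### A representation of `C(𝕋)` containing the unilateral shift -/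

/-- The coordinate function on the circle. -/
def circleCoord : C(Circle, ℂ) := ⟨fun ζ => (ζ : ℂ), continuous_subtype_val⟩

theorem circleCoord_apply (ζ : Circle) : circleCoord ζ = (ζ : ℂ) := rfl

theorem star_circleCoord_mul : star circleCoord * circleCoord = 1 := by
  ext ζ
  simp [circleCoord_apply, Complex.conj_mul', Circle.norm_coe]

theorem elemental_circleCoord : StarAlgebra.elemental ℂ circleCoord = ⊤ := by
  refine ContinuousMap.starSubalgebra_topologicalClosure_eq_top_of_separatesPoints _ ?_
  intro x y hxy
  refine ⟨circleCoord, ⟨circleCoord, StarAlgebra.self_mem_adjoin_singleton ℂ _, rfl⟩, ?_⟩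
  exact fun h => hxy (Subtype.ext h)

theorem circle_induction {p : C(Circle, ℂ) → Prop} (hc : IsClosed {f | p f})
    (coord : p circleCoord) (const : ∀ t : ℂ, p (algebraMap ℂ _ t))
    (star : ∀ f, p f → p (star f)) (add : ∀ f g, p f → p g → p (f + g))
    (mul : ∀ f g, p f → p g → p (f * g)) (f : C(Circle, ℂ)) : p f := by
  have hf : f ∈ StarAlgebra.elemental ℂ circleCoord := by
    rw [elemental_circleCoord]; trivial
  induction hf using StarAlgebra.elemental.induction_on with
  | self => exact coord
  | star_self => exact star _ coord
  | algebraMap r => exact const r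
  | add u _ v _ hu hv => exact add u v hu hv
  | mul u _ v _ hu hv => exact mul u v hu hv
  | closure s _ h v hv => exact closure_minimal (fun u hu => h u hu) hc hv

/-- Integration against the normalized Haar measure, as a positive functional on `C(𝕋)`. -/
def haarFunctional : C(Circle, ℂ) →ₚ[ℂ] ℂ := PositiveLinearMap.mk₀
  { toFun := fun f => ∫ x : AddCircle (1 : ℝ), f (AddCircle.toCircle x) ∂AddCircle.haarAddCircle
    map_add' := fun f g => by
      refine MeasureTheory.integral_add ?_ ?_ <;>
      · refine Continuous.integrable_of_hasCompactSupport ?_ (HasCompactSupport.of_compactSpace _)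
        exact (map_continuous _).comp AddCircle.continuous_toCircle
    map_smul' := fun t f => MeasureTheory.integral_const_mul t _ }
  (fun f hf => MeasureTheory.integral_nonneg fun x => hf _)

/-- The Hilbert space of square integrable functions on the circle. -/
abbrev CircleSpace : Type := haarFunctional.GNS

/-- Multiplication by continuous functions on `CircleSpace`. -/
def circleMul : C(Circle, ℂ) →⋆ₐ[ℂ] (CircleSpace →L[ℂ] CircleSpace) :=
  haarFunctional.gnsStarAlgHom

/-- The functions `z ^ n`, as elements of `CircleSpace`. -/
def circlePow (n : ℕ) : CircleSpace := (haarFunctional.toPreGNS (circleCoord ^ n) :)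

theorem circleMul_circlePow (n : ℕ) :
    circleMul circleCoord (circlePow n) = circlePow (n + 1) := by
  simp [circleMul, circlePow, pow_succ']

theorem haarFunctional_star_mul (m n : ℕ) :
    haarFunctional (star (circleCoord ^ m) * circleCoord ^ n) = if m = n then 1 else 0 := by
  have h := orthonormal_iff_ite.1 (orthonormal_fourier (T := (1 : ℝ))) m n
  rw [fourierLp, fourierLp, MeasureTheory.ContinuousMap.inner_toLp] at h
  simp only [Nat.cast_inj] at h
  rw [← h]
  refine MeasureTheory.integral_congr_ae (MeasureTheory.ae_of_all _ fun x => ?_)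
  simp [circleCoord_apply, fourier_apply, mul_comm, AddCircle.toCircle_nsmul]

theorem orthonormal_circlePow : Orthonormal ℂ circlePow := by
  rw [orthonormal_iff_ite]
  intro m n
  rw [circlePow, circlePow, UniformSpace.Completion.inner_coe, PositiveLinearMap.preGNS_inner_def]
  exact haarFunctional_star_mul m n

namespace DiscWeight

variable {W : DiscWeight}

/-- The isometry from `H` to `CircleSpace` which maps `√(a n) z ^ n` to `z ^ n`. -/
def toCircleSpace (W : DiscWeight) : W.H →ₗᵢ[ℂ] CircleSpace :=
  orthonormal_circlePow.orthogonalFamily.linearIsometry.comp W.basis.repr.toLinearIsometry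

theorem toCircleSpace_basis (n : ℕ) : W.toCircleSpace (W.basis n) = circlePow n := by
  simp [toCircleSpace, HilbertBasis.repr_self]

/-- The isometry from `H` to `CircleSpace`, as a bounded operator. -/
def toCircleCLM (W : DiscWeight) : W.H →L[ℂ] CircleSpace :=
  W.toCircleSpace.toContinuousLinearMap

theorem toCircleCLM_basis (n : ℕ) : W.toCircleCLM (W.basis n) = circlePow n :=
  toCircleSpace_basis n

theorem adjoint_comp_toCircleCLM : adjoint W.toCircleCLM ∘L W.toCircleCLM = 1 :=
  (norm_map_iff_adjoint_comp_self _).1 W.toCircleSpace.norm_map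

/-- The Toeplitz operator with a continuous symbol. -/
def toeplitz (W : DiscWeight) : C(Circle, ℂ) →ₗ[ℂ] (W.H →L[ℂ] W.H) where
  toFun f := adjoint W.toCircleCLM ∘L circleMul f ∘L W.toCircleCLM
  map_add' f g := by rw [map_add, ContinuousLinearMap.add_comp, ContinuousLinearMap.comp_add]
  map_smul' t f := by
    rw [map_smul, ContinuousLinearMap.smul_comp, ContinuousLinearMap.comp_smul]
    rfl

theorem toeplitz_def (f : C(Circle, ℂ)) :
    W.toeplitz f = adjoint W.toCircleCLM ∘L circleMul f ∘L W.toCircleCLM := rfl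

theorem continuous_circleMul : Continuous circleMul := map_continuous _

theorem continuous_toeplitz : Continuous W.toeplitz := by
  have h := continuous_circleMul
  change Continuous fun f => adjoint W.toCircleCLM ∘L circleMul f ∘L W.toCircleCLM
  fun_prop

theorem toeplitz_one : W.toeplitz 1 = 1 := by
  rw [toeplitz_def, map_one]
  exact adjoint_comp_toCircleCLM

theorem star_toeplitz (f : C(Circle, ℂ)) : star (W.toeplitz f) = W.toeplitz (star f) := by
  rw [toeplitz_def, toeplitz_def, star_eq_adjoint, adjoint_comp, adjoint_comp, adjoint_adjoint,
    map_star, star_eq_adjoint, ContinuousLinearMap.comp_assoc]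

theorem toeplitz_circleCoord_basis (n : ℕ) :
    W.toeplitz circleCoord (W.basis n) = W.basis (n + 1) := by
  rw [toeplitz_def, comp_apply, comp_apply, toCircleCLM_basis, circleMul_circlePow,
    ← toCircleCLM_basis (W := W), ← comp_apply, adjoint_comp_toCircleCLM]
  rfl

/-- The projection of `CircleSpace` onto the orthogonal complement of the range of `H`. -/
def hankelProj (W : DiscWeight) : CircleSpace →L[ℂ] CircleSpace :=
  1 - W.toCircleCLM ∘L adjoint W.toCircleCLM

theorem hankelProj_comp : W.hankelProj ∘L W.toCircleCLM = 0 := by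
  rw [hankelProj, ContinuousLinearMap.sub_comp, ContinuousLinearMap.comp_assoc,
    adjoint_comp_toCircleCLM]
  exact sub_self _

theorem hankelProj_circlePow (n : ℕ) : W.hankelProj (circlePow n) = 0 := by
  rw [← toCircleCLM_basis (W := W), ← comp_apply, hankelProj_comp]; rfl

theorem ext_basis_clm {E : Type*} [NormedAddCommGroup E] [NormedSpace ℂ E] {S T : W.H →L[ℂ] E}
    (h : ∀ n, S (W.basis n) = T (W.basis n)) : S = T := by
  ext f
  induction f using basis_induction with
  | hc => exact isClosed_eq (by fun_prop) (by fun_prop)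
  | hb n => exact h n
  | hadd f g hf hg => rw [map_add, map_add, hf, hg]
  | hsmul t f hf => rw [map_smul, map_smul, hf]

/-- Hankel operators with continuous symbols are compact. -/
theorem isCompactOperator_hankel (f : C(Circle, ℂ)) :
    IsCompactOperator (W.hankelProj ∘L circleMul f ∘L W.toCircleCLM) := by
  -- Compactness for `f` and for `star f` is carried together, so that the class of symbols in the
  -- induction is closed under `star`.
  suffices h : IsCompactOperator (W.hankelProj ∘L circleMul f ∘L W.toCircleCLM) ∧
      IsCompactOperator (W.hankelProj ∘L circleMul (star f) ∘L W.toCircleCLM) from h.1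
  -- Insert `1 = hankelProj + V V*` between the two multiplications, where `V` embeds `H` in
  -- `CircleSpace`.
  have hmul : ∀ f g : C(Circle, ℂ),
      W.hankelProj ∘L circleMul (f * g) ∘L W.toCircleCLM =
      (W.hankelProj ∘L circleMul f) ∘L (W.hankelProj ∘L circleMul g ∘L W.toCircleCLM) +
      (W.hankelProj ∘L circleMul f ∘L W.toCircleCLM) ∘L
        (adjoint W.toCircleCLM ∘L circleMul g ∘L W.toCircleCLM) := fun f g => by
    ext x
    simp [hankelProj]
  induction f using circle_induction with
  | hc =>
    have h := continuous_circleMul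
    have h1 : Continuous fun f => W.hankelProj ∘L circleMul f ∘L W.toCircleCLM :=
      continuous_const.clm_comp (h.clm_comp continuous_const)
    have h2 : Continuous fun f => W.hankelProj ∘L circleMul (star f) ∘L W.toCircleCLM :=
      continuous_const.clm_comp ((h.comp continuous_star).clm_comp continuous_const)
    have hcl := isClosed_setOfPred_isCompactOperator (σ₁₂ := RingHom.id ℂ) (M₁ := W.H)
      (M₂ := CircleSpace)
    exact (hcl.preimage h1).inter (hcl.preimage h2)
  | coord =>
    constructor
    · have : W.hankelProj ∘L circleMul circleCoord ∘L W.toCircleCLM = 0 :=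
        ext_basis_clm fun n => by
          rw [comp_apply, comp_apply, toCircleCLM_basis, circleMul_circlePow,
            hankelProj_circlePow]
          rfl
      rw [this]
      exact isCompactOperator_zero
    -- Multiplication by `star z` moves only the constant function out of the Hardy space, so this
    -- Hankel operator has rank at most one.
    · have : W.hankelProj ∘L circleMul (star circleCoord) ∘L W.toCircleCLM =
          rankOne ℂ (W.hankelProj (circleMul (star circleCoord) (circlePow 0))) (W.basis 0) :=
        ext_basis_clm fun n => by
          rw [comp_apply, comp_apply, toCircleCLM_basis, rankOne_apply, inner_basis_basis]
          cases n with
          | zero => simp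
          | succ n =>
            rw [← circleMul_circlePow, ← mul_apply_eq_comp (circleMul _), ← map_mul,
              star_circleCoord_mul, map_one, one_apply_eq_self, hankelProj_circlePow,
                if_neg (by omega), zero_smul]
      rw [this]
      exact isCompactOperator_rankOne _ _
  | const t =>
    have hc : ∀ t : ℂ, W.hankelProj ∘L circleMul (algebraMap ℂ C(Circle, ℂ) t) ∘L
        W.toCircleCLM = 0 := fun t => by
      ext x
      have h := congrArg (fun S => S x) (hankelProj_comp (W := W))
      simp only [comp_apply] at h
      simp [Algebra.algebraMap_eq_smul_one, h]
    have hs : star (algebraMap ℂ C(Circle, ℂ) t) = algebraMap ℂ _ (star t) := by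
      ext; simp
    rw [hs, hc, hc]
    exact ⟨isCompactOperator_zero, isCompactOperator_zero⟩
  | star f hf => rw [star_star f]; exact hf.symm
  | add f g hf hg =>
    rw [star_add, map_add, map_add, ContinuousLinearMap.add_comp, ContinuousLinearMap.add_comp,
      ContinuousLinearMap.comp_add, ContinuousLinearMap.comp_add]
    exact ⟨hf.1.add hg.1, hf.2.add hg.2⟩
  | mul f g hf hg =>
    rw [star_mul', hmul, hmul]
    have h : ∀ f g : C(Circle, ℂ),
        IsCompactOperator (W.hankelProj ∘L circleMul f ∘L W.toCircleCLM) →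
        IsCompactOperator (W.hankelProj ∘L circleMul g ∘L W.toCircleCLM) →
        IsCompactOperator ((W.hankelProj ∘L circleMul f) ∘L
          (W.hankelProj ∘L circleMul g ∘L W.toCircleCLM) +
          (W.hankelProj ∘L circleMul f ∘L W.toCircleCLM) ∘L
          (adjoint W.toCircleCLM ∘L circleMul g ∘L W.toCircleCLM) :
            W.H →L[ℂ] CircleSpace) := fun f g hf hg =>
      (hg.clm_comp (W.hankelProj ∘L circleMul f)).add
        (hf.comp_clm (adjoint W.toCircleCLM ∘L circleMul g ∘L W.toCircleCLM))
    exact ⟨h f g hf.1 hg.1, h _ _ hf.2 hg.2⟩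

/-- With `V` the embedding, the difference is `-V* f (1 - V V*) g V`, which contains a Hankel
operator as a factor. -/
theorem isCompactOperator_toeplitz_mul (f g : C(Circle, ℂ)) :
    IsCompactOperator
      (W.toeplitz f * W.toeplitz g - W.toeplitz (f * g) : W.H →L[ℂ] W.H) := by
  have h : W.toeplitz f * W.toeplitz g - W.toeplitz (f * g) =
      -((adjoint W.toCircleCLM ∘L circleMul f) ∘L
        (W.hankelProj ∘L circleMul g ∘L W.toCircleCLM)) := by
    ext1 x
    simp [toeplitz_def, hankelProj]
  rw [h]
  exact ((isCompactOperator_hankel g).clm_comp (adjoint W.toCircleCLM ∘L circleMul f)).neg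

/-! ### Approximate eigenvectors at points of the circle -/

/-- Asymptotically multiplicative unit vectors at a point of the circle. -/
def arcVec (W : DiscWeight) (ζ : Circle) (N : ℕ) : W.H :=
  ((Real.sqrt N : ℂ)⁻¹) • ∑ n ∈ Finset.range N, (star (ζ : ℂ)) ^ n • W.basis (n + N)

/-- Only the indices `N, …, 2N - 1` occur in `arcVec ζ N`. This is what makes compact operators
vanish asymptotically on these vectors. -/
theorem trunc_arcVec (ζ : Circle) (N : ℕ) : W.trunc N (W.arcVec ζ N) = 0 := by
  refine ext_basis fun k => ?_
  rw [inner_basis_trunc]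
  split_ifs with h
  · rw [arcVec, inner_smul_right, inner_sum, Finset.sum_eq_zero, mul_zero, inner_zero_right]
    intro n _
    rw [inner_smul_right, inner_basis_basis, if_neg (by omega), mul_zero]
  · rw [inner_zero_right]

theorem norm_arcVec (ζ : Circle) {N : ℕ} (hN : 0 < N) : ‖W.arcVec ζ N‖ = 1 := by
  have h : ‖∑ n ∈ Finset.range N, (star (ζ : ℂ)) ^ n • W.basis (n + N)‖ ^ 2 = N := by
    have h1 := (W.basis.orthonormal.comp (fun n => n + N) (add_left_injective N)).inner_sum
      (fun n => (star (ζ : ℂ)) ^ n) (fun n => (star (ζ : ℂ)) ^ n) (Finset.range N)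
    have h2 : ∀ n : ℕ, (starRingEnd ℂ) ((star (ζ : ℂ)) ^ n) * (star (ζ : ℂ)) ^ n = 1 := fun n => by
      rw [Complex.conj_mul', norm_pow, norm_star, Circle.norm_coe, one_pow]
      simp
    simp only [h2, Finset.sum_const, Finset.card_range, nsmul_eq_mul, mul_one,
      inner_self_eq_norm_sq_to_K, Function.comp_apply] at h1
    have h3 := congrArg Complex.re h1
    rw [← Complex.ofReal_natCast, Complex.ofReal_re] at h3
    rw [← h3, ← RCLike.ofReal_pow]
    rfl
  have h0 : (0 : ℝ) < N := Nat.cast_pos.2 hN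
  rw [arcVec, norm_smul, ← sq_eq_sq₀ (by positivity) zero_le_one, mul_pow, h, norm_inv,
    Complex.norm_real, Real.norm_eq_abs, inv_pow, sq_abs, Real.sq_sqrt h0.le, one_pow,
    inv_mul_cancel₀ h0.ne']

theorem norm_arcVec_le (ζ : Circle) (N : ℕ) : ‖W.arcVec ζ N‖ ≤ 1 := by
  rcases Nat.eq_zero_or_pos N with rfl | h
  · simp [arcVec]
  · exact (norm_arcVec ζ h).le

end DiscWeight

/-- A uniform Lipschitz constant in `N` allows the usual `ε / 2` argument. It passes asymptotic
relations to norm limits, both for `arcVec` and for truncated dilations. -/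
theorem isClosed_setOf_tendsto_zero {E F : Type*} [NormedAddCommGroup E] [NormedAddCommGroup F]
    {L : ℕ → E → F} (C : ℝ) (h : ∀ N x y, ‖L N x - L N y‖ ≤ C * ‖x - y‖) :
    IsClosed {x | Tendsto (fun N => L N x) atTop (𝓝 0)} := by
  rw [← isSeqClosed_iff_isClosed]
  intro x y hx hy
  have hC : 0 ≤ |C| + 1 := by positivity
  rw [Set.mem_ofPred_eq, Metric.tendsto_atTop]
  intro ε hε
  obtain ⟨n, hn⟩ := ((tendsto_iff_norm_sub_tendsto_zero.1 hy).eventually_lt_const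
    (show 0 < ε / (2 * (|C| + 1)) by positivity)).exists
  obtain ⟨N₀, hN₀⟩ := Metric.tendsto_atTop.1 (hx n) (ε / 2) (by positivity)
  refine ⟨N₀, fun N hN => ?_⟩
  have h1 := hN₀ N hN
  rw [dist_zero_right] at h1 ⊢
  have h2 : ‖L N y - L N (x n)‖ ≤ ε / 2 := by
    refine (h N y (x n)).trans ?_
    rw [norm_sub_rev]
    have h3 : C * ‖x n - y‖ ≤ (|C| + 1) * ‖x n - y‖ :=
      mul_le_mul_of_nonneg_right (by linarith [le_abs_self C]) (norm_nonneg _)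
    have h4 : (|C| + 1) * ‖x n - y‖ ≤ (|C| + 1) * (ε / (2 * (|C| + 1))) :=
      mul_le_mul_of_nonneg_left hn.le hC
    have h5 : (|C| + 1) * (ε / (2 * (|C| + 1))) = ε / 2 := by field_simp
    linarith
  calc ‖L N y‖ = ‖L N y - L N (x n) + L N (x n)‖ := by rw [sub_add_cancel]
    _ ≤ _ := norm_add_le _ _
    _ < ε := by linarith

theorem norm_circleMul_le (f : C(Circle, ℂ)) : ‖circleMul f‖ ≤ ‖f‖ :=
  NonUnitalStarAlgHom.norm_apply_le circleMul f

namespace DiscWeight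

variable {W : DiscWeight}

theorem toCircleCLM_arcVec (ζ : Circle) (N : ℕ) : W.toCircleCLM (W.arcVec ζ N) =
    ((Real.sqrt N : ℂ)⁻¹) • ∑ n ∈ Finset.range N, (star (ζ : ℂ)) ^ n • circlePow (n + N) := by
  simp [arcVec, map_sum, toCircleCLM_basis]

/-- The sum telescopes to its two end terms; after division by `√N` the error is at most `2 / √N`.
-/
theorem circleMul_circleCoord_arcVec (ζ : Circle) (N : ℕ) :
    circleMul circleCoord (W.toCircleCLM (W.arcVec ζ N)) - (ζ : ℂ) • W.toCircleCLM (W.arcVec ζ N) =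
      ((Real.sqrt N : ℂ)⁻¹ * ζ) • ((star (ζ : ℂ)) ^ N • circlePow (N + N) - circlePow N) := by
  have hζ : (ζ : ℂ) * star (ζ : ℂ) = 1 := by
    rw [Complex.star_def, Complex.mul_conj']; simp [Circle.norm_coe]
  have h := Finset.sum_range_sub (fun n => (star (ζ : ℂ)) ^ n • circlePow (n + N)) N
  simp only [pow_zero, one_smul, zero_add] at h
  rw [← h, toCircleCLM_arcVec, map_smul, map_sum, smul_comm (ζ : ℂ), ← smul_sub, mul_smul,
    Finset.smul_sum, Finset.smul_sum, ← Finset.sum_sub_distrib]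
  congr 1
  refine Finset.sum_congr rfl fun n _ => ?_
  rw [map_smul, circleMul_circlePow, smul_sub, smul_smul, smul_smul,
    show (ζ : ℂ) * star (ζ : ℂ) ^ (n + 1) = (ζ * star (ζ : ℂ)) * star (ζ : ℂ) ^ n by ring, hζ,
    one_mul, add_right_comm]

theorem tendsto_circleMul_arcVec (ζ : Circle) (f : C(Circle, ℂ)) :
    Tendsto (fun N => circleMul f (W.toCircleCLM (W.arcVec ζ N)) -
      f ζ • W.toCircleCLM (W.arcVec ζ N)) atTop (𝓝 0) := by
  have hn : ∀ N, ‖W.toCircleCLM (W.arcVec ζ N)‖ ≤ 1 := fun N =>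
    (W.toCircleSpace.norm_map _).trans_le (norm_arcVec_le ζ N)
  induction f using circle_induction with
  | hc =>
    refine isClosed_setOf_tendsto_zero 2 fun N f g => ?_
    have h1 : (circleMul f (W.toCircleCLM (W.arcVec ζ N)) - f ζ • W.toCircleCLM (W.arcVec ζ N)) -
        (circleMul g (W.toCircleCLM (W.arcVec ζ N)) - g ζ • W.toCircleCLM (W.arcVec ζ N)) =
        circleMul (f - g) (W.toCircleCLM (W.arcVec ζ N)) -
          (f - g) ζ • W.toCircleCLM (W.arcVec ζ N) := by
      rw [map_sub, sub_apply, ContinuousMap.sub_apply, sub_smul]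
      abel
    rw [h1]
    refine (norm_sub_le _ _).trans ?_
    have h2 : ‖circleMul (f - g) (W.toCircleCLM (W.arcVec ζ N))‖ ≤ ‖f - g‖ * 1 :=
      ((circleMul (f - g)).le_opNorm _).trans
        (mul_le_mul (norm_circleMul_le _) (hn N) (norm_nonneg _) (norm_nonneg _))
    have h3 : ‖(f - g) ζ • W.toCircleCLM (W.arcVec ζ N)‖ ≤ ‖f - g‖ * 1 := by
      rw [norm_smul]
      exact mul_le_mul ((f - g).norm_coe_le_norm ζ) (hn N) (norm_nonneg _) (norm_nonneg _)
    linarith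
  | coord =>
    simp only [circleCoord_apply, circleMul_circleCoord_arcVec]
    refine squeeze_zero_norm (a := fun N : ℕ => (Real.sqrt N)⁻¹ * 2) (fun N => ?_) ?_
    · rw [norm_smul, norm_mul, Circle.norm_coe, mul_one, norm_inv, Complex.norm_real,
        Real.norm_of_nonneg (Real.sqrt_nonneg _)]
      refine mul_le_mul_of_nonneg_left ?_ (by positivity)
      refine (norm_sub_le _ _).trans ?_
      rw [norm_smul, norm_pow, norm_star, Circle.norm_coe, orthonormal_circlePow.1,
        orthonormal_circlePow.1]
      norm_num
    · have h : Tendsto (fun N : ℕ => (Real.sqrt N)⁻¹) atTop (𝓝 0) :=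
        tendsto_inv_atTop_zero.comp (Real.tendsto_sqrt_atTop.comp tendsto_natCast_atTop_atTop)
      simpa using h.mul_const 2
  | const t =>
    simp [Algebra.algebraMap_eq_smul_one]
  | star f hf =>
    rw [tendsto_zero_iff_norm_tendsto_zero] at hf ⊢
    refine hf.congr fun N => ?_
    set v := W.toCircleCLM (W.arcVec ζ N)
    -- `circleMul (f - f ζ)` is normal, so it and its adjoint have the same norm at every vector.
    have hx : IsStarNormal (circleMul (f - algebraMap ℂ _ (f ζ))) :=
      ⟨by rw [← map_star]; exact (Commute.all _ _).map circleMul⟩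
    have h1 := (ContinuousLinearMap.isStarNormal_iff_norm_eq_adjoint
      (T := circleMul (f - algebraMap ℂ _ (f ζ)))).1 hx v
    rw [← star_eq_adjoint, ← map_star, star_sub] at h1
    have hs : star (algebraMap ℂ C(Circle, ℂ) (f ζ)) = algebraMap ℂ _ (star (f ζ)) := by
      ext; simp
    rw [hs] at h1
    simpa [Algebra.algebraMap_eq_smul_one] using h1
  | add f g hf hg =>
    have h := hf.add hg
    rw [add_zero] at h
    refine h.congr fun N => ?_
    rw [map_add, add_apply, ContinuousMap.add_apply, add_smul]
    abel
  | mul f g hf hg =>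
    have h1 := ((circleMul f).continuous.tendsto _).comp hg
    rw [map_zero] at h1
    have h := h1.add (hf.const_smul (g ζ))
    rw [smul_zero, add_zero] at h
    refine h.congr fun N => ?_
    simp only [Function.comp_apply, map_sub, map_smul, map_mul, mul_apply_eq_comp,
      ContinuousMap.mul_apply, smul_sub, smul_smul, mul_comm (g ζ)]
    abel

theorem tendsto_inner_arcVec_toeplitz (ζ : Circle) (f : C(Circle, ℂ)) :
    Tendsto (fun N => ⟪W.arcVec ζ N, W.toeplitz f (W.arcVec ζ N)⟫_ℂ) atTop (𝓝 (f ζ)) := by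
  rw [tendsto_iff_norm_sub_tendsto_zero]
  have h := tendsto_zero_iff_norm_tendsto_zero.1 (tendsto_circleMul_arcVec (W := W) ζ f)
  refine squeeze_zero' (Eventually.of_forall fun N => norm_nonneg _) ?_ h
  filter_upwards [eventually_gt_atTop 0] with N hN
  have hv : ‖W.toCircleCLM (W.arcVec ζ N)‖ = 1 :=
    (W.toCircleSpace.norm_map _).trans (norm_arcVec ζ hN)
  have h1 : ⟪W.arcVec ζ N, W.toeplitz f (W.arcVec ζ N)⟫_ℂ - f ζ =
      ⟪W.toCircleCLM (W.arcVec ζ N), circleMul f (W.toCircleCLM (W.arcVec ζ N)) -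
        f ζ • W.toCircleCLM (W.arcVec ζ N)⟫_ℂ := by
    rw [inner_sub_right, inner_smul_right, inner_self_eq_norm_sq_to_K, hv, toeplitz_def,
      ContinuousLinearMap.comp_apply, ContinuousLinearMap.comp_apply, adjoint_inner_right]
    simp
  rw [h1]
  refine (norm_inner_le_norm _ _).trans ?_
  rw [hv, one_mul]

/-- `trunc N` annihilates `arcVec ζ N`, so only `k - trunc N * k` contributes, and that tends to
zero in norm. -/
theorem tendsto_inner_arcVec_compact (ζ : Circle) {k : W.H →L[ℂ] W.H} (hk : IsCompactOperator k) :
    Tendsto (fun N => ⟪W.arcVec ζ N, k (W.arcVec ζ N)⟫_ℂ) atTop (𝓝 0) := by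
  have h := tendsto_zero_iff_norm_tendsto_zero.1
    (tendsto_sub_nhds_zero_iff.2 (tendsto_trunc_mul hk))
  refine squeeze_zero_norm (fun N => ?_) h
  have h1 : ⟪W.arcVec ζ N, k (W.arcVec ζ N)⟫_ℂ =
      -⟪W.arcVec ζ N, (W.trunc N * k - k) (W.arcVec ζ N)⟫_ℂ := by
    have h2 : star (W.trunc N) = W.trunc N := by
      simp only [trunc, star_sum, star_rankOne]
    rw [sub_apply, inner_sub_right, mul_apply_eq_comp, ← h2, star_eq_adjoint,
      adjoint_inner_right, trunc_arcVec, inner_zero_left, zero_sub, neg_neg]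
  rw [h1, norm_neg]
  refine (norm_inner_le_norm _ _).trans ?_
  calc ‖W.arcVec ζ N‖ * ‖(W.trunc N * k - k) (W.arcVec ζ N)‖
      ≤ 1 * (‖W.trunc N * k - k‖ * 1) :=
        mul_le_mul (norm_arcVec_le ζ N) (((W.trunc N * k - k).le_opNorm _).trans
          (mul_le_mul_of_nonneg_left (norm_arcVec_le ζ N) (norm_nonneg _)))
          (norm_nonneg _) zero_le_one
    _ = _ := by ring

/-! ### Symbols modulo compact operators -/

/-- `f` is the symbol of `x` if `x` is a compact perturbation of the Toeplitz operator of `f`. -/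
def HasSymbol (x : W.H →L[ℂ] W.H) (f : C(Circle, ℂ)) : Prop :=
  IsCompactOperator (x - W.toeplitz f)

/-- The vector functionals of `arcVec ζ N` send `x` to `f ζ` in the limit, ignoring the compact
part. Uniqueness of symbols and their convergence along norm limits both rest on this bound. -/
theorem HasSymbol.norm_le {x : W.H →L[ℂ] W.H} {f : C(Circle, ℂ)} (h : HasSymbol x f) :
    ‖f‖ ≤ ‖x‖ := by
  refine (ContinuousMap.norm_le f (norm_nonneg _)).2 fun ζ => ?_
  have h1 := (tendsto_inner_arcVec_toeplitz (W := W) ζ f).add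
    (tendsto_inner_arcVec_compact ζ h)
  rw [add_zero] at h1
  refine le_of_tendsto h1.norm (Eventually.of_forall fun N => ?_)
  rw [← inner_add_right, ← add_apply, add_sub_cancel]
  refine (norm_inner_le_norm _ _).trans ?_
  calc ‖W.arcVec ζ N‖ * ‖x (W.arcVec ζ N)‖ ≤ 1 * (‖x‖ * 1) :=
        mul_le_mul (norm_arcVec_le ζ N) ((x.le_opNorm _).trans
          (mul_le_mul_of_nonneg_left (norm_arcVec_le ζ N) (norm_nonneg _)))
          (norm_nonneg _) zero_le_one
    _ = _ := by ring

theorem HasSymbol.add {x y : W.H →L[ℂ] W.H} {f g : C(Circle, ℂ)} (hx : HasSymbol x f)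
    (hy : HasSymbol y g) : HasSymbol (x + y) (f + g) := by
  rw [HasSymbol, map_add, add_sub_add_comm]
  exact IsCompactOperator.add hx hy

theorem HasSymbol.smul {x : W.H →L[ℂ] W.H} {f : C(Circle, ℂ)} (hx : HasSymbol x f) (t : ℂ) :
    HasSymbol (t • x) (t • f) := by
  rw [HasSymbol, map_smul, ← smul_sub t x (W.toeplitz f)]
  exact IsCompactOperator.smul hx t

theorem HasSymbol.sub {x y : W.H →L[ℂ] W.H} {f g : C(Circle, ℂ)} (hx : HasSymbol x f)
    (hy : HasSymbol y g) : HasSymbol (x - y) (f - g) := by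
  rw [HasSymbol, map_sub, sub_sub_sub_comm]
  exact IsCompactOperator.sub hx hy

theorem HasSymbol.star {x : W.H →L[ℂ] W.H} {f : C(Circle, ℂ)} (hx : HasSymbol x f) :
    HasSymbol (star x) (star f) := by
  rw [HasSymbol, ← star_toeplitz, ← star_sub]
  exact isCompactOperator_star hx

theorem HasSymbol.mul {x y : W.H →L[ℂ] W.H} {f g : C(Circle, ℂ)} (hx : HasSymbol x f)
    (hy : HasSymbol y g) : HasSymbol (x * y) (f * g) := by
  have h : x * y - W.toeplitz (f * g) = (x - W.toeplitz f) * y +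
      (W.toeplitz f * (y - W.toeplitz g) +
        (W.toeplitz f * W.toeplitz g - W.toeplitz (f * g))) := by
    rw [sub_mul, mul_sub]
    abel
  rw [HasSymbol, h]
  exact (IsCompactOperator.comp_clm hx y).add
    ((IsCompactOperator.clm_comp hy (W.toeplitz f)).add (isCompactOperator_toeplitz_mul f g))

theorem HasSymbol.unique {x : W.H →L[ℂ] W.H} {f g : C(Circle, ℂ)} (hx : HasSymbol x f)
    (hy : HasSymbol x g) : f = g := by
  have h := (hx.sub hy).norm_le
  rw [sub_self, norm_zero] at h
  exact sub_eq_zero.1 (norm_le_zero_iff.1 h)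

theorem hasSymbol_toeplitz (f : C(Circle, ℂ)) : HasSymbol (W.toeplitz f) f := by
  rw [HasSymbol, sub_self]
  exact isCompactOperator_zero

theorem hasSymbol_algebraMap (t : ℂ) :
    HasSymbol (algebraMap ℂ (W.H →L[ℂ] W.H) t) (algebraMap ℂ _ t) := by
  rw [Algebra.algebraMap_eq_smul_one, Algebra.algebraMap_eq_smul_one, ← toeplitz_one]
  exact (hasSymbol_toeplitz 1).smul t

/-- `M_z` minus the unilateral shift is a weighted shift whose weights `√(a n / a (n+1)) - 1` tend
to zero, hence a norm limit of truncations. -/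
theorem hasSymbol_mulOp_X : HasSymbol (mulOp W X) circleCoord := by
  refine isCompactOperator_of_tendsto_trunc ?_
  set k := mulOp W X - W.toeplitz circleCoord with hk
  have hw : Tendsto (fun n => W.wt n 1 - 1) atTop (𝓝 0) := by
    have h := (Real.continuous_sqrt.tendsto 1).comp W.ratio
    rw [Real.sqrt_one] at h
    simpa using! h.sub_const 1
  have hkb : ∀ n, k (W.basis n) = ((W.wt n 1 - 1 : ℝ) : ℂ) • W.basis (n + 1) := fun n => by
    rw [hk, sub_apply, mulOp_X_basis, toeplitz_circleCoord_basis]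
    simp [sub_smul]
  have hks : ∀ n f, ⟪W.basis (n + 1), k f⟫_ℂ = ((W.wt n 1 - 1 : ℝ) : ℂ) * ⟪W.basis n, f⟫_ℂ := by
    intro n f
    induction f using basis_induction with
    | hc => exact isClosed_eq (by fun_prop) (by fun_prop)
    | hb m =>
      rw [hkb, inner_smul_right, inner_basis_basis, inner_basis_basis]
      by_cases h : n = m
      · simp [h]
      · simp [h]
    | hadd f g hf hg => rw [map_add k, inner_add_right, hf, hg, inner_add_right, mul_add]
    | hsmul t f hf => rw [map_smul k, inner_smul_right, hf, inner_smul_right, mul_left_comm]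
  rw [tendsto_iff_norm_sub_tendsto_zero, Metric.tendsto_atTop]
  intro ε hε
  obtain ⟨N₀, hN₀⟩ := Metric.tendsto_atTop.1 hw (ε / 2) (by positivity)
  -- The shift raises indices by one: an output index `n + 1 ≥ N` must force `n ≥ N₀`.
  refine ⟨N₀ + 1, fun N hN => ?_⟩
  rw [Real.dist_eq, sub_zero, abs_of_nonneg (norm_nonneg _)]
  refine lt_of_le_of_lt (b := ε / 2) ?_ (by linarith)
  refine opNorm_le_bound _ (by positivity) fun f => ?_
  rw [sub_apply, mul_apply_eq_comp, norm_sub_rev]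
  refine le_of_sq_le_sq ?_ (by positivity)
  have h1 := hasSum_norm_sq_trunc_sub N (k f)
  rw [← hasSum_nat_add_iff' 1] at h1
  simp only [Finset.range_one, Finset.sum_singleton, hks] at h1
  rw [if_pos (by omega), sub_zero] at h1
  have h2 := (hasSum_norm_sq f).mul_left ((ε / 2) ^ 2)
  rw [mul_pow]
  refine hasSum_le (fun n => ?_) h1 h2
  split_ifs with h
  · positivity
  · rw [norm_mul, mul_pow, Complex.norm_real]
    refine mul_le_mul_of_nonneg_right (pow_le_pow_left₀ (norm_nonneg _) ?_ 2) (by positivity)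
    have := hN₀ n (by omega)
    rw [dist_zero_right] at this
    exact this.le

theorem exists_hasSymbol {x : W.H →L[ℂ] W.H} (hx : x ∈ W.T) : ∃ f, HasSymbol x f := by
  unfold T at hx
  induction hx using StarAlgebra.elemental.induction_on with
  | self => exact ⟨_, hasSymbol_mulOp_X⟩
  | star_self => exact ⟨_, hasSymbol_mulOp_X.star⟩
  | algebraMap r => exact ⟨_, hasSymbol_algebraMap r⟩
  | add u _ v _ hu hv =>
    obtain ⟨f, hf⟩ := hu
    obtain ⟨g, hg⟩ := hv
    exact ⟨_, hf.add hg⟩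
  | mul u _ v _ hu hv =>
    obtain ⟨f, hf⟩ := hu
    obtain ⟨g, hg⟩ := hv
    exact ⟨_, hf.mul hg⟩
  | closure s _ h v hv =>
    obtain ⟨u, hu, huv⟩ := mem_closure_iff_seq_limit.1 hv
    choose f hf using fun n => h (u n) (hu n)
    -- The symbol is contractive, so symbols of a convergent sequence converge; compactness of the
    -- differences then passes to the limit.
    have hc : CauchySeq f := by
      refine Metric.cauchySeq_iff'.2 fun ε hε => ?_
      obtain ⟨N, hN⟩ := Metric.cauchySeq_iff'.1 huv.cauchySeq ε hε
      refine ⟨N, fun n hn => ?_⟩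
      have h1 := hN n hn
      rw [dist_eq_norm] at h1 ⊢
      exact ((hf n).sub (hf N)).norm_le.trans_lt h1
    obtain ⟨g, hg⟩ := cauchySeq_tendsto_of_complete hc
    exact ⟨g, isCompactOperator_of_tendsto
      (huv.sub ((continuous_toeplitz.tendsto g).comp hg)) (Eventually.of_forall hf)⟩

/-- The symbol homomorphism. -/
def symbol (W : DiscWeight) : W.T →⋆ₐ[ℂ] C(Circle, ℂ) where
  toFun x := (exists_hasSymbol x.2).choose
  map_one' := (exists_hasSymbol (1 : W.T).2).choose_spec.unique (by
    have h := hasSymbol_algebraMap (W := W) 1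
    rwa [map_one, map_one] at h)
  map_mul' x y := (exists_hasSymbol (x * y).2).choose_spec.unique
    ((exists_hasSymbol x.2).choose_spec.mul (exists_hasSymbol y.2).choose_spec)
  map_zero' := (exists_hasSymbol (0 : W.T).2).choose_spec.unique (by
    have h := hasSymbol_algebraMap (W := W) 0
    rwa [map_zero, map_zero] at h)
  map_add' x y := (exists_hasSymbol (x + y).2).choose_spec.unique
    ((exists_hasSymbol x.2).choose_spec.add (exists_hasSymbol y.2).choose_spec)
  commutes' t := (exists_hasSymbol (algebraMap ℂ W.T t).2).choose_spec.unique
    (hasSymbol_algebraMap t)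
  map_star' x := (exists_hasSymbol (star x).2).choose_spec.unique
    (exists_hasSymbol x.2).choose_spec.star

theorem hasSymbol_symbol (x : W.T) : HasSymbol (x : W.H →L[ℂ] W.H) (W.symbol x) :=
  (exists_hasSymbol x.2).choose_spec

theorem toeplitz_mem (f : C(Circle, ℂ)) : W.toeplitz f ∈ W.T := by
  have hcl : IsClosed (W.T : Set (W.H →L[ℂ] W.H)) := inferInstance
  induction f using circle_induction with
  | hc => exact hcl.preimage continuous_toeplitz
  | coord =>
    have h := sub_mem (mulOp_mem W X) (mem_T_of_isCompactOperator (hasSymbol_mulOp_X (W := W)))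
    rwa [sub_sub_cancel] at h
  | const t =>
    rw [Algebra.algebraMap_eq_smul_one, map_smul, toeplitz_one]
    exact W.T.smul_mem (one_mem _) t
  | star f hf => rw [← star_toeplitz]; exact star_mem hf
  | add f g hf hg => rw [map_add]; exact add_mem hf hg
  | mul f g hf hg =>
    have h := sub_mem (mul_mem hf hg)
      (mem_T_of_isCompactOperator (isCompactOperator_toeplitz_mul f g))
    rwa [sub_sub_cancel] at h

theorem M_eq_aeval (p : ℂ[X]) : W.M p = aeval (W.M X) p := by
  refine Subtype.ext ?_
  change mulOp W p = W.T.subtype (aeval (W.M X) p)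
  rw [mulOp_eq_aeval, ← StarAlgHom.coe_toAlgHom, ← aeval_algHom_apply]
  rfl

theorem isSymbolMap_symbol : W.IsSymbolMap W.symbol := by
  refine ⟨fun p ζ => ?_, fun f => ?_, fun x => ?_, fun x => mem_T_of_isCompactOperator⟩
  · have h : W.symbol (W.M X) = circleCoord := (hasSymbol_symbol _).unique hasSymbol_mulOp_X
    have h2 : ((ContinuousMap.evalStarAlgHom ℂ ℂ ζ).comp W.symbol) (aeval (W.M X) p) =
        aeval (circleCoord ζ) p := by
      rw [← StarAlgHom.coe_toAlgHom, ← aeval_algHom_apply]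
      simp [h]
    rw [M_eq_aeval]
    refine h2.trans ?_
    rw [circleCoord_apply, coe_aeval_eq_eval]
  · exact ⟨⟨_, toeplitz_mem f⟩, (hasSymbol_symbol _).unique (hasSymbol_toeplitz f)⟩
  · have h := hasSymbol_symbol x
    constructor
    · intro hx
      rw [HasSymbol, hx, map_zero, sub_zero] at h
      exact h
    · intro hx
      refine h.unique ?_
      rw [HasSymbol, map_zero, sub_zero]
      exact hx

theorem IsSymbolMap.eq_symbol {ρ : W.T →⋆ₐ[ℂ] C(Circle, ℂ)} (h : W.IsSymbolMap ρ) :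
    ρ = W.symbol := by
  refine StarAlgebra.elemental.starAlgHomClass_ext ℂ (a := mulOp W X) (map_continuous ρ)
    (map_continuous W.symbol) ?_
  refine ContinuousMap.ext fun ζ => ?_
  exact (h.1 X ζ).trans (isSymbolMap_symbol.1 X ζ).symm

end DiscWeight

/-! ### Positive functionals -/

theorem characterRep_apply {A : Type v} [CStarAlgebra A] (χ : A →⋆ₐ[ℂ] ℂ) (x : A) :
    characterRep χ x = algebraMap ℂ (ℂ →L[ℂ] ℂ) (χ x) := rfl

section Functionals

variable {A : Type v} [CStarAlgebra A] [PartialOrder A] [StarOrderedRing A]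

/-- Cauchy–Schwarz for the GNS form of `τ`, in which `star u` has length zero. -/
theorem PositiveLinearMap.map_mul_eq_zero_left (τ : A →ₚ[ℂ] ℂ) {u : A} (h : τ (u * star u) = 0)
    (y : A) : τ (u * y) = 0 := by
  have h1 : ‖τ.toPreGNS (star u)‖ = 0 := by
    rw [PositiveLinearMap.preGNS_norm_def]
    simp [h]
  have h2 := norm_inner_le_norm (𝕜 := ℂ) (τ.toPreGNS (star u)) (τ.toPreGNS y)
  rw [h1, zero_mul, norm_le_zero_iff, PositiveLinearMap.preGNS_inner_def] at h2
  simpa using h2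

theorem PositiveLinearMap.map_mul_eq_zero_right (τ : A →ₚ[ℂ] ℂ) {u : A} (h : τ (u * star u) = 0)
    (y : A) : τ (y * star u) = 0 := by
  have h1 : ‖τ.toPreGNS (star u)‖ = 0 := by
    rw [PositiveLinearMap.preGNS_norm_def]
    simp [h]
  have h2 := norm_inner_le_norm (𝕜 := ℂ) (τ.toPreGNS (star y)) (τ.toPreGNS (star u))
  rw [h1, mul_zero, norm_le_zero_iff, PositiveLinearMap.preGNS_inner_def] at h2
  simpa using h2

/-- Matrix positivity is preserved by positive functionals. -/
theorem PositiveLinearMap.posSemidef_map (τ : A →ₚ[ℂ] ℂ) {k : ℕ}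
    (M : CStarMatrix (Fin k) (Fin k) A) (hM : 0 ≤ M) :
    (Matrix.of fun i j => τ (M i j)).PosSemidef := by
  rw [StarOrderedRing.nonneg_iff] at hM
  induction hM using AddSubmonoid.closure_induction with
  | mem M hM =>
    obtain ⟨Y, rfl⟩ := hM
    have hMY : ∀ i j, (star Y * Y) i j = ∑ l, star (Y l i) * Y l j := fun i j => by
      rw [CStarMatrix.mul_apply]
      rfl
    refine Matrix.PosSemidef.of_dotProduct_mulVec_nonneg ?_ fun x => ?_
    · ext i j
      rw [Matrix.conjTranspose_apply, Matrix.of_apply, Matrix.of_apply, ← map_star]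
      simp only [hMY, star_sum, star_mul, star_star]
    · have h : (0 : A) ≤ ∑ l, star (∑ j, x j • Y l j) * ∑ j, x j • Y l j :=
        Finset.sum_nonneg fun l _ => star_mul_self_nonneg _
      refine (map_nonneg τ h).trans_eq ?_
      simp only [map_sum, star_sum, star_smul, smul_mul_smul_comm, map_smul,
        dotProduct, Matrix.mulVec, Matrix.of_apply, hMY, Pi.star_apply, smul_eq_mul,
        Finset.mul_sum, Finset.sum_mul]
      rw [Finset.sum_comm]
      conv_rhs => rw [Finset.sum_comm]
      refine Finset.sum_congr rfl fun i _ => ?_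
      rw [Finset.sum_comm]
      refine Finset.sum_congr rfl fun j _ => Finset.sum_congr rfl fun l _ => ?_
      ring
  | zero =>
    convert Matrix.PosSemidef.zero using 1
    ext i j
    simp
  | add x y _ _ hx hy =>
    convert hx.add hy using 1
    ext i j
    simp

open scoped MatrixOrder in
theorem Matrix.PosSemidef.exists_eq_conjTranspose_mul {k : ℕ} {P : Matrix (Fin k) (Fin k) ℂ}
    (h : P.PosSemidef) : ∃ B : Matrix (Fin k) (Fin k) ℂ, P = B.conjTranspose * B :=
  CStarAlgebra.nonneg_iff_eq_star_mul_self.1 h.nonneg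

/-- A positive functional, as a completely positive map into the operators on `ℂ`. -/
def PositiveLinearMap.toCompletelyPositive (τ : A →ₚ[ℂ] ℂ) : A →CP (ℂ →L[ℂ] ℂ) where
  toFun x := algebraMap ℂ (ℂ →L[ℂ] ℂ) (τ x)
  map_add' x y := by rw [map_add, map_add]
  map_smul' t x := by rw [map_smul, smul_eq_mul, map_mul, Algebra.smul_def]; rfl
  map_cstarMatrix_nonneg' k M hM := by
    obtain ⟨B, hB⟩ := (τ.posSemidef_map M hM).exists_eq_conjTranspose_mul
    let Y : CStarMatrix (Fin k) (Fin k) (ℂ →L[ℂ] ℂ) :=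
      CStarMatrix.ofMatrix (B.map (algebraMap ℂ (ℂ →L[ℂ] ℂ)))
    have h : 0 ≤ star Y * Y := star_mul_self_nonneg Y
    refine h.trans_eq (CStarMatrix.ext fun i j => ?_)
    have h2 := congrFun (congrFun hB i) j
    rw [Matrix.of_apply, Matrix.mul_apply] at h2
    rw [CStarMatrix.mul_apply, CStarMatrix.map_apply]
    change _ = algebraMap ℂ (ℂ →L[ℂ] ℂ) (τ (M i j))
    rw [h2, map_sum]
    refine Finset.sum_congr rfl fun l _ => ?_
    rw [map_mul, Matrix.conjTranspose_apply]
    change star (algebraMap ℂ (ℂ →L[ℂ] ℂ) (B l i)) * _ = _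
    rw [← algebraMap_star_comm]
    rfl

theorem PositiveLinearMap.toCompletelyPositive_apply (τ : A →ₚ[ℂ] ℂ) (x : A) :
    τ.toCompletelyPositive x = algebraMap ℂ (ℂ →L[ℂ] ℂ) (τ x) := rfl

end Functionals

namespace OperatorSystem

variable {A : Type v} [CStarAlgebra A] [PartialOrder A] [StarOrderedRing A]

/-- For self-adjoint `y` the inequality `-‖y‖ ≤ y ≤ ‖y‖` holds inside the operator system and gives
the bound with constant one; splitting into two self-adjoint parts costs the factor 2. Only
continuity is needed later. -/
theorem IsPositiveFunctional.norm_le (S : OperatorSystem A) {θ : S.toSubmodule →ₗ[ℂ] ℂ}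
    (hθ : S.IsPositiveFunctional θ) (x : S.toSubmodule) :
    ‖θ x‖ ≤ 2 * ‖θ S.unit‖ * ‖x‖ := by
  have hsa : ∀ y : S.toSubmodule, IsSelfAdjoint (y : A) → ‖θ y‖ ≤ ‖θ S.unit‖ * ‖y‖ := by
    intro y hy
    have h1 : 0 ≤ θ (((‖y‖ : ℝ) : ℂ) • S.unit - y) := hθ _ (by
      have := hy.le_algebraMap_norm_self
      rw [Algebra.algebraMap_eq_smul_one] at this
      exact sub_nonneg.2 (by simpa using! this))
    have h2 : 0 ≤ θ (((‖y‖ : ℝ) : ℂ) • S.unit + y) := hθ _ (by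
      have := hy.neg_algebraMap_norm_le_self
      rw [Algebra.algebraMap_eq_smul_one, neg_le_iff_add_nonneg, add_comm] at this
      simpa using! this)
    have h3 : 0 ≤ θ S.unit := hθ _ zero_le_one
    rw [map_sub, map_smul, smul_eq_mul] at h1
    rw [map_add, map_smul, smul_eq_mul] at h2
    rw [Complex.le_def] at h1 h2 h3
    simp at h1 h2 h3
    have him : (θ y).im = 0 := by
      rw [← h3.2] at h1; simp at h1; exact h1.2
    have hre : |(θ y).re| ≤ (θ S.unit).re * ‖y‖ := by
      rw [Submodule.coe_norm]
      exact abs_le.2 ⟨by linarith [h2.1], by linarith [h1.1]⟩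
    rw [← Complex.re_add_im (θ y), him]
    simp only [Complex.ofReal_zero, zero_mul, add_zero, Complex.norm_real, Real.norm_eq_abs]
    refine hre.trans (mul_le_mul_of_nonneg_right (Complex.re_le_norm _) (norm_nonneg _))
  have hxs : star (x : A) ∈ S.toSubmodule := S.star_mem' x.2
  set y : S.toSubmodule := ⟨(x : A) + star (x : A), add_mem x.2 hxs⟩ with hy
  set z : S.toSubmodule := ⟨Complex.I • ((x : A) - star (x : A)),
    Submodule.smul_mem _ _ (sub_mem x.2 hxs)⟩ with hz
  have hx : x = (2 : ℂ)⁻¹ • (y - Complex.I • z) := by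
    refine Subtype.ext ?_
    simp only [hy, hz, Submodule.coe_smul, Submodule.coe_sub, smul_smul, Complex.I_mul_I]
    module
  have hyn : ‖y‖ ≤ 2 * ‖x‖ := by
    refine (norm_add_le (x : A) (star (x : A))).trans ?_
    rw [norm_star, ← Submodule.coe_norm]; linarith
  have hzn : ‖z‖ ≤ 2 * ‖x‖ := by
    rw [Submodule.coe_norm, hz]
    rw [norm_smul, Complex.norm_I, one_mul]
    refine (norm_sub_le (x : A) (star (x : A))).trans ?_
    rw [norm_star, ← Submodule.coe_norm]; linarith
  have h1 := hsa y (by simp [hy, IsSelfAdjoint, add_comm])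
  have h2 := hsa z (by simp [hz, IsSelfAdjoint, ← smul_neg])
  have h3 : ‖θ x‖ ≤ 2⁻¹ * (‖θ y‖ + ‖θ z‖) := by
    conv_lhs => rw [hx]
    rw [map_smul, map_sub, map_smul, norm_smul, norm_inv, Complex.norm_two]
    refine mul_le_mul_of_nonneg_left ((norm_sub_le _ _).trans_eq ?_) (by norm_num)
    rw [norm_smul, Complex.norm_I, one_mul]
  nlinarith [norm_nonneg (θ S.unit), norm_nonneg x]

theorem IsPositiveFunctional.continuous (S : OperatorSystem A) {θ : S.toSubmodule →ₗ[ℂ] ℂ}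
    (hθ : S.IsPositiveFunctional θ) : Continuous θ :=
  (θ.mkContinuous (2 * ‖θ S.unit‖) (hθ.norm_le S)).continuous

end OperatorSystem

/-- A hermitian affine function which is nonnegative everywhere is constant. -/
theorem eq_zero_of_forall_affine_nonneg {α β γ : ℂ}
    (h : ∀ t : ℂ, 0 ≤ t * α + star t * β + γ) : α = 0 ∧ β = 0 := by
  have h1 := h 0
  simp [Complex.le_def] at h1
  have key : ∀ z : ℂ, (∀ r : ℝ, 0 ≤ (r : ℂ) * z + γ) → z = 0 := fun z hz => by
    have h2 := fun r => (Complex.le_def.1 (hz r))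
    simp at h2
    have hre : z.re = 0 := by
      by_contra hne
      have h3 := (h2 (-(γ.re + 1) / z.re)).1
      rw [div_mul_cancel₀ _ hne] at h3
      linarith
    have him := (h2 1).2
    exact Complex.ext hre (by simp; linarith [h1.2])
  -- Restricting to `t` real gives `α + β = 0`; restricting to `t` imaginary gives `α - β = 0`.
  have e1 := key (α + β) fun r => by
    convert h r using 1
    simp; ring
  have e2 := key (Complex.I * (α - β)) fun r => by
    convert h (r * Complex.I) using 1
    simp; ring
  have e3 : α - β = 0 := by simpa using e2
  constructor
  · linear_combination (e1 + e3) / 2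
  · linear_combination (e1 - e3) / 2

namespace DiscWeight

variable {W : DiscWeight}

theorem T_induction {p : W.T → Prop} (hc : IsClosed {x | p x}) (self : p (W.M X))
    (star_self : p (star (W.M X))) (const : ∀ t : ℂ, p (algebraMap ℂ W.T t))
    (add : ∀ x y, p x → p y → p (x + y)) (mul : ∀ x y, p x → p y → p (x * y)) (x : W.T) : p x := by
  obtain ⟨x, hx⟩ := x
  unfold T at hx
  induction hx using StarAlgebra.elemental.induction_on with
  | self => exact self
  | star_self => exact star_self
  | algebraMap r => exact const r
  | add u hu v hv h1 h2 => exact add _ _ h1 h2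
  | mul u hu v hv h1 h2 => exact mul _ _ h1 h2
  | closure s hs h v hv =>
    obtain ⟨u, hu, huv⟩ := mem_closure_iff_seq_limit.1 hv
    have hT : IsClosed (W.T : Set (W.H →L[ℂ] W.H)) := inferInstance
    have hvT : v ∈ W.T := hT.mem_of_tendsto huv (Eventually.of_forall fun n => hs (hu n))
    have h2 : Tendsto (fun n => (⟨u n, hs (hu n)⟩ : W.T)) atTop (𝓝 ⟨v, hvT⟩) :=
      tendsto_subtype_rng.2 huv
    exact hc.mem_of_tendsto h2 (Eventually.of_forall fun n => h (u n) (hu n))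

/-! ### The boundary kernel function -/

theorem inner_basis_kernelOne (n : ℕ) :
    ⟪W.basis n, kernel W 1 (by simp)⟫_ℂ = (Real.sqrt (W.a n) : ℂ) := by
  rw [inner_basis, kernel, taylor_ofCoeff, div_eq_iff (sqrt_ne_zero n)]
  rw [← Complex.ofReal_mul, Real.mul_self_sqrt (W.pos n).le]
  simp

/-- The coordinates of `k_1` are `√(a n)`, and the backward weighted shift carries `√(a (n+1))`
exactly to `√(a n)`. -/
theorem star_mulOp_X_kernelOne :
    star (mulOp W X) (kernel W 1 (by simp)) = kernel W 1 (by simp) := by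
  refine ext_basis fun n => ?_
  have h := inner_basis_star_pow n 1 (kernel W 1 (by simp))
  rw [pow_one, inner_basis_kernelOne] at h
  rw [h, inner_basis_kernelOne, wt_eq, Complex.ofReal_div, div_mul_cancel₀ _ (sqrt_ne_zero _)]

/-- The equation `A* f = f` is a first-order recursion determining every coordinate from the zeroth,
so the fixed space is one-dimensional. -/
theorem eq_smul_kernelOne {f : W.H} (hf : star (mulOp W X) f = f) :
    f = ⟪W.basis 0, f⟫_ℂ • kernel W 1 (by simp) := by
  refine ext_basis fun n => ?_
  rw [inner_smul_right, inner_basis_kernelOne]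
  induction n with
  | zero => simp [W.zero]
  | succ n ih =>
    have h := inner_basis_star_pow n 1 f
    rw [pow_one, hf, ih, wt_eq, Complex.ofReal_div] at h
    have h1 := sqrt_ne_zero (W := W) n
    have h2 := sqrt_ne_zero (W := W) (n + 1)
    field_simp at h
    rw [← h]

theorem kernelOne_ne_zero : kernel W 1 (by simp) ≠ 0 := fun h => by
  have h1 := inner_basis_kernelOne (W := W) 0
  rw [h, inner_zero_right] at h1
  exact sqrt_ne_zero 0 h1.symm

theorem norm_normalizedKernelOne : ‖normalizedKernelOne W‖ = 1 := by
  rw [normalizedKernelOne, norm_smul, Complex.norm_real, norm_inv, norm_norm,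
    inv_mul_cancel₀ (norm_ne_zero_iff.2 kernelOne_ne_zero)]

theorem star_mulOp_X_normalizedKernelOne :
    star (mulOp W X) (normalizedKernelOne W) = normalizedKernelOne W := by
  rw [normalizedKernelOne, map_smul, star_mulOp_X_kernelOne]

theorem inner_normalizedKernelOne_mulOp (p : ℂ[X]) (f : W.H) :
    ⟪normalizedKernelOne W, mulOp W p f⟫_ℂ = p.eval 1 * ⟪normalizedKernelOne W, f⟫_ℂ := by
  have hX : ∀ f, ⟪normalizedKernelOne W, mulOp W X f⟫_ℂ = ⟪normalizedKernelOne W, f⟫_ℂ :=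
      fun f => by
    rw [← adjoint_inner_left, ← star_eq_adjoint, star_mulOp_X_normalizedKernelOne]
  induction p using Polynomial.induction_on' with
  | add p q hp hq =>
    rw [mulOp_eq_aeval, map_add, ← mulOp_eq_aeval, ← mulOp_eq_aeval, add_apply, inner_add_right,
      hp, hq, eval_add, add_mul]
  | monomial n t =>
    rw [mulOp_eq_aeval, aeval_monomial, ← Algebra.smul_def, smul_apply, inner_smul_right,
      eval_monomial, one_pow, mul_one]
    congr 1
    induction n with
    | zero => rfl
    | succ n ih => rw [pow_succ', mul_apply_eq_comp, hX, ih]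

theorem star_mulOp_normalizedKernelOne (p : ℂ[X]) :
    star (mulOp W p) (normalizedKernelOne W) = star (p.eval 1) • normalizedKernelOne W := by
  refine ext_inner_right ℂ fun f => ?_
  rw [star_eq_adjoint, adjoint_inner_left, inner_normalizedKernelOne_mulOp, inner_smul_left]
  simp

theorem psi_apply (x : W.T) : W.psi x =
    ⟪normalizedKernelOne W, (x : W.H →L[ℂ] W.H) (normalizedKernelOne W)⟫_ℂ := rfl

theorem evalOne_M (p : ℂ[X]) : evalOne W.symbol (W.M p) = p.eval 1 := by
  have h := (isSymbolMap_symbol (W := W)).1 p (1 : Circle)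
  simpa using! h

theorem evalOne_of_compact {x : W.T} (hx : IsCompactOperator (x : W.H →L[ℂ] W.H)) :
    evalOne W.symbol x = 0 := by
  have h := ((isSymbolMap_symbol (W := W)).2.2.1 x).2 hx
  change W.symbol x 1 = 0
  rw [h]
  rfl

theorem psi_M_mul_star (p q : ℂ[X]) :
    W.psi (W.M p * star (W.M q)) = p.eval 1 * star (q.eval 1) := by
  rw [psi_apply]
  change ⟪normalizedKernelOne W, mulOp W p (star (mulOp W q) (normalizedKernelOne W))⟫_ℂ = _
  rw [inner_normalizedKernelOne_mulOp, star_mulOp_normalizedKernelOne, inner_smul_right,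
    inner_self_eq_norm_sq_to_K, norm_normalizedKernelOne]
  simp

theorem evalOne_M_mul_star (p q : ℂ[X]) :
    evalOne W.symbol (W.M p * star (W.M q)) = p.eval 1 * star (q.eval 1) := by
  rw [map_mul, map_star, evalOne_M, evalOne_M]

theorem M_mul_star_mem (p q : ℂ[X]) : W.M p * star (W.M q) ∈ W.S.toSubmodule :=
  Submodule.le_topologicalClosure _ (Submodule.subset_span ⟨p, q, rfl⟩)

theorem S_induction {P : W.T → Prop} (hc : IsClosed {x | P x})
    (base : ∀ p q : ℂ[X], P (W.M p * star (W.M q))) (add : ∀ x y, P x → P y → P (x + y))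
    (smul : ∀ (t : ℂ) x, P x → P (t • x)) {x : W.T} (hx : x ∈ W.S.toSubmodule) : P x := by
  refine closure_minimal (fun y hy => ?_) hc hx
  induction hy using Submodule.span_induction with
  | mem y hy => obtain ⟨p, q, rfl⟩ := hy; exact base p q
  | zero => simpa using smul 0 _ (base 0 0)
  | add y z _ _ hy hz => exact add y z hy hz
  | smul t y _ hy => exact smul t y hy

theorem continuous_psi : Continuous W.psi := map_continuous _

theorem continuous_evalOne : Continuous (evalOne W.symbol) := map_continuous _

/-- `k_1` is a common eigenvector of all `M_q^*`, so `ψ` is multiplicative on products with adjoints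
on the right. It need not be so for the other order, which is why agreement stops at `S`. -/
theorem psi_eq_evalOne_of_mem_S {x : W.T} (hx : x ∈ W.S.toSubmodule) :
    W.psi x = evalOne W.symbol x := by
  refine S_induction (P := fun x => W.psi x = evalOne W.symbol x)
    (isClosed_eq continuous_psi continuous_evalOne) (fun p q => ?_) (fun x y hx hy => ?_)
    (fun t x hx => ?_) hx
  · rw [psi_M_mul_star, evalOne_M_mul_star]
  · rw [map_add, map_add, hx, hy]
  · rw [map_smul, map_smul, hx]

/-- Rank one operators, as elements of `T`. -/
def rk (f g : W.H) : W.T := ⟨rankOne ℂ f g, rankOne_mem f g⟩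

theorem coe_rk (f g : W.H) : ((rk f g : W.T) : W.H →L[ℂ] W.H) = rankOne ℂ f g := rfl

theorem mul_rk (x : W.T) (f g : W.H) : x * rk f g = rk ((x : W.H →L[ℂ] W.H) f) g := by
  refine Subtype.ext ?_
  have h := rankOne_conj (x : W.H →L[ℂ] W.H) 1 f g
  rwa [star_one, mul_one] at h

theorem star_rk (f g : W.H) : star (rk f g : W.T) = rk g f := Subtype.ext (star_rankOne f g)

theorem continuous_rk_left (g : W.H) : Continuous fun f : W.H => (rk f g : W.T) :=
  Continuous.subtype_mk
    ((rankOne ℂ : W.H →L[ℂ] W.H →L⋆[ℂ] (W.H →L[ℂ] W.H)).flip g).continuous _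

theorem psi_rk (f g : W.H) : W.psi (rk f g) =
    ⟪normalizedKernelOne W, f⟫_ℂ * ⟪g, normalizedKernelOne W⟫_ℂ := by
  rw [psi_apply, coe_rk, rankOne_apply, inner_smul_right, mul_comm]

theorem psi_rk_self : W.psi (rk (normalizedKernelOne W) (normalizedKernelOne W)) = 1 := by
  rw [psi_rk, inner_self_eq_norm_sq_to_K, norm_normalizedKernelOne]
  simp

theorem isCompact_induction {P : W.T → Prop} (hc : IsClosed {x | P x})
    (base : ∀ f g : W.H, P (rk f g)) (add : ∀ x y, P x → P y → P (x + y))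
    {x : W.T} (hx : IsCompactOperator (x : W.H →L[ℂ] W.H)) : P x := by
  have h1 : Tendsto (fun N => ∑ n ∈ Finset.range N,
      rk (W.basis n) (star (x : W.H →L[ℂ] W.H) (W.basis n))) atTop (𝓝 x) := by
    rw [tendsto_subtype_rng]
    refine (tendsto_trunc_mul hx).congr fun N => ?_
    rw [trunc_mul, ← StarSubalgebra.coe_subtype, map_sum]
    rfl
  refine hc.mem_of_tendsto h1 (Eventually.of_forall fun N => ?_)
  rw [Set.mem_ofPred_eq]
  have h0 : P 0 := by
    have : (rk 0 0 : W.T) = 0 := Subtype.ext (by simp [coe_rk])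
    rw [← this]
    exact base 0 0
  exact Finset.sum_induction _ P add h0 fun n _ => base _ _

/-- A positive functional which vanishes at `(M_z - 1)(M_z - 1)^*` is a combination of the vector
state at the boundary kernel and the character at `1`. -/
theorem eq_psi_add_evalOne (τ : W.T →ₚ[ℂ] ℂ)
    (hτ : τ (W.M (X - 1) * star (W.M (X - 1))) = 0) (x : W.T) :
    τ x = τ (rk (normalizedKernelOne W) (normalizedKernelOne W)) * W.psi x +
      (τ 1 - τ (rk (normalizedKernelOne W) (normalizedKernelOne W))) * evalOne W.symbol x := by
  set k := normalizedKernelOne W with hk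
  set c := τ (rk k k) with hc
  have hM : W.M (X - 1) = W.M X - 1 := by
    rw [M_eq_aeval, map_sub, map_one, ← M_eq_aeval]
  have hpsi0 : W.psi (W.M (X - 1) * star (W.M (X - 1))) = 0 := by
    rw [psi_M_mul_star]; simp
  have hleft : ∀ σ : W.T →ₚ[ℂ] ℂ, σ (W.M (X - 1) * star (W.M (X - 1))) = 0 → ∀ y,
      σ (W.M X * y) = σ y := fun σ hσ y => by
    have h := σ.map_mul_eq_zero_left hσ y
    rwa [hM, sub_mul, one_mul, map_sub, sub_eq_zero] at h
  have hright : ∀ σ : W.T →ₚ[ℂ] ℂ, σ (W.M (X - 1) * star (W.M (X - 1))) = 0 → ∀ y,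
      σ (y * star (W.M X)) = σ y := fun σ hσ y => by
    have h := σ.map_mul_eq_zero_right hσ y
    rwa [hM, star_sub, star_one, mul_sub, mul_one, map_sub, sub_eq_zero] at h
  have hτc : Continuous τ := map_continuous _
  have h1 : ∀ f g, τ (rk f g) = ⟪k, f⟫_ℂ * τ (rk k g) := fun f g => by
    let F : W.H →L[ℂ] ℂ :=
      { toFun := fun f => τ (rk f g)
        map_add' := fun f f' => by
          rw [← map_add]; congr 1; exact Subtype.ext (by simp [coe_rk])
        map_smul' := fun t f => by
          rw [RingHom.id_apply, ← map_smul]; congr 1; exact Subtype.ext (by simp [coe_rk])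
        cont := hτc.comp (continuous_rk_left g) }
    -- Riesz representation of `f ↦ τ (f ⊗ g)`. Absorption of `A` on the left turns into `A* v = v`,
    -- so `v` is a multiple of `k`.
    set v := (toDual ℂ W.H).symm F with hv
    have hvF : ∀ f, ⟪v, f⟫_ℂ = τ (rk f g) := fun f => toDual_symm_apply
    have hvA : star (mulOp W X) v = v := by
      refine ext_inner_right ℂ fun f => ?_
      rw [star_eq_adjoint, adjoint_inner_left, hvF, hvF, ← hleft τ hτ (rk f g), mul_rk]
      rfl
    obtain ⟨b, hb⟩ : ∃ b : ℂ, v = b • k := by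
      refine ⟨⟪W.basis 0, v⟫_ℂ * ‖kernel W 1 (by simp)‖, ?_⟩
      rw [hk, normalizedKernelOne, smul_smul, mul_assoc, ← Complex.ofReal_mul,
        mul_inv_cancel₀ (norm_ne_zero_iff.2 kernelOne_ne_zero), Complex.ofReal_one, mul_one]
      exact eq_smul_kernelOne hvA
    rw [← hvF, ← hvF, hb, inner_smul_left, inner_smul_left, inner_self_eq_norm_sq_to_K, hk,
      norm_normalizedKernelOne]
    simp [mul_comm]
  have h2 : ∀ f g, τ (rk f g) = c * W.psi (rk f g) := fun f g => by
    -- The second variable follows from the first by taking adjoints; here `c` is seen to be real.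
    have h3 : τ (rk k g) = ⟪g, k⟫_ℂ * c := by
      rw [← star_rk, map_star, h1, star_mul', ← map_star, star_rk, ← hc, ← inner_conj_symm g k]
      rfl
    rw [h1, h3, psi_rk]
    ring
  -- The remainder kills the compact operators; the claim is that it is a multiple of the character
  -- `δ`.
  let σ : W.T →ₗ[ℂ] ℂ := τ.toLinearMap - c • W.psi.toLinearMap
  have hσ : ∀ x, σ x = τ x - c * W.psi x := fun x => rfl
  have hσc : Continuous σ := by
    have : (σ : W.T → ℂ) = fun x => τ x - c * W.psi x := rfl
    rw [this]
    exact hτc.sub (continuous_const.mul continuous_psi)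
  have hσk : ∀ x : W.T, IsCompactOperator (x : W.H →L[ℂ] W.H) → σ x = 0 := fun x hx => by
    refine isCompact_induction (P := fun x => σ x = 0) (isClosed_eq hσc continuous_const)
      (fun f g => ?_) (fun x y hx hy => ?_) hx
    · rw [hσ, h2, sub_self]
    · rw [map_add, hx, hy, add_zero]
  have hσm : ∀ x y, σ (x * y) = evalOne W.symbol x * σ y := fun x => by
    induction x using T_induction with
    | hc =>
      simp only [Set.ofPred_forall]
      exact isClosed_iInter fun y => isClosed_eq (hσc.comp (continuous_mul_const y))
        (continuous_evalOne.mul continuous_const)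
    | self =>
      intro y
      rw [evalOne_M, eval_X, one_mul, hσ, hσ, hleft τ hτ, hleft _ hpsi0]
    | star_self =>
      intro y
      -- Absorption of `A*` is known only on the right. Commutators are compact because symbols
      -- commute, so `A*` can be moved across.
      have h3 : σ (star (W.M X) * y - y * star (W.M X)) = 0 := by
        refine hσk _ (((isSymbolMap_symbol (W := W)).2.2.1 _).1 ?_)
        rw [map_sub, map_mul, map_mul, mul_comm, sub_self]
      rw [map_sub, sub_eq_zero] at h3
      rw [h3, map_star, evalOne_M, eval_X, star_one, one_mul, hσ, hσ, hright τ hτ,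
        hright _ hpsi0]
    | const t =>
      intro y
      rw [← Algebra.smul_def, map_smul, AlgHomClass.commutes]
      rfl
    | add u v hu hv =>
      intro y
      rw [add_mul, map_add, hu, hv, map_add, add_mul]
    | mul u v hu hv =>
      intro y
      rw [mul_assoc, hu, hv, map_mul, mul_assoc]
  have h3 := hσm x 1
  have h4 : W.psi 1 = 1 := by
    rw [psi_apply]
    change ⟪k, k⟫_ℂ = 1
    rw [inner_self_eq_norm_sq_to_K, hk, norm_normalizedKernelOne]
    simp
  rw [mul_one, hσ, hσ, h4, mul_one] at h3
  linear_combination h3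

/-! ### Purity of `φ` on `S` and its extensions to `T` -/

/-- The elements `M_p M_q^*` of `S`. -/
def monomialPair (p q : ℂ[X]) : W.S.toSubmodule := ⟨W.M p * star (W.M q), M_mul_star_mem p q⟩

theorem S_ext {F : Type*} [NormedAddCommGroup F] [NormedSpace ℂ F]
    {f g : W.S.toSubmodule →ₗ[ℂ] F} (hf : Continuous f) (hg : Continuous g)
    (h : ∀ p q : ℂ[X], f (monomialPair p q) = g (monomialPair p q)) : f = g := by
  have hspan : ∀ (y : W.T) (_ : y ∈ Submodule.span ℂ {x | ∃ p q : ℂ[X], x = W.M p * star (W.M q)})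
      (hy' : y ∈ W.S.toSubmodule), f ⟨y, hy'⟩ = g ⟨y, hy'⟩ := by
    intro y hy
    induction hy using Submodule.span_induction with
    | mem y hy => obtain ⟨p, q, rfl⟩ := hy; exact fun _ => h p q
    | zero => intro hy'; exact (map_zero f).trans (map_zero g).symm
    | add y z hy hz h1 h2 =>
      intro hyz
      have hy' := Submodule.le_topologicalClosure _ hy
      have hz' := Submodule.le_topologicalClosure _ hz
      have e : (⟨y + z, hyz⟩ : W.S.toSubmodule) = ⟨y, hy'⟩ + ⟨z, hz'⟩ := rfl
      rw [e, map_add, map_add, h1 hy', h2 hz']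
    | smul t y hy h1 =>
      intro hty
      have hy' := Submodule.le_topologicalClosure _ hy
      have e : (⟨t • y, hty⟩ : W.S.toSubmodule) = t • ⟨y, hy'⟩ := rfl
      rw [e, map_smul, map_smul, h1 hy']
  refine LinearMap.ext fun x => ?_
  obtain ⟨u, hu, hux⟩ := mem_closure_iff_seq_limit.1 x.2
  have hlim : Tendsto (fun n => (⟨u n, Submodule.le_topologicalClosure _ (hu n)⟩ :
      W.S.toSubmodule)) atTop (𝓝 x) := tendsto_subtype_rng.2 hux
  refine tendsto_nhds_unique ((hf.tendsto x).comp hlim)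
    (((hg.tendsto x).comp hlim).congr fun n => ?_)
  exact (hspan _ (hu n) _).symm

theorem M_add (p q : ℂ[X]) : W.M (p + q) = W.M p + W.M q := by
  rw [M_eq_aeval, map_add, ← M_eq_aeval, ← M_eq_aeval]

theorem M_C_mul (t : ℂ) (p : ℂ[X]) : W.M (C t * p) = t • W.M p := by
  rw [M_eq_aeval, map_mul, aeval_C, ← Algebra.smul_def, ← M_eq_aeval]

theorem M_one : W.M 1 = 1 := by rw [M_eq_aeval, map_one]

theorem monomialPair_add_left (p q r : ℂ[X]) :
    (monomialPair (p + q) r : W.S.toSubmodule) = monomialPair p r + monomialPair q r :=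
  Subtype.ext (by simp [monomialPair, M_add, add_mul])

theorem monomialPair_add_right (p q r : ℂ[X]) :
    (monomialPair p (q + r) : W.S.toSubmodule) = monomialPair p q + monomialPair p r :=
  Subtype.ext (by simp [monomialPair, M_add, mul_add])

theorem monomialPair_C_mul_left (t : ℂ) (p q : ℂ[X]) :
    monomialPair (C t * p) q = t • monomialPair (W := W) p q :=
  Subtype.ext (by simp [monomialPair, M_C_mul])

theorem monomialPair_C_mul_right (t : ℂ) (p q : ℂ[X]) :
    monomialPair p (C t * q) = star t • monomialPair (W := W) p q :=
  Subtype.ext (by simp [monomialPair, M_C_mul])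

theorem monomialPair_one_one : (monomialPair 1 1 : W.S.toSubmodule) = W.S.unit :=
  Subtype.ext (by simp [monomialPair, M_one, OperatorSystem.unit])

theorem monomialPair_self_nonneg (p : ℂ[X]) :
    0 ≤ ((monomialPair p p : W.S.toSubmodule) : W.T) := mul_star_self_nonneg (W.M p)

theorem phi_apply (x : W.S.toSubmodule) : W.phi W.symbol x = evalOne W.symbol x := rfl

theorem phi_monomialPair (p q : ℂ[X]) :
    W.phi W.symbol (monomialPair p q) = p.eval 1 * star (q.eval 1) := evalOne_M_mul_star p q

theorem isState_phi : W.S.IsState (W.phi W.symbol) :=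
  ⟨fun _ hx => map_nonneg (evalOne W.symbol) hx, map_one (evalOne W.symbol)⟩

/-- If `0 ≤ θ ≤ φ` and `u 1 = 0`, then `θ (M_u M_u^*) = 0`, so `θ (M_u M_q^*) = 0` for all `q` by
positivity of `(p, q) ↦ θ (M_p M_q^*)`. Writing `p = u + p 1` then leaves only the value at the
unit. -/
theorem isPureState_phi : W.S.IsPureState (W.phi W.symbol) := by
  refine ⟨isState_phi, fun θ hθ hθ' => ?_⟩
  have hvan : ∀ u : ℂ[X], u.eval 1 = 0 → ∀ q : ℂ[X],
      θ (monomialPair u q) = 0 ∧ θ (monomialPair q u) = 0 := by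
    intro u hu q
    have h0 : θ (monomialPair u u) = 0 := by
      have h1 := hθ _ (monomialPair_self_nonneg u)
      have h2 := hθ' _ (monomialPair_self_nonneg u)
      rw [LinearMap.sub_apply, phi_monomialPair, hu, zero_mul, zero_sub, neg_nonneg] at h2
      exact le_antisymm h2 h1
    -- Expand the value at `t u + q`: the `|t|^2` term is zero, so a nonnegative affine function of
    -- `t` remains.
    refine eq_zero_of_forall_affine_nonneg (γ := θ (monomialPair q q)) fun t => ?_
    have h3 := hθ _ (monomialPair_self_nonneg (C t * u + q))
    rw [monomialPair_add_left, monomialPair_add_right, monomialPair_add_right,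
      monomialPair_C_mul_left, monomialPair_C_mul_left, monomialPair_C_mul_right,
      monomialPair_C_mul_right] at h3
    simp only [map_add, map_smul, h0, smul_eq_mul, mul_zero, zero_add] at h3
    convert h3 using 1
    ring
  have hdec : ∀ p : ℂ[X], ∃ u : ℂ[X], u.eval 1 = 0 ∧ p = u + C (p.eval 1) * 1 := fun p =>
    ⟨p - C (p.eval 1), by simp, by ring⟩
  have hval : θ = θ W.S.unit • W.phi W.symbol := by
    refine S_ext (hθ.continuous W.S) ?_ fun p q => ?_
    · exact ((isState_phi.1.continuous W.S).const_smul (θ W.S.unit))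
    · rw [LinearMap.smul_apply, phi_monomialPair]
      obtain ⟨u, hu, hp⟩ := hdec p
      obtain ⟨v, hv, hq⟩ := hdec q
      conv_lhs => rw [hp, hq]
      rw [monomialPair_add_left, map_add, (hvan u hu _).1, monomialPair_add_right, map_add,
        (hvan v hv _).2, monomialPair_C_mul_left, monomialPair_C_mul_right, monomialPair_one_one]
      simp only [map_smul, smul_eq_mul, zero_add]
      ring
  have h1 : 0 ≤ θ W.S.unit := hθ _ zero_le_one
  have h2 : 0 ≤ (W.phi W.symbol - θ) W.S.unit := hθ' _ zero_le_one
  rw [LinearMap.sub_apply, isState_phi.2, sub_nonneg] at h2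
  rw [Complex.le_def] at h1 h2
  refine ⟨(θ W.S.unit).re, by simpa using h1.1, by simpa using h2.1, ?_⟩
  have h3 : (((θ W.S.unit).re : ℝ) : ℂ) = θ W.S.unit := Complex.ext rfl (by simpa using h1.2)
  rw [h3]
  exact hval

theorem psi_one : W.psi 1 = 1 := by
  rw [psi_apply]
  change ⟪normalizedKernelOne W, normalizedKernelOne W⟫_ℂ = 1
  rw [inner_self_eq_norm_sq_to_K, norm_normalizedKernelOne]
  simp

theorem rk_mul_rk_self {k : W.H} (hk : ‖k‖ = 1) : (rk k k : W.T) * rk k k = rk k k := by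
  rw [mul_rk, coe_rk, rankOne_apply, inner_self_eq_norm_sq_to_K, hk]
  simp

theorem rk_self_nonneg {k : W.H} (hk : ‖k‖ = 1) : 0 ≤ (rk k k : W.T) := by
  have h := star_mul_self_nonneg (rk k k : W.T)
  rwa [star_rk, rk_mul_rk_self hk] at h

theorem rk_self_le_one {k : W.H} (hk : ‖k‖ = 1) : (rk k k : W.T) ≤ 1 := by
  have h : (1 - rk k k : W.T) = star (1 - rk k k) * (1 - rk k k) := by
    rw [star_sub, star_one, star_rk, mul_sub, mul_one, sub_mul, one_mul, rk_mul_rk_self hk,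
      sub_self, sub_zero]
  rw [← sub_nonneg, h]
  exact star_mul_self_nonneg _

/-- The weight `t` of `ψ` is the value of the state at the projection onto the normalized kernel,
which lies between 0 and 1. -/
theorem setOf_isCStarState_extending_phi :
    {τ : W.T →ₗ[ℂ] ℂ | IsCStarState τ ∧ τ.comp W.S.toSubmodule.subtype = W.phi W.symbol} =
      {τ : W.T →ₗ[ℂ] ℂ | ∃ t : ℝ, 0 ≤ t ∧ t ≤ 1 ∧
        ∀ x : W.T, τ x = (t : ℂ) * W.psi x + (1 - (t : ℂ)) * evalOne W.symbol x} := by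
  ext τ
  constructor
  · rintro ⟨⟨hpos, h1⟩, hφ⟩
    have hk := norm_normalizedKernelOne (W := W)
    let τ' : W.T →ₚ[ℂ] ℂ := PositiveLinearMap.mk₀ τ hpos
    have h0 : τ' (W.M (X - 1) * star (W.M (X - 1))) = 0 := by
      have h := LinearMap.congr_fun hφ (monomialPair (X - 1) (X - 1))
      rw [phi_monomialPair] at h
      simpa using! h
    have key := eq_psi_add_evalOne τ' h0
    have hE := hpos _ (rk_self_nonneg hk)
    have hE' := hpos _ (sub_nonneg.2 (rk_self_le_one hk))
    rw [map_sub, h1, sub_nonneg] at hE'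
    rw [Complex.le_def] at hE hE'
    refine ⟨(τ (rk (normalizedKernelOne W) (normalizedKernelOne W))).re, by simpa using hE.1,
      by simpa using hE'.1, fun x => ?_⟩
    have h3 : (((τ (rk (normalizedKernelOne W) (normalizedKernelOne W))).re : ℝ) : ℂ) =
      τ (rk (normalizedKernelOne W) (normalizedKernelOne W)) :=
        Complex.ext rfl (by simpa using hE.2)
    rw [h3]
    have := key x
    rwa [show τ' 1 = 1 from h1] at this
  · rintro ⟨t, ht0, ht1, h⟩
    refine ⟨⟨fun x hx => ?_, ?_⟩, LinearMap.ext fun x => ?_⟩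
    · rw [h]
      refine add_nonneg (mul_nonneg (by exact_mod_cast ht0) (map_nonneg W.psi hx))
        (mul_nonneg ?_ (map_nonneg (evalOne W.symbol) hx))
      exact_mod_cast sub_nonneg.2 ht1
    · rw [h, psi_one, map_one]
      ring
    · rw [LinearMap.comp_apply, Submodule.subtype_apply, h, psi_eq_evalOne_of_mem_S x.2, phi_apply]
      ring

theorem isCompactOperator_rk (f g : W.H) :
    IsCompactOperator ((rk f g : W.T) : W.H →L[ℂ] W.H) := isCompactOperator_rankOne f g

/-- `ψ` is a second extension of `φ`: on the projection onto the normalized kernel it is 1, while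
`δ` is 0 on compact operators. -/
theorem not_isBoundaryRep_evalOne : ¬ IsBoundaryRep W.S (characterRep (evalOne W.symbol)) := by
  rintro ⟨-, h⟩
  have h1 := h W.psi.toCompletelyPositive (fun x hx => by
    rw [PositiveLinearMap.toCompletelyPositive_apply, characterRep_apply,
      psi_eq_evalOne_of_mem_S hx]) (rk (normalizedKernelOne W) (normalizedKernelOne W))
  rw [PositiveLinearMap.toCompletelyPositive_apply, characterRep_apply, psi_rk_self,
    evalOne_of_compact (isCompactOperator_rk _ _), map_one, map_zero] at h1
  exact one_ne_zero h1

/-! ### Diagonal operators -/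

/-- The basis vectors are eigenvectors of `D`, with real eigenvalues `d n`. -/
def IsDiag (D : W.H →L[ℂ] W.H) (d : ℕ → ℝ) : Prop :=
  ∀ n, D (W.basis n) = (d n : ℂ) • W.basis n

theorem IsDiag.inner_basis {D : W.H →L[ℂ] W.H} {d : ℕ → ℝ} (h : IsDiag D d) (n : ℕ) (f : W.H) :
    ⟪W.basis n, D f⟫_ℂ = d n * ⟪W.basis n, f⟫_ℂ := by
  induction f using basis_induction with
  | hc => exact isClosed_eq (by fun_prop) (by fun_prop)
  | hb k =>
    rw [h, inner_smul_right, inner_basis_basis]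
    split_ifs with hk
    · rw [hk]
    · simp
  | hadd f g hf hg => rw [map_add, inner_add_right, inner_add_right, hf, hg, mul_add]
  | hsmul t f hf => rw [map_smul, inner_smul_right, inner_smul_right, hf]; ring

theorem IsDiag.hasSum {D : W.H →L[ℂ] W.H} {d : ℕ → ℝ} (h : IsDiag D d) (f : W.H) :
    HasSum (fun n => ((d n * ‖⟪W.basis n, f⟫_ℂ‖ ^ 2 : ℝ) : ℂ)) ⟪f, D f⟫_ℂ := by
  refine (W.basis.hasSum_inner_mul_inner f (D f)).congr_fun fun n => ?_
  rw [h.inner_basis, ← inner_conj_symm f (W.basis n)]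
  push_cast
  rw [← Complex.conj_mul']
  ring

theorem IsDiag.nonneg {D : W.H →L[ℂ] W.H} {d : ℕ → ℝ} (h : IsDiag D d) (hd : ∀ n, 0 ≤ d n) :
    0 ≤ D := by
  rw [ContinuousLinearMap.nonneg_iff_isPositive, ContinuousLinearMap.isPositive_iff_complex]
  intro f
  have h1 := h.hasSum f
  have him : (⟪f, D f⟫_ℂ).im = 0 := by
    have := Complex.hasSum_im h1
    simp only [Complex.ofReal_im] at this
    exact this.unique hasSum_zero
  have hre : 0 ≤ (⟪f, D f⟫_ℂ).re := by
    have := Complex.hasSum_re h1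
    simp only [Complex.ofReal_re] at this
    exact this.nonneg fun n => mul_nonneg (hd n) (by positivity)
  rw [← inner_conj_symm (D f) f]
  generalize ⟪f, D f⟫_ℂ = z at him hre ⊢
  refine ⟨Complex.ext ?_ ?_, ?_⟩
  · simp
  · simp [him]
  · simpa using hre

theorem IsDiag.sub {D E : W.H →L[ℂ] W.H} {d e : ℕ → ℝ} (hD : IsDiag D d) (hE : IsDiag E e) :
    IsDiag (D - E) fun n => d n - e n := fun n => by
  rw [sub_apply, hD, hE, ← sub_smul, Complex.ofReal_sub]

theorem IsDiag.smul {D : W.H →L[ℂ] W.H} {d : ℕ → ℝ} (hD : IsDiag D d) (t : ℝ) :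
    IsDiag ((t : ℂ) • D) fun n => t * d n := fun n => by
  rw [smul_apply, hD, smul_smul, Complex.ofReal_mul]

theorem IsDiag.sum {ι : Type*} (s : Finset ι) {D : ι → W.H →L[ℂ] W.H} {d : ι → ℕ → ℝ}
    (hD : ∀ i, IsDiag (D i) (d i)) : IsDiag (∑ i ∈ s, D i) fun n => ∑ i ∈ s, d i n := fun n => by
  rw [sum_apply, Complex.ofReal_sum, Finset.sum_smul]
  exact Finset.sum_congr rfl fun i _ => hD i n

theorem isDiag_one : IsDiag (1 : W.H →L[ℂ] W.H) fun _ => 1 := fun n => by simp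

theorem isDiag_rankOne_zero :
    IsDiag (rankOne ℂ (W.basis 0) (W.basis 0)) fun n => if n = 0 then 1 else 0 := fun n => by
  rw [rankOne_apply, inner_basis_basis]
  rcases eq_or_ne n 0 with rfl | hn
  · simp
  · simp [hn, hn.symm]

theorem IsDiag.le {D E : W.H →L[ℂ] W.H} {d e : ℕ → ℝ} (hD : IsDiag D d) (hE : IsDiag E e)
    (h : ∀ n, d n ≤ e n) : D ≤ E :=
  sub_nonneg.1 ((hE.sub hD).nonneg fun n => sub_nonneg.2 (h n))

theorem IsDiag.conj {D : W.H →L[ℂ] W.H} {d : ℕ → ℝ} (hD : IsDiag D d) (m : ℕ) :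
    IsDiag (mulOp W X ^ m * D * star (mulOp W X ^ m))
      fun n => if m ≤ n then d (n - m) * (W.a (n - m) / W.a n) else 0 := fun n => by
  rw [mul_apply_eq_comp, mul_apply_eq_comp]
  dsimp only
  split_ifs with h
  · obtain ⟨k, rfl⟩ := Nat.exists_eq_add_of_le' h
    rw [star_pow_basis_add, map_smul, hD, map_smul, map_smul, mulOp_pow_basis, Nat.add_sub_cancel,
      ← wt_sq, smul_smul, smul_smul]
    congr 1
    push_cast
    ring
  · rw [star_pow_basis_of_lt (not_le.1 h)]
    simp

/-! ### The residual operators of a complete Pick space -/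

/-- The nonnegative coefficients `b n` of the power series `1 - 1 / ∑ a n z^n`, shifted by one. -/
structure IsPickSeq (W : DiscWeight) (b : ℕ → ℝ) : Prop where
  nonneg : ∀ m, 0 ≤ b m
  recurrence : ∀ n, W.a (n + 1) = ∑ m ∈ Finset.range (n + 1), b m * W.a (n - m)

/-- The operators `1 - ∑ b m A^(m+1) A*^(m+1)`, where `A = M_z`. -/
def pickRes (W : DiscWeight) (b : ℕ → ℝ) (N : ℕ) : W.H →L[ℂ] W.H :=
  1 - ∑ m ∈ Finset.range N, (b m : ℂ) • (mulOp W X ^ (m + 1) * 1 * star (mulOp W X ^ (m + 1)))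

/-- The eigenvalues of `pickRes`. -/
def pickResVal (W : DiscWeight) (b : ℕ → ℝ) (N n : ℕ) : ℝ :=
  1 - ∑ m ∈ Finset.range N, b m * if m + 1 ≤ n then 1 * (W.a (n - (m + 1)) / W.a n) else 0

theorem isDiag_pickRes (b : ℕ → ℝ) (N : ℕ) : IsDiag (pickRes W b N) (pickResVal W b N) :=
  isDiag_one.sub (IsDiag.sum _ fun m => (isDiag_one.conj (m + 1)).smul (b m))

theorem pickResVal_zero (b : ℕ → ℝ) (N : ℕ) : pickResVal W b N 0 = 1 := by
  simp [pickResVal]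

theorem pickResVal_le_one {b : ℕ → ℝ} (hb : IsPickSeq W b) (N n : ℕ) : pickResVal W b N n ≤ 1 := by
  rw [pickResVal, sub_le_self_iff]
  refine Finset.sum_nonneg fun m _ => mul_nonneg (hb.nonneg m) ?_
  split_ifs
  · exact mul_nonneg zero_le_one (div_nonneg (W.pos _).le (W.pos _).le)
  · exact le_rfl

theorem pickResVal_succ (b : ℕ → ℝ) (N n : ℕ) : pickResVal W b N (n + 1) =
    1 - (∑ m ∈ Finset.range N with m ≤ n, b m * W.a (n - m)) / W.a (n + 1) := by
  rw [pickResVal, Finset.sum_filter, Finset.sum_div]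
  congr 1
  refine Finset.sum_congr rfl fun m _ => ?_
  simp only [Nat.add_le_add_iff_right, Nat.add_sub_add_right]
  split_ifs
  · ring
  · simp

/-- The sum subtracted is part of the recurrence for `a (n + 1)`, all of whose terms are
nonnegative. -/
theorem pickResVal_nonneg {b : ℕ → ℝ} (hb : IsPickSeq W b) (N n : ℕ) : 0 ≤ pickResVal W b N n := by
  cases n with
  | zero => rw [pickResVal_zero]; exact zero_le_one
  | succ n =>
    rw [pickResVal_succ, sub_nonneg, div_le_one (W.pos _), hb.recurrence]
    refine Finset.sum_le_sum_of_subset_of_nonneg (fun m hm => ?_) fun m _ _ =>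
      mul_nonneg (hb.nonneg m) (W.pos _).le
    have := (Finset.mem_filter.1 hm).2
    exact Finset.mem_range.2 (by lia)

/-- Once `N ≥ n` the whole recurrence is present, and it sums to the denominator. -/
theorem pickResVal_eq_zero {b : ℕ → ℝ} (hb : IsPickSeq W b) {N n : ℕ} (h0 : n ≠ 0) (h : n ≤ N) :
    pickResVal W b N n = 0 := by
  obtain ⟨n, rfl⟩ := Nat.exists_eq_succ_of_ne_zero h0
  rw [Nat.succ_eq_add_one, pickResVal_succ, sub_eq_zero, eq_comm, div_eq_one_iff_eq (W.pos _).ne',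
    hb.recurrence]
  refine Finset.sum_congr (Finset.ext fun m => ?_) fun _ _ => rfl
  simp only [Finset.mem_filter, Finset.mem_range]
  lia

theorem rankOne_le_pickRes {b : ℕ → ℝ} (hb : IsPickSeq W b) (N : ℕ) :
    rankOne ℂ (W.basis 0) (W.basis 0) ≤ pickRes W b N := by
  refine isDiag_rankOne_zero.le (isDiag_pickRes b N) fun n => ?_
  split_ifs with h
  · rw [h, pickResVal_zero]
  · exact pickResVal_nonneg hb N n

/-- Each eigenvalue other than the zeroth is eventually zero, and all lie in `[0, 1]`, so the series
for `‖f‖ ^ 2` dominates. -/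
theorem tendsto_inner_pickRes {b : ℕ → ℝ} (hb : IsPickSeq W b) (f : W.H) :
    Tendsto (fun N => (⟪f, pickRes W b N f⟫_ℂ).re) atTop (𝓝 (‖⟪W.basis 0, f⟫_ℂ‖ ^ 2)) := by
  have h1 : ∀ N, HasSum (fun n => pickResVal W b N n * ‖⟪W.basis n, f⟫_ℂ‖ ^ 2)
      (⟪f, pickRes W b N f⟫_ℂ).re := fun N => by
    have h := Complex.hasSum_re ((isDiag_pickRes b N).hasSum f)
    simp only [Complex.ofReal_re] at h
    exact h
  have h2 := tendsto_tsum_of_dominated_convergence (𝓕 := atTop)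
    (f := fun N n => pickResVal W b N n * ‖⟪W.basis n, f⟫_ℂ‖ ^ 2)
    (g := fun n => if n = 0 then ‖⟪W.basis 0, f⟫_ℂ‖ ^ 2 else 0)
    (hasSum_norm_sq f).summable (fun n => ?_) (Eventually.of_forall fun N n => ?_)
  · rw [tsum_ite_eq] at h2
    exact h2.congr fun N => (h1 N).tsum_eq
  · rcases eq_or_ne n 0 with rfl | hn
    · simp [pickResVal_zero]
    · rw [if_neg hn]
      refine tendsto_const_nhds.congr' ?_
      filter_upwards [eventually_ge_atTop n] with N hN
      rw [pickResVal_eq_zero hb hn hN, zero_mul]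
  · rw [Real.norm_eq_abs, abs_of_nonneg (mul_nonneg (pickResVal_nonneg hb N n) (by positivity))]
    exact mul_le_of_le_one_left (by positivity) (pickResVal_le_one hb N n)

/-- If `c` bounds the ratios `a n / a (n+1)` from below, the eigenvalues of `1 - c⁻¹ A A*` are 1 at
`e 0` and nonpositive elsewhere. This gives an element of `S` below the projection onto `e 0`. -/
theorem exists_one_sub_le_rankOne : ∃ c : ℝ,
    1 - (c : ℂ) • (mulOp W X ^ 1 * 1 * star (mulOp W X ^ 1)) ≤
      rankOne ℂ (W.basis 0) (W.basis 0) := by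
  obtain ⟨c, hc, h⟩ := exists_ratio_lower (W := W)
  refine ⟨c⁻¹, (isDiag_one.sub ((isDiag_one.conj 1).smul c⁻¹)).le isDiag_rankOne_zero fun n => ?_⟩
  cases n with
  | zero => simp
  | succ n =>
    have h1 := h n
    simp only [le_add_iff_nonneg_left, zero_le, if_true, Nat.add_sub_cancel, one_mul,
      Nat.succ_ne_zero, if_false, tsub_le_iff_right, zero_add]
    rw [inv_mul_eq_div, one_le_div hc]
    exact h1

end DiscWeight

/-! ### Positive operators dominated by a rank one operator -/

section PositiveOperators

variable {K : Type w} [NormedAddCommGroup K] [InnerProductSpace ℂ K] [CompleteSpace K]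

theorem ContinuousLinearMap.re_inner_nonneg_of_nonneg {K : Type w} [NormedAddCommGroup K]
    [InnerProductSpace ℂ K] {D : K →L[ℂ] K} (h : 0 ≤ D) (f : K) :
    0 ≤ (⟪f, D f⟫_ℂ).re :=
  ((nonneg_iff_isPositive D).1 h).re_inner_nonneg_right f

theorem ContinuousLinearMap.re_inner_le_of_le {D E : K →L[ℂ] K} (h : D ≤ E) (f : K) :
    (⟪f, D f⟫_ℂ).re ≤ (⟪f, E f⟫_ℂ).re := by
  have h1 := re_inner_nonneg_of_nonneg (sub_nonneg.2 h) f
  rwa [sub_apply, inner_sub_right, Complex.sub_re, sub_nonneg] at h1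

theorem ContinuousLinearMap.nonneg_of_re_inner {D : K →L[ℂ] K} (hD : IsSelfAdjoint D)
    (h : ∀ f, 0 ≤ (⟪f, D f⟫_ℂ).re) : 0 ≤ D := by
  rw [nonneg_iff_isPositive, isPositive_def']
  refine ⟨hD, fun f => ?_⟩
  rw [reApplyInnerSelf_apply]
  change 0 ≤ (⟪D f, f⟫_ℂ).re
  rw [← inner_conj_symm, Complex.conj_re]
  exact h f

theorem ContinuousLinearMap.apply_eq_zero_of_re_inner {D : K →L[ℂ] K} (hD : 0 ≤ D) {f : K}
    (h : (⟪f, D f⟫_ℂ).re ≤ 0) : D f = 0 := by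
  obtain ⟨s, rfl⟩ := CStarAlgebra.nonneg_iff_eq_star_mul_self.1 hD
  rw [mul_apply_eq_comp, star_eq_adjoint, adjoint_inner_right, inner_self_eq_norm_sq_to_K] at h
  have h1 : ‖s f‖ ^ 2 ≤ 0 := by exact_mod_cast h
  have h2 : s f = 0 := by
    rw [← norm_eq_zero]
    exact pow_eq_zero_iff two_ne_zero |>.1 (le_antisymm h1 (by positivity))
  rw [mul_apply_eq_comp, h2, map_zero]

/-- A positive operator dominated by a rank one operator `v ⊗ v` is equal to it as soon as the
quadratic forms agree at one vector which is not orthogonal to `v`. -/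
theorem ContinuousLinearMap.eq_rankOne_of_le {D : K →L[ℂ] K} (hD : 0 ≤ D) {v e : K}
    (hDv : D ≤ rankOne ℂ v v) (he : ⟪v, e⟫_ℂ ≠ 0) (h : ‖⟪v, e⟫_ℂ‖ ^ 2 ≤ (⟪e, D e⟫_ℂ).re) :
    D = rankOne ℂ v v := by
  have hq : ∀ f : K, ⟪f, rankOne ℂ v v f⟫_ℂ = (‖⟪v, f⟫_ℂ‖ ^ 2 : ℝ) := fun f => by
    rw [rankOne_apply, inner_smul_right, ← inner_conj_symm f v, Complex.mul_conj']
    push_cast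
    rfl
  set E := rankOne ℂ v v - D with hE
  have hE0 : 0 ≤ E := sub_nonneg.2 hDv
  have h1 : E e = 0 := by
    refine apply_eq_zero_of_re_inner hE0 ?_
    rw [hE, sub_apply, inner_sub_right, hq, Complex.sub_re, Complex.ofReal_re]
    linarith
  -- Orthogonally to `v` the quadratic form of `E` is that of `-D`, so it is both nonnegative and
  -- nonpositive. Together with `e` these vectors span `K`.
  have h2 : ∀ f : K, ⟪v, f⟫_ℂ = 0 → E f = 0 := fun f hf => by
    refine apply_eq_zero_of_re_inner hE0 ?_
    rw [hE, sub_apply, inner_sub_right, hq, Complex.sub_re, Complex.ofReal_re, hf]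
    have := re_inner_nonneg_of_nonneg hD f
    simpa using this
  refine (sub_eq_zero.1 (ContinuousLinearMap.ext fun f => ?_)).symm
  have h3 : ⟪v, f - (⟪v, f⟫_ℂ / ⟪v, e⟫_ℂ) • e⟫_ℂ = 0 := by
    rw [inner_sub_right, inner_smul_right, div_mul_cancel₀ _ he, sub_self]
  have h4 := h2 _ h3
  rw [map_sub, map_smul, h1, smul_zero, sub_zero] at h4
  exact h4

end PositiveOperators

namespace DiscWeight

variable {W : DiscWeight}

/-! ### The unique extension property of the identity representation -/

theorem M_mul (p q : ℂ[X]) : W.M (p * q) = W.M p * W.M q := by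
  rw [M_eq_aeval, map_mul, ← M_eq_aeval, ← M_eq_aeval]

/-- `S` is not an algebra, but it is stable under left multiplication by `M_p` and right
multiplication by `M_q^*`. This is the only multiplicative structure of `S` that is used. -/
theorem mul_mul_star_mem_S {x : W.T} (hx : x ∈ W.S.toSubmodule) (p q : ℂ[X]) :
    W.M p * x * star (W.M q) ∈ W.S.toSubmodule := by
  refine S_induction (P := fun x => W.M p * x * star (W.M q) ∈ W.S.toSubmodule) ?_
    (fun r s => ?_) (fun x y hx hy => ?_) (fun t x hx => ?_) hx
  · exact W.S.isClosed'.preimage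
      ((continuous_const.mul continuous_id).mul continuous_const)
  · have h : W.M p * (W.M r * star (W.M s)) * star (W.M q) =
        W.M (p * r) * star (W.M (q * s)) := by
      rw [M_mul, M_mul, star_mul]
      simp only [mul_assoc]
    rw [h]
    exact M_mul_star_mem _ _
  · rw [mul_add, add_mul]
    exact add_mem hx hy
  · rw [mul_smul_comm, smul_mul_assoc]
    exact Submodule.smul_mem _ _ hx

/-- Operators of the form `A^m A*^m` belong to `S`. -/
theorem exists_mem_S_pow (m : ℕ) : ∃ x ∈ W.S.toSubmodule,
    (x : W.H →L[ℂ] W.H) = mulOp W X ^ m * 1 * star (mulOp W X ^ m) :=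
  ⟨W.M (X ^ m) * star (W.M (X ^ m)), M_mul_star_mem _ _, by
    rw [mul_one, ← mulOp_X_pow]
    rfl⟩

theorem exists_mem_S_pickRes (b : ℕ → ℝ) (N : ℕ) : ∃ x ∈ W.S.toSubmodule,
    (x : W.H →L[ℂ] W.H) = pickRes W b N := by
  choose x hx hx' using exists_mem_S_pow (W := W)
  refine ⟨1 - ∑ m ∈ Finset.range N, (b m : ℂ) • x (m + 1), sub_mem W.S.one_mem'
    (sum_mem fun m _ => Submodule.smul_mem _ _ (hx _)), ?_⟩
  rw [← StarSubalgebra.coe_subtype, map_sub, map_one, map_sum, pickRes]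
  simp only [map_smul, StarSubalgebra.coe_subtype, hx']

theorem star_mulOp_basis_zero (p : ℂ[X]) :
    star (mulOp W p) (W.basis 0) = star (p.coeff 0) • W.basis 0 := by
  have h : mulOp W p = mulOp W X * mulOp W p.divX + (p.coeff 0) • 1 := by
    conv_lhs => rw [← X_mul_divX_add p]
    rw [mulOp_eq_aeval, map_add, map_mul, ← mulOp_eq_aeval, ← mulOp_eq_aeval, aeval_C,
      Algebra.algebraMap_eq_smul_one]
  have h1 := star_pow_basis_of_lt (W := W) (m := 1) (n := 0) one_pos
  rw [pow_one] at h1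
  rw [h, star_add, star_mul, star_smul, star_one, add_apply, mul_apply_eq_comp, h1, map_zero,
    zero_add, smul_apply, one_apply_eq_self]

/-- The basis vector at the order of vanishing of `p` is mapped by `M_p^*` to a nonzero multiple of
the constant function. -/
theorem exists_star_mulOp_basis {p : ℂ[X]} (hp : p ≠ 0) :
    ∃ (k : ℕ) (c : ℂ), c ≠ 0 ∧ star (mulOp W p) (W.basis k) = c • W.basis 0 := by
  -- Factor `p = X^k q` with `q 0 ≠ 0`: `A*^k` sends `e k` to a multiple of `e 0`, which is an
  -- eigenvector of `M_q^*`.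
  obtain ⟨q, hq, hX⟩ := exists_eq_pow_rootMultiplicity_mul_and_not_dvd p hp 0
  set k := p.rootMultiplicity 0
  rw [C_0, sub_zero] at hq hX
  refine ⟨k, W.wt 0 k * star (q.coeff 0), mul_ne_zero ?_ (star_ne_zero.2 fun h => hX ?_), ?_⟩
  · exact Complex.ofReal_ne_zero.2 (wt_pos 0 k).ne'
  · exact X_dvd_iff.2 h
  · have h := star_pow_basis_add (W := W) k 0
    rw [zero_add] at h
    rw [hq, mulOp_mul, mulOp_X_pow, star_mul, mul_apply_eq_comp, h, map_smul,
      star_mulOp_basis_zero, smul_smul]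

theorem polynomial_induction {P : W.H → Prop} (hc : IsClosed {f | P f})
    (h : ∀ p : ℂ[X], P (mulOp W p (W.basis 0))) (f : W.H) : P f := by
  let L : ℂ[X] →ₗ[ℂ] W.H :=
    (ContinuousLinearMap.apply ℂ W.H (W.basis 0)).toLinearMap ∘ₗ
      (aeval (R := ℂ) (mulOp W X)).toLinearMap
  have hL : ∀ p, L p = mulOp W p (W.basis 0) := fun p => by rw [mulOp_eq_aeval]; rfl
  have hf : f ∈ (LinearMap.range L).topologicalClosure := by
    induction f using basis_induction with
    | hc => exact Submodule.isClosed_topologicalClosure _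
    | hb n =>
      refine Submodule.le_topologicalClosure _ ⟨((W.wt 0 n : ℂ)⁻¹) • X ^ n, ?_⟩
      rw [map_smul, hL, mulOp_X_pow, mulOp_pow_basis, smul_smul, inv_mul_cancel₀, one_smul,
        zero_add]
      exact Complex.ofReal_ne_zero.2 (wt_pos 0 n).ne'
    | hadd f g hf hg => exact add_mem hf hg
    | hsmul t f hf => exact Submodule.smul_mem _ _ hf
  refine closure_minimal ?_ hc hf
  rintro _ ⟨p, rfl⟩
  rw [hL]
  exact h p

theorem conj_rk_basis_zero (p : ℂ[X]) :
    rk (mulOp W p (W.basis 0)) (mulOp W p (W.basis 0)) =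
      W.M p * rk (W.basis 0) (W.basis 0) * star (W.M p) :=
  Subtype.ext (rankOne_conj (mulOp W p) (mulOp W p) _ _).symm

theorem conj_le_conj_T {x y : W.T} (h : x ≤ y) (p : ℂ[X]) :
    W.M p * x * star (W.M p) ≤ W.M p * y * star (W.M p) := star_right_conjugate_le_conjugate h _

theorem inner_conj_mulOp (p : ℂ[X]) (D : W.H →L[ℂ] W.H) (f : W.H) :
    ⟪f, (mulOp W p * D * star (mulOp W p)) f⟫_ℂ =
      ⟪star (mulOp W p) f, D (star (mulOp W p) f)⟫_ℂ := by
  rw [mul_apply_eq_comp, mul_apply_eq_comp, star_eq_adjoint, adjoint_inner_left]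

variable {b : ℕ → ℝ} (Φ : W.T →ₚ[ℂ] (W.H →L[ℂ] W.H))

/-- With `E` the projection onto `e 0`, one has `v ⊗ v = M_p E M_p^* ≤ M_p R_N M_p^*`, where the
upper bound lies in `S` and is fixed by `Φ`. Let `N → ∞` in the quadratic forms. -/
theorem map_rk_mulOp_le (hb : IsPickSeq W b) (hS : ∀ x ∈ W.S.toSubmodule, Φ x = x) (p : ℂ[X]) :
    Φ (rk (mulOp W p (W.basis 0)) (mulOp W p (W.basis 0))) ≤
      rankOne ℂ (mulOp W p (W.basis 0)) (mulOp W p (W.basis 0)) := by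
  set v := mulOp W p (W.basis 0) with hv
  have hpos : 0 ≤ Φ (rk v v) := map_nonneg Φ (by
    have h : 0 ≤ (rankOne ℂ v v : W.H →L[ℂ] W.H) :=
      (nonneg_iff_isPositive _).2 (isPositive_rankOne_self v)
    exact h)
  refine sub_nonneg.1 (nonneg_of_re_inner ?_ fun f => ?_)
  · exact (isPositive_rankOne_self v).isSelfAdjoint.sub (IsSelfAdjoint.of_nonneg hpos)
  rw [sub_apply, inner_sub_right, Complex.sub_re, sub_nonneg]
  have h1 : ∀ N, (⟪f, Φ (rk v v) f⟫_ℂ).re ≤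
      (⟪star (mulOp W p) f, pickRes W b N (star (mulOp W p) f)⟫_ℂ).re := fun N => by
    obtain ⟨x, hx, hx'⟩ := exists_mem_S_pickRes (W := W) b N
    have h2 : rk (W.basis 0) (W.basis 0) ≤ x := by
      have h3 := rankOne_le_pickRes hb N
      rw [← hx'] at h3
      exact h3
    have h3 := OrderHomClass.mono Φ (conj_le_conj_T h2 p)
    rw [← conj_rk_basis_zero, hS _ (mul_mul_star_mem_S hx p p)] at h3
    have h4 := re_inner_le_of_le h3 f
    rw [← inner_conj_mulOp, ← hx']
    exact h4
  have h2 := ge_of_tendsto' (tendsto_inner_pickRes hb (star (mulOp W p) f)) h1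
  refine h2.trans_eq ?_
  rw [star_eq_adjoint, adjoint_inner_right, ← hv, rankOne_apply, inner_smul_right,
    ← inner_conj_symm f v, Complex.mul_conj']
  norm_cast

/-- Equality is tested at one basis vector `e k` with `M_p^* e k` a nonzero multiple of `e 0`. There
the lower bound obtained from `1 - c A A* ≤ e 0 ⊗ e 0` is sharp, because its left side fixes `e 0`.
-/
theorem map_rk_mulOp (hb : IsPickSeq W b) (hS : ∀ x ∈ W.S.toSubmodule, Φ x = x) (p : ℂ[X]) :
    Φ (rk (mulOp W p (W.basis 0)) (mulOp W p (W.basis 0))) =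
      rankOne ℂ (mulOp W p (W.basis 0)) (mulOp W p (W.basis 0)) := by
  rcases eq_or_ne p 0 with rfl | hp
  · have h : mulOp W 0 = 0 := by rw [mulOp_eq_aeval, map_zero]
    have h2 : (rk (0 : W.H) 0 : W.T) = 0 := Subtype.ext (by simp [coe_rk])
    rw [h, zero_apply, h2, map_zero]
    simp
  set v := mulOp W p (W.basis 0) with hv
  obtain ⟨k, t, ht, hk⟩ := exists_star_mulOp_basis (W := W) hp
  have hin : ⟪v, W.basis k⟫_ℂ = t := by
    rw [hv, ← adjoint_inner_right, ← star_eq_adjoint, hk, inner_smul_right, inner_basis_basis]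
    simp
  have hpos : 0 ≤ Φ (rk v v) := map_nonneg Φ (by
    have h : 0 ≤ (rankOne ℂ v v : W.H →L[ℂ] W.H) :=
      (nonneg_iff_isPositive _).2 (isPositive_rankOne_self v)
    exact h)
  refine eq_rankOne_of_le hpos (map_rk_mulOp_le Φ hb hS p) (e := W.basis k) (by rwa [hin]) ?_
  obtain ⟨c, hc⟩ := exists_one_sub_le_rankOne (W := W)
  obtain ⟨x, hx, hx'⟩ := exists_mem_S_pow (W := W) 1
  have hy : (1 - (c : ℂ) • x : W.T) ∈ W.S.toSubmodule :=
    sub_mem W.S.one_mem' (Submodule.smul_mem _ _ hx)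
  have hle : (1 - (c : ℂ) • x : W.T) ≤ rk (W.basis 0) (W.basis 0) := by
    rw [← hx'] at hc
    exact hc
  have h3 := OrderHomClass.mono Φ (conj_le_conj_T hle p)
  rw [← conj_rk_basis_zero, hS _ (mul_mul_star_mem_S hy p p)] at h3
  refine le_of_eq_of_le ?_ (re_inner_le_of_le h3 (W.basis k))
  change _ = (⟪W.basis k, (mulOp W p * (1 - (c : ℂ) • (x : W.H →L[ℂ] W.H)) *
    star (mulOp W p)) (W.basis k)⟫_ℂ).re
  have h4 : (1 - (c : ℂ) • (x : W.H →L[ℂ] W.H)) (W.basis 0) = W.basis 0 := by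
    rw [sub_apply, smul_apply, hx', mul_apply_eq_comp,
      star_pow_basis_of_lt (W := W) (m := 1) (n := 0) one_pos]
    simp
  rw [inner_conj_mulOp, hk, map_smul, h4, inner_self_eq_norm_sq_to_K, hin, norm_smul, norm_basis,
    mul_one]
  norm_cast

theorem continuous_rankOne_self : Continuous fun f : W.H => (rankOne ℂ f f : W.H →L[ℂ] W.H) :=
  (smulRightL ℂ W.H W.H).continuous₂.comp ((innerSL ℂ).continuous.prodMk continuous_id)

theorem continuous_rk_self : Continuous fun f : W.H => (rk f f : W.T) :=
  continuous_rankOne_self.subtype_mk _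

theorem map_rk_self (hb : IsPickSeq W b) (hS : ∀ x ∈ W.S.toSubmodule, Φ x = x) (f : W.H) :
    Φ (rk f f) = rankOne ℂ f f := by
  have hΦ : Continuous Φ := map_continuous Φ
  induction f using polynomial_induction with
  | hc => exact isClosed_eq (hΦ.comp continuous_rk_self) continuous_rankOne_self
  | h p => exact map_rk_mulOp Φ hb hS p

theorem isDiag_trunc (N : ℕ) : IsDiag (W.trunc N) fun n => if n < N then 1 else 0 := fun n => by
  refine ext_basis fun k => ?_
  rw [inner_basis_trunc, inner_smul_right, inner_basis_basis]
  rcases eq_or_ne k n with rfl | h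
  · by_cases h : k < N <;> simp [h]
  · simp [h]

/-- Write `x = s* s`. The finite rank operators `s* (trunc N) s` are sums of `f ⊗ f`, are fixed by
`Φ`, lie below `x` and converge strongly to it. -/
theorem le_map (hb : IsPickSeq W b) (hS : ∀ x ∈ W.S.toSubmodule, Φ x = x) {x : W.T} (hx : 0 ≤ x) :
    (x : W.H →L[ℂ] W.H) ≤ Φ x := by
  refine sub_nonneg.1 (nonneg_of_re_inner ?_ fun f => ?_)
  · exact (IsSelfAdjoint.of_nonneg (map_nonneg Φ hx)).sub
      (IsSelfAdjoint.of_nonneg (show (0 : W.H →L[ℂ] W.H) ≤ x from hx))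
  obtain ⟨s, rfl⟩ := CStarAlgebra.nonneg_iff_eq_star_mul_self.1 hx
  have h1 : ∀ N, star (s : W.H →L[ℂ] W.H) * W.trunc N * s ≤ Φ (star s * s) := fun N => by
    let t : W.T := ∑ n ∈ Finset.range N, rk (star (s : W.H →L[ℂ] W.H) (W.basis n))
      (star (s : W.H →L[ℂ] W.H) (W.basis n))
    have ht : (t : W.H →L[ℂ] W.H) = star (s : W.H →L[ℂ] W.H) * W.trunc N * s := by
      rw [← StarSubalgebra.coe_subtype, map_sum, trunc, Finset.mul_sum, Finset.sum_mul]
      refine Finset.sum_congr rfl fun n _ => ?_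
      have h := rankOne_conj (star (s : W.H →L[ℂ] W.H)) (star (s : W.H →L[ℂ] W.H))
        (W.basis n) (W.basis n)
      rw [star_star] at h
      exact h.symm
    have hle : t ≤ star s * s := by
      have h2 : star (s : W.H →L[ℂ] W.H) * W.trunc N * s ≤ star (s : W.H →L[ℂ] W.H) * 1 * s :=
        star_left_conjugate_le_conjugate ((isDiag_trunc N).le isDiag_one fun n => by
          split_ifs <;> norm_num) _
      rw [← ht, mul_one] at h2
      exact h2
    rw [← ht]
    refine le_of_eq_of_le ?_ (OrderHomClass.mono Φ hle)
    rw [map_sum, ← StarSubalgebra.coe_subtype, map_sum]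
    exact Finset.sum_congr rfl fun n _ => (map_rk_self Φ hb hS _).symm
  rw [sub_apply, inner_sub_right, Complex.sub_re, sub_nonneg]
  have h2 : Tendsto (fun N => (⟪f, (star (s : W.H →L[ℂ] W.H) * W.trunc N * s) f⟫_ℂ).re) atTop
      (𝓝 (⟪f, ((star s * s : W.T) : W.H →L[ℂ] W.H) f⟫_ℂ).re) := by
    have h3 : Continuous fun g => (⟪f, star (s : W.H →L[ℂ] W.H) g⟫_ℂ).re :=
      Complex.continuous_re.comp
        ((innerSL ℂ f).continuous.comp (star (s : W.H →L[ℂ] W.H)).continuous)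
    exact (h3.tendsto _).comp (tendsto_trunc ((s : W.H →L[ℂ] W.H) f))
  exact le_of_tendsto' h2 fun N => re_inner_le_of_le (h1 N) f

/-- The identity representation has the unique extension property, even for positive maps. -/
theorem map_eq_of_eq_on_S (hb : IsPickSeq W b) (hS : ∀ x ∈ W.S.toSubmodule, Φ x = x) (x : W.T) :
    Φ x = x := by
  have hx : x ∈ Submodule.span ℂ {a : W.T | 0 ≤ a} := by
    rw [CStarAlgebra.span_nonneg]
    trivial
  induction hx using Submodule.span_induction with
  | mem x hx =>
    refine le_antisymm ?_ (le_map Φ hb hS hx)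
    -- The reverse inequality is `le_map` for `‖x‖ - x`, since `Φ` fixes scalars.
    have h1 : 0 ≤ algebraMap ℝ W.T ‖x‖ - x :=
      sub_nonneg.2 (IsSelfAdjoint.of_nonneg hx).le_algebraMap_norm_self
    have h2 := le_map Φ hb hS h1
    have h3 : algebraMap ℝ W.T ‖x‖ = ((‖x‖ : ℝ) : ℂ) • 1 := by
      rw [Algebra.algebraMap_eq_smul_one]
      exact (Complex.coe_smul _ _).symm
    have h4 : Φ (algebraMap ℝ W.T ‖x‖) = ((algebraMap ℝ W.T ‖x‖ : W.T) : W.H →L[ℂ] W.H) :=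
      hS _ (by rw [h3]; exact Submodule.smul_mem _ _ W.S.one_mem')
    rw [map_sub, h4] at h2
    exact (sub_le_sub_iff_left _).1 h2
  | zero => exact map_zero Φ
  | add x y _ _ hx hy => rw [map_add, hx, hy]; rfl
  | smul t x _ hx => rw [map_smul, hx]; rfl

theorem isIrreducibleRep_idRep : IsIrreducibleRep W.idRep := by
  refine ⟨⟨W.basis 0, 0, W.basis.orthonormal.ne_zero 0⟩, fun V _ hV => ?_⟩
  refine or_iff_not_imp_left.2 fun hne => ?_
  obtain ⟨v, hv, hv0⟩ := (Submodule.ne_bot_iff V).1 hne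
  refine (Submodule.eq_top_iff').2 fun f => ?_
  have h := hV (rk f v) v hv
  have h2 : W.idRep (rk f v) v = ⟪v, v⟫_ℂ • f := rfl
  rw [h2] at h
  exact (Submodule.smul_mem_iff V (inner_self_ne_zero.2 hv0)).1 h

theorem isBoundaryRep_idRep (hb : IsPickSeq W b) : IsBoundaryRep W.S W.idRep :=
  ⟨isIrreducibleRep_idRep, fun Φ hΦ x =>
    map_eq_of_eq_on_S (PositiveLinearMap.mk₀ (Φ : W.T →ₗ[ℂ] (W.H →L[ℂ] W.H))
      fun _ hx => map_nonneg Φ hx) hb hΦ x⟩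

end DiscWeight

/-! ### Unitarily equivalent representations -/

section Conjugation

variable {A : Type v} [CStarAlgebra A] {K L : Type w}
  [NormedAddCommGroup K] [InnerProductSpace ℂ K] [CompleteSpace K]
  [NormedAddCommGroup L] [InnerProductSpace ℂ L] [CompleteSpace L]
  {π : A →⋆ₐ[ℂ] (K →L[ℂ] K)} {σ : A →⋆ₐ[ℂ] (L →L[ℂ] L)}

theorem IsIrreducibleRep.of_unitaryEquiv (h : IsIrreducibleRep σ) (U : K ≃ₗᵢ[ℂ] L)
    (hU : ∀ (x : A) (ξ : K), U (π x ξ) = σ x (U ξ)) : IsIrreducibleRep π := by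
  obtain ⟨hn, h⟩ := h
  refine ⟨U.toEquiv.nontrivial, fun V hV hinv => ?_⟩
  have hmem : ∀ ξ, ξ ∈ V.comap (U.symm.toLinearEquiv : L →ₗ[ℂ] K) ↔ U.symm ξ ∈ V := fun ξ => Iff.rfl
  rcases h (V.comap (U.symm.toLinearEquiv : L →ₗ[ℂ] K)) (hV.preimage U.symm.continuous)
    (fun x ξ hξ => by
      rw [hmem] at hξ ⊢
      have h2 := hinv x _ hξ
      rwa [← U.symm_apply_apply (π x (U.symm ξ)), hU, U.apply_symm_apply] at h2) with h1 | h1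
  · refine Or.inl ((Submodule.eq_bot_iff V).2 fun ξ hξ => ?_)
    have h2 : U ξ ∈ V.comap (U.symm.toLinearEquiv : L →ₗ[ℂ] K) := by
      rw [hmem, U.symm_apply_apply]; exact hξ
    rw [h1, Submodule.mem_bot] at h2
    exact (map_eq_zero_iff U U.injective).1 h2
  · refine Or.inr ((Submodule.eq_top_iff').2 fun ξ => ?_)
    have h2 : U ξ ∈ V.comap (U.symm.toLinearEquiv : L →ₗ[ℂ] K) := by rw [h1]; trivial
    rwa [hmem, U.symm_apply_apply] at h2

end Conjugation

namespace DiscWeight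

variable {W : DiscWeight} {b : ℕ → ℝ}

/-- Conjugating a competing map by `U` gives a positive map on `T` that fixes `S`, and
`map_eq_of_eq_on_S` requires only positivity. -/
theorem isBoundaryRep_of_unitaryEquiv (hb : IsPickSeq W b) {K : Type} [NormedAddCommGroup K]
    [InnerProductSpace ℂ K] [CompleteSpace K] {π : W.T →⋆ₐ[ℂ] (K →L[ℂ] K)} (U : K ≃ₗᵢ[ℂ] W.H)
    (hU : ∀ (x : W.T) (ξ : K), U (π x ξ) = W.idRep x (U ξ)) : IsBoundaryRep W.S π := by
  refine ⟨isIrreducibleRep_idRep.of_unitaryEquiv U hU, fun Φ hΦ x => ?_⟩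
  let V : K →L[ℂ] W.H := U.toContinuousLinearEquiv.toContinuousLinearMap
  have hV : ∀ f, adjoint V f = U.symm f := fun f => by
    refine ext_inner_right ℂ fun ξ => ?_
    rw [adjoint_inner_left]
    change ⟪f, U ξ⟫_ℂ = _
    rw [← U.inner_map_map, U.apply_symm_apply]
  let Ψ : W.T →ₚ[ℂ] (W.H →L[ℂ] W.H) := PositiveLinearMap.mk₀
    { toFun := fun x => V ∘L Φ x ∘L adjoint V
      map_add' := fun x y => by
        rw [map_add, ContinuousLinearMap.add_comp, ContinuousLinearMap.comp_add]
      map_smul' := fun t x => by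
        rw [map_smul, ContinuousLinearMap.smul_comp, ContinuousLinearMap.comp_smul]
        rfl }
    (fun x hx => by
      have h : 0 ≤ Φ x := map_nonneg Φ hx
      exact (nonneg_iff_isPositive _).2 (((nonneg_iff_isPositive _).1 h).conj_adjoint V))
  have hΨ : ∀ x f, Ψ x f = U (Φ x (U.symm f)) := fun x f => by
    rw [← hV]
    rfl
  have h := map_eq_of_eq_on_S Ψ hb (fun x hx => ContinuousLinearMap.ext fun f => by
    rw [hΨ, hΦ x hx, hU, U.apply_symm_apply]
    rfl) x
  refine ContinuousLinearMap.ext fun ξ => U.injective ?_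
  have h2 := hΨ x (U ξ)
  rw [h, U.symm_apply_apply] at h2
  rw [hU, ← h2]
  rfl

/-- The map `x ↦ x k` is isometric for the GNS seminorm; it is onto because `T` contains every `f ⊗
k`, which sends `k` to `f`. -/
theorem exists_gns_unitary : ∃ U : W.psi.GNS ≃ₗᵢ[ℂ] W.H,
    U (W.psi.toPreGNS 1 : W.psi.PreGNS) = W.normalizedKernelOne ∧
      ∀ (x : W.T) (ξ : W.psi.GNS), U (W.psi.gnsStarAlgHom x ξ) = W.idRep x (U ξ) := by
  let k := normalizedKernelOne W
  let L : W.psi.PreGNS →ₗ[ℂ] W.H :=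
    { toFun := fun x => (W.psi.ofPreGNS x : W.H →L[ℂ] W.H) k
      map_add' := fun x y => by rw [map_add]; rfl
      map_smul' := fun t x => by rw [map_smul]; rfl }
  have hL : ∀ x, ‖L x‖ = ‖x‖ := fun x => by
    have h1 := W.psi.preGNS_norm_sq x
    rw [psi_apply] at h1
    have h2 : ⟪k, ((star (W.psi.ofPreGNS x) * W.psi.ofPreGNS x : W.T) : W.H →L[ℂ] W.H) k⟫_ℂ =
        ⟪L x, L x⟫_ℂ := by
      change ⟪k, star (W.psi.ofPreGNS x : W.H →L[ℂ] W.H) (L x)⟫_ℂ = _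
      rw [star_eq_adjoint, adjoint_inner_right]
      rfl
    rw [h2, inner_self_eq_norm_sq_to_K] at h1
    have h3 : ‖x‖ ^ 2 = ‖L x‖ ^ 2 := Complex.ofReal_injective (by
      push_cast
      exact h1)
    exact ((pow_left_inj₀ (norm_nonneg _) (norm_nonneg _) two_ne_zero).1 h3).symm
  let e : W.psi.PreGNS →ₗ[ℂ] W.psi.GNS :=
    (UniformSpace.Completion.toComplL (𝕜 := ℂ) (E := W.psi.PreGNS)).toLinearMap
  have he : ∀ x, e x = (x : W.psi.GNS) := fun x => rfl
  have hd : DenseRange e := UniformSpace.Completion.denseRange_coe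
  have hn : ∀ x, ‖L x‖ ≤ 1 * ‖e x‖ := fun x => by
    rw [one_mul, he, UniformSpace.Completion.norm_coe, hL]
  let F : W.psi.GNS →L[ℂ] W.H := L.extendOfNorm e
  have hF : ∀ x : W.psi.PreGNS, F x = L x := fun x => LinearMap.extendOfNorm_eq hd ⟨1, hn⟩ x
  have hFn : ∀ ξ, ‖F ξ‖ = ‖ξ‖ := fun ξ => by
    induction ξ using UniformSpace.Completion.induction_on with
    | hp => exact isClosed_eq (by fun_prop) (by fun_prop)
    | ih x => rw [hF, hL, UniformSpace.Completion.norm_coe]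
  let F' : W.psi.GNS →ₗᵢ[ℂ] W.H := ⟨F.toLinearMap, hFn⟩
  have hsurj : Function.Surjective F' := fun f => by
    refine ⟨((W.psi.toPreGNS (rk f k) : W.psi.PreGNS) : W.psi.GNS), ?_⟩
    change F _ = f
    rw [hF]
    change rankOne ℂ f k k = f
    rw [rankOne_apply, inner_self_eq_norm_sq_to_K, norm_normalizedKernelOne]
    simp
  refine ⟨LinearIsometryEquiv.ofSurjective F' hsurj, ?_, fun x ξ => ?_⟩
  · change F _ = _
    rw [hF]
    rfl
  · change F _ = (x : W.H →L[ℂ] W.H) (F ξ)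
    induction ξ using UniformSpace.Completion.induction_on with
    | hp => exact isClosed_eq (by fun_prop) (by fun_prop)
    | ih y =>
      rw [hF]
      have h : W.psi.gnsStarAlgHom x (y : W.psi.GNS) =
          (W.psi.leftMulMapPreGNS x y : W.psi.PreGNS) :=
        W.psi.gnsNonUnitalStarAlgHom_apply_coe
      rw [h, hF]
      rfl

end DiscWeight

/-! ### Contractive unital maps on operator systems are positive -/

section Contractions

open ComplexStarModule

theorem CStarAlgebra.norm_one_le {A : Type v} [CStarAlgebra A] : ‖(1 : A)‖ ≤ 1 := by
  rcases subsingleton_or_nontrivial A with hA | hA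
  · rw [Subsingleton.elim (1 : A) 0, norm_zero]
    exact zero_le_one
  · exact CStarRing.norm_one.le

theorem CStarAlgebra.coe_smul_one {A : Type v} [CStarAlgebra A] (r : ℝ) :
    (r : ℂ) • (1 : A) = algebraMap ℝ A r := by
  rw [Algebra.algebraMap_eq_smul_one]
  exact Complex.coe_smul _ _

theorem IsSelfAdjoint.eq_zero_of_forall_norm_add_le {A : Type v} [CStarAlgebra A] {k : A}
    (hk : IsSelfAdjoint k) {r : ℝ} (h : ∀ t : ℝ, ‖k + algebraMap ℝ A t‖ ^ 2 ≤ r ^ 2 + t ^ 2) :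
    k = 0 := by
  let _ : PartialOrder A := CStarAlgebra.spectralOrder A
  have _ : StarOrderedRing A := CStarAlgebra.spectralOrderedRing A
  rcases subsingleton_or_nontrivial A with hA | hA
  · exact Subsingleton.elim _ _
  have hs : ∀ l ∈ spectrum ℝ k, l = 0 := fun l hl => by
    by_contra hne
    -- A spectral value `l` satisfies `(l + t)^2 ≤ r^2 + t^2` for all real `t`; the choice `t = r^2
    -- / l` yields `l^2 + r^2 ≤ 0`.
    have h1 : l + r ^ 2 / l ∈ spectrum ℝ (k + algebraMap ℝ A (r ^ 2 / l)) := by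
      rw [add_comm k]
      exact spectrum.add_mem_add_iff.2 hl
    have h2 := spectrum.norm_le_norm_of_mem h1
    have h3 := h (r ^ 2 / l)
    have h4 : (l + r ^ 2 / l) ^ 2 ≤ r ^ 2 + (r ^ 2 / l) ^ 2 :=
      (sq_le_sq' (by linarith [norm_nonneg (k + algebraMap ℝ A (r ^ 2 / l)), (abs_le.1 h2).1])
        (abs_le.1 h2).2).trans h3
    have h5 : l * (r ^ 2 / l) = r ^ 2 := mul_div_cancel₀ _ hne
    nlinarith [sq_pos_of_ne_zero hne, sq_nonneg r]
  refine le_antisymm ?_ ?_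
  · rw [← neg_nonneg, StarOrderedRing.nonneg_iff_spectrum_nonneg (R := ℝ) (-k) hk.neg]
    intro l hl
    rw [← spectrum.neg_eq, Set.mem_neg] at hl
    have := hs _ hl
    linarith
  · rw [StarOrderedRing.nonneg_iff_spectrum_nonneg (R := ℝ) k hk]
    exact fun l hl => (hs l hl).ge

/-- A unital contraction is positive. Two embeddings of one space are used so that the same lemma
serves for `S` and for its matrices. -/
theorem LinearMap.map_nonneg_of_norm_le {V : Type*} [AddCommGroup V] [Module ℂ V] {A : Type v}
    [CStarAlgebra A] [PartialOrder A] [StarOrderedRing A] {B : Type u} [CStarAlgebra B]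
    [PartialOrder B] [StarOrderedRing B] (ι : V →ₗ[ℂ] A) (J : V →ₗ[ℂ] B)
    (hJ : ∀ v, ‖J v‖ ≤ ‖ι v‖) {e : V} (he : ι e = 1) (he' : J e = 1) {v : V} (hv : 0 ≤ ι v) :
    0 ≤ J v := by
  have hsa : IsSelfAdjoint (ι v) := IsSelfAdjoint.of_nonneg hv
  -- Adding `i t e` shifts the imaginary part of `J v` by `t`, while `‖ι v + i t‖^2 ≤ ‖ι v‖^2 + t^2`
  -- as `ι v` is self-adjoint. This growth forces the imaginary part to vanish.
  have him : (ℑ (J v) : B) = 0 := by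
    refine (ℑ (J v)).2.eq_zero_of_forall_norm_add_le (r := ‖ι v‖) fun t => ?_
    have h1 : (ℑ (J (v + (Complex.I * t) • e)) : B) = ℑ (J v) + algebraMap ℝ B t := by
      rw [map_add, map_smul, he', map_add, mul_comm, mul_smul, imaginaryPart_smul]
      simp [Algebra.algebraMap_eq_smul_one]
    have h2 : ‖(ℑ (J (v + (Complex.I * t) • e)) : B)‖ ≤ ‖J (v + (Complex.I * t) • e)‖ :=
      imaginaryPart.norm_le (J (v + (Complex.I * t) • e))
    rw [h1] at h2
    have h3 : ‖ι (v + (Complex.I * t) • e)‖ ^ 2 ≤ ‖ι v‖ ^ 2 + t ^ 2 := by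
      rw [map_add, map_smul, he, sq, ← CStarRing.norm_star_mul_self]
      have h4 : star (ι v + (Complex.I * t) • (1 : A)) * (ι v + (Complex.I * t) • 1) =
          ι v * ι v + ((t ^ 2 : ℝ) : ℂ) • 1 := by
        rw [star_add, hsa.star_eq, star_smul, star_one]
        simp only [add_mul, mul_add, smul_mul_assoc, mul_smul_comm, one_mul, mul_one,
          smul_add, smul_smul]
        have h5 : star (Complex.I * (t : ℂ)) = -(Complex.I * t) := by simp
        have h6 : (Complex.I * (t : ℂ)) * star (Complex.I * (t : ℂ)) = ((t ^ 2 : ℝ) : ℂ) := by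
          rw [h5]; push_cast; linear_combination (-(t : ℂ) ^ 2) * Complex.I_sq
        rw [h6, h5]
        module
      rw [h4]
      refine (norm_add_le _ _).trans (add_le_add ((norm_mul_le _ _).trans_eq (sq _).symm) ?_)
      rw [norm_smul, Complex.norm_real, Real.norm_eq_abs, abs_of_nonneg (sq_nonneg t)]
      exact mul_le_of_le_one_right (sq_nonneg t) CStarAlgebra.norm_one_le
    refine le_trans ?_ h3
    exact pow_le_pow_left₀ (norm_nonneg _) (h2.trans (hJ _)) 2
  have hJsa : IsSelfAdjoint (J v) := by
    rw [← realPart_add_I_smul_imaginaryPart (J v), him, smul_zero, add_zero]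
    exact (ℜ (J v)).2
  have h1 : ‖algebraMap ℝ A ‖ι v‖ - ι v‖ ≤ ‖ι v‖ := by
    rw [CStarAlgebra.norm_le_iff_le_algebraMap _ (norm_nonneg _)
      (sub_nonneg.2 hsa.le_algebraMap_norm_self), sub_le_self_iff]
    exact hv
  have h2 : ‖algebraMap ℝ B ‖ι v‖ - J v‖ ≤ ‖ι v‖ := by
    have h3 := hJ (((‖ι v‖ : ℝ) : ℂ) • e - v)
    rw [map_sub, map_sub, map_smul, map_smul, he, he', CStarAlgebra.coe_smul_one,
      CStarAlgebra.coe_smul_one] at h3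
    exact h3.trans h1
  have h3 : IsSelfAdjoint (algebraMap ℝ B ‖ι v‖ - J v) := (IsSelfAdjoint.algebraMap B
    (IsSelfAdjoint.all _)).sub hJsa
  have h4 := h3.le_algebraMap_norm_self.trans (algebraMap_mono B h2)
  rwa [sub_le_self_iff] at h4

/-- A bounded functional whose norm is its value at the unit is positive. -/
theorem LinearMap.nonneg_of_norm_le {A : Type v} [CStarAlgebra A] [PartialOrder A]
    [StarOrderedRing A] (g : A →ₗ[ℂ] ℂ) {r : ℝ} (hr : 0 < r) (h1 : g 1 = r)
    (hg : ∀ x, ‖g x‖ ≤ r * ‖x‖) {x : A} (hx : 0 ≤ x) : 0 ≤ g x := by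
  have hr' : (r : ℂ) ≠ 0 := Complex.ofReal_ne_zero.2 hr.ne'
  have h := LinearMap.map_nonneg_of_norm_le (LinearMap.id : A →ₗ[ℂ] A) ((r : ℂ)⁻¹ • g)
    (fun x => by
      rw [smul_apply, smul_eq_mul, norm_mul, norm_inv, Complex.norm_real, Real.norm_eq_abs,
        abs_of_pos hr, inv_mul_le_iff₀ hr]
      exact hg x) (e := 1) rfl (by rw [smul_apply, h1, smul_eq_mul, inv_mul_cancel₀ hr']) hx
  rw [smul_apply, smul_eq_mul] at h
  have h2 := mul_nonneg (show (0 : ℂ) ≤ r by exact_mod_cast hr.le) h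
  rwa [mul_inv_cancel_left₀ hr'] at h2

theorem PositiveLinearMap.norm_apply_le {A : Type v} [CStarAlgebra A] [PartialOrder A]
    [StarOrderedRing A] (τ : A →ₚ[ℂ] ℂ) (x : A) : ‖τ x‖ ≤ (τ 1).re * ‖x‖ := by
  have h1 : ‖τ.toPreGNS 1‖ ^ 2 = (τ 1).re := by
    have h := τ.preGNS_norm_sq (τ.toPreGNS 1)
    rw [PositiveLinearMap.ofPreGNS_toPreGNS, star_one, one_mul] at h
    rw [← h]
    norm_cast
  have h2 := norm_inner_le_norm (𝕜 := ℂ) (τ.toPreGNS 1) (τ.leftMulMapPreGNS x (τ.toPreGNS 1))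
  rw [PositiveLinearMap.preGNS_inner_def] at h2
  have h3 : ‖τ.leftMulMapPreGNS x (τ.toPreGNS 1)‖ ≤ ‖x‖ * ‖τ.toPreGNS 1‖ :=
    ContinuousLinearMap.le_of_opNorm_le _ (LinearMap.mkContinuous_norm_le _ (norm_nonneg _) _) _
  have h4 : star (τ.ofPreGNS (τ.toPreGNS 1)) *
      τ.ofPreGNS (τ.leftMulMapPreGNS x (τ.toPreGNS 1)) = x := by simp
  rw [h4] at h2
  calc ‖τ x‖ ≤ _ := h2
    _ ≤ ‖τ.toPreGNS 1‖ * (‖x‖ * ‖τ.toPreGNS 1‖) := mul_le_mul_of_nonneg_left h3 (norm_nonneg _)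
    _ = _ := by rw [← h1]; ring

end Contractions

/-! ### Star homomorphisms with dense range are surjective -/

section Surjectivity

open ComplexStarModule

variable {A : Type u} [CStarAlgebra A] {B : Type v} [CStarAlgebra B]

/-- Clip `x` at height `‖π x‖` by functional calculus; the clipping is the identity on the spectrum
of `π x`. -/
theorem StarAlgHom.exists_lift_of_isSelfAdjoint (π : A →⋆ₐ[ℂ] B) {x : A} (hx : IsSelfAdjoint x) :
    ∃ y, π y = π x ∧ ‖y‖ ≤ ‖π x‖ := by
  let f : ℝ → ℝ := fun t => max (-‖π x‖) (min t ‖π x‖)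
  have hf : Continuous f := by fun_prop
  have hπx : IsSelfAdjoint (π x) := hx.map π
  refine ⟨cfc f x, ?_, norm_cfc_le (norm_nonneg _) fun t _ => abs_le.2 ⟨le_max_left _ _, ?_⟩⟩
  · rw [StarAlgHomClass.map_cfc π f x hf.continuousOn (map_continuous π) hx hπx]
    conv_rhs => rw [← cfc_id ℝ (π x) hπx]
    refine cfc_congr fun t ht => ?_
    have h1 : ‖t‖ ≤ ‖π x‖ * ‖(1 : B)‖ := spectrum.norm_le_norm_mul_of_mem ht
    have h2 : ‖t‖ ≤ ‖π x‖ := h1.trans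
      (mul_le_of_le_one_right (norm_nonneg _) CStarAlgebra.norm_one_le)
    have h3 := abs_le.1 h2
    change max (-‖π x‖) (min t ‖π x‖) = t
    rw [min_eq_left h3.2, max_eq_right h3.1]
  · exact max_le (by have := norm_nonneg (π x); linarith) (min_le_right _ _)

theorem StarAlgHom.exists_lift (π : A →⋆ₐ[ℂ] B) (x : A) : ∃ y, π y = π x ∧ ‖y‖ ≤ 2 * ‖π x‖ := by
  obtain ⟨y, hy, hyn⟩ := π.exists_lift_of_isSelfAdjoint (ℜ x).2
  obtain ⟨z, hz, hzn⟩ := π.exists_lift_of_isSelfAdjoint (ℑ x).2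
  have h1 : π (ℜ x : A) = (ℜ (π x) : B) := by
    rw [realPart_apply_coe, realPart_apply_coe, ← Complex.coe_smul, ← Complex.coe_smul, map_smul,
      map_add, map_star]
  have h2 : π (ℑ x : A) = (ℑ (π x) : B) := by
    rw [imaginaryPart_apply_coe, imaginaryPart_apply_coe, ← Complex.coe_smul, ← Complex.coe_smul,
      map_smul, map_smul, map_sub, map_star]
  refine ⟨y + Complex.I • z, ?_, ?_⟩
  · rw [map_add, map_smul, hy, hz, ← map_smul, ← map_add, realPart_add_I_smul_imaginaryPart]
  · refine (norm_add_le _ _).trans ?_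
    rw [norm_smul, Complex.norm_I, one_mul, two_mul]
    rw [h1] at hyn
    rw [h2] at hzn
    exact add_le_add (hyn.trans (realPart.norm_le (π x))) (hzn.trans (imaginaryPart.norm_le (π x)))

/-- Lifts of controlled norm make the range closed by successive approximation. The constant 2 comes
from lifting real and imaginary parts separately. -/
theorem StarAlgHom.surjective_of_denseRange (π : A →⋆ₐ[ℂ] B) (h : DenseRange π) :
    Function.Surjective π := by
  let f : NormedAddGroupHom A B := AddMonoidHom.mkNormedAddGroupHom (π : A →+ B) 1 fun x => by
    rw [one_mul]; exact NonUnitalStarAlgHom.norm_apply_le π x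
  have hf : ∀ x, f x = π x := fun x => rfl
  have h1 : f.SurjectiveOnWith (π : A →+ B).range 2 := by
    rintro _ ⟨x, rfl⟩
    exact π.exists_lift x
  have h2 := controlled_closure_of_complete two_pos one_pos h1
  intro b
  obtain ⟨x, hx, -⟩ := h2 b (by
    change b ∈ closure (Set.range π)
    exact h b)
  exact ⟨x, hx⟩

end Surjectivity

/-! ### Matrices over C*-algebras -/

namespace CStarMatrix

section Entrywise

variable {V : Type*} [AddCommGroup V] [Module ℂ V] {A : Type v} [CStarAlgebra A]

/-- The entrywise application of a linear map to a matrix. -/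
def entrywise (f : V →ₗ[ℂ] A) (n : ℕ) :
    Matrix (Fin n) (Fin n) V →ₗ[ℂ] CStarMatrix (Fin n) (Fin n) A where
  toFun M := ofMatrix (M.map fun x => f x)
  map_add' M N := CStarMatrix.ext fun i j => map_add f (M i j) (N i j)
  map_smul' t M := CStarMatrix.ext fun i j => map_smul f t (M i j)

theorem entrywise_apply (f : V →ₗ[ℂ] A) {n : ℕ} (M : Matrix (Fin n) (Fin n) V) (i j : Fin n) :
    entrywise f n M i j = f (M i j) := rfl

/-- The inclusion of `A` as the scalar matrices. -/
def scalarHom (A : Type v) [CStarAlgebra A] (n : ℕ) : A →⋆ₐ[ℂ] CStarMatrix (Fin n) (Fin n) A where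
  toFun b := ofMatrix (Matrix.diagonal fun _ => b)
  map_one' := CStarMatrix.ext fun _ _ => rfl
  map_mul' x y := (Matrix.diagonal_mul_diagonal (fun _ : Fin n => x) (fun _ => y)).symm
  map_zero' := Matrix.diagonal_zero
  map_add' x y := (Matrix.diagonal_add (fun _ : Fin n => x) (fun _ => y)).symm
  commutes' _ := rfl
  map_star' x := (Matrix.diagonal_conjTranspose (fun _ : Fin n => x)).symm

theorem star_mul_self_apply {n : ℕ} (Y : CStarMatrix (Fin n) (Fin n) A) (i j : Fin n) :
    (star Y * Y) i j = ∑ l, star (Y l i) * Y l j := by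
  rw [mul_apply]
  rfl

end Entrywise

variable {A : Type v} [CStarAlgebra A] [PartialOrder A] [StarOrderedRing A]
  {K : Type w} [NormedAddCommGroup K] [InnerProductSpace ℂ K] [CompleteSpace K]
  (π : A →⋆ₐ[ℂ] (K →L[ℂ] K))

theorem sum_inner_nonneg {n : ℕ} (e : Fin n → K) {P : CStarMatrix (Fin n) (Fin n) A} (hP : 0 ≤ P) :
    0 ≤ ∑ i, ∑ l, ⟪e i, π (P i l) (e l)⟫_ℂ := by
  rw [StarOrderedRing.nonneg_iff] at hP
  induction hP using AddSubmonoid.closure_induction with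
  | mem P hP =>
    obtain ⟨Y, rfl⟩ := hP
    have h : ∑ i, ∑ l, ⟪e i, π ((star Y * Y) i l) (e l)⟫_ℂ =
        ∑ k, ⟪∑ i, π (Y k i) (e i), ∑ i, π (Y k i) (e i)⟫_ℂ := by
      simp only [star_mul_self_apply, map_sum, map_mul, map_star, sum_apply, mul_apply_eq_comp,
        inner_sum, sum_inner, star_eq_adjoint, adjoint_inner_right]
      rw [Finset.sum_comm]
      conv_rhs => rw [Finset.sum_comm]
      refine Finset.sum_congr rfl fun i _ => ?_
      rw [Finset.sum_comm]
    rw [h]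
    refine Finset.sum_nonneg fun k _ => ?_
    rw [inner_self_eq_norm_sq_to_K]
    refine (Complex.zero_le_real.2 (sq_nonneg ‖∑ i, π (Y k i) (e i)‖)).trans_eq ?_
    push_cast
    rfl
  | zero => simp
  | add x y _ _ hx hy =>
    refine (add_nonneg hx hy).trans_eq ?_
    simp only [add_apply, map_add, _root_.add_apply, inner_add_right,
      Finset.sum_add_distrib]

/-- The positive functional on matrices defined by a representation and a tuple of vectors. -/
def vecFunctional {n : ℕ} (e : Fin n → K) : CStarMatrix (Fin n) (Fin n) A →ₚ[ℂ] ℂ :=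
  PositiveLinearMap.mk₀
    { toFun := fun x => ∑ i, ∑ l, ⟪e i, π (x i l) (e l)⟫_ℂ
      map_add' := fun x y => by
        simp only [add_apply, map_add, _root_.add_apply, inner_add_right,
          Finset.sum_add_distrib]
      map_smul' := fun t x => by
        simp only [smul_apply, map_smul, _root_.smul_apply, inner_smul_right,
          Finset.mul_sum, RingHom.id_apply, smul_eq_mul] }
    fun _ hx => sum_inner_nonneg π e hx

theorem vecFunctional_apply {n : ℕ} (e : Fin n → K) (x : CStarMatrix (Fin n) (Fin n) A) :
    vecFunctional π e x = ∑ i, ∑ l, ⟪e i, π (x i l) (e l)⟫_ℂ := rfl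

/-- The Cauchy–Schwarz inequality for positive `2 × 2` matrices. -/
theorem norm_sq_apply_le {P : CStarMatrix (Fin 2) (Fin 2) A} (hP : 0 ≤ P) {c : ℝ} (hc : 0 < c)
    (h : P 1 1 ≤ (c : ℂ) • 1) (ξ : K) :
    ‖π (P 1 0) ξ‖ ^ 2 ≤ c * (⟪ξ, π (P 0 0) ξ⟫_ℂ).re := by
  have hsa : star (P 1 0) = P 0 1 := congrFun (congrFun (IsSelfAdjoint.of_nonneg hP).star_eq 0) 1
  set η := π (P 1 0) ξ with hη
  -- The vector `(ξ, -c⁻¹ η)` is chosen so that, after `P 1 1 ≤ c`, the cross terms `-2 c⁻¹ ‖η‖^2`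
  -- and the last term combine to `-c⁻¹ ‖η‖^2`.
  have h1 := sum_inner_nonneg π ![ξ, (-(c⁻¹ : ℝ) : ℂ) • η] hP
  simp only [Fin.sum_univ_two, Matrix.cons_val_zero, Matrix.cons_val_one, map_smul,
    inner_smul_left, inner_smul_right, ← hsa, map_star, ← hη] at h1
  rw [star_eq_adjoint, adjoint_inner_right, ← hη, inner_self_eq_norm_sq_to_K] at h1
  have h2 : (⟪η, π (P 1 1) η⟫_ℂ).re ≤ c * ‖η‖ ^ 2 := by
    have h3 : π (P 1 1) ≤ (c : ℂ) • 1 := by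
      have := OrderHomClass.mono π h
      rwa [map_smul, map_one] at this
    have h4 := re_inner_le_of_le h3 η
    rw [_root_.smul_apply, one_apply_eq_self, inner_smul_right,
      inner_self_eq_norm_sq_to_K] at h4
    have e : ((c : ℂ) * ((‖η‖ : ℝ) : ℂ) ^ 2) = ((c * ‖η‖ ^ 2 : ℝ) : ℂ) := by push_cast; rfl
    exact h4.trans_eq ((congrArg Complex.re e).trans (Complex.ofReal_re _))
  have e1 : ⟪ξ, π (P 0 0) ξ⟫_ℂ + -((c⁻¹ : ℝ) : ℂ) * ((‖η‖ : ℝ) : ℂ) ^ 2 +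
      ((starRingEnd ℂ) (-((c⁻¹ : ℝ) : ℂ)) * ((‖η‖ : ℝ) : ℂ) ^ 2 +
        -((c⁻¹ : ℝ) : ℂ) * ((starRingEnd ℂ) (-((c⁻¹ : ℝ) : ℂ)) * ⟪η, π (P 1 1) η⟫_ℂ)) =
      ⟪ξ, π (P 0 0) ξ⟫_ℂ - ((2 * (c⁻¹ * ‖η‖ ^ 2) : ℝ) : ℂ) +
        ((c⁻¹ * c⁻¹ : ℝ) : ℂ) * ⟪η, π (P 1 1) η⟫_ℂ := by
    rw [map_neg, Complex.conj_ofReal]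
    push_cast
    ring
  have h5 : 0 ≤ (⟪ξ, π (P 0 0) ξ⟫_ℂ).re - 2 * (c⁻¹ * ‖η‖ ^ 2) +
      c⁻¹ * c⁻¹ * (⟪η, π (P 1 1) η⟫_ℂ).re := by
    have h := (Complex.le_def.1 h1).1.trans_eq (congrArg Complex.re e1)
    rwa [Complex.add_re, Complex.sub_re, Complex.re_ofReal_mul, Complex.ofReal_re] at h
  have h6 : c⁻¹ * (c⁻¹ * (⟪η, π (P 1 1) η⟫_ℂ).re) ≤ c⁻¹ * (c⁻¹ * (c * ‖η‖ ^ 2)) := by gcongr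
  rw [inv_mul_cancel_left₀ hc.ne'] at h6
  have h7 : c⁻¹ * ‖η‖ ^ 2 ≤ (⟪ξ, π (P 0 0) ξ⟫_ℂ).re := by linarith
  rwa [inv_mul_le_iff₀ hc] at h7

end CStarMatrix

/-! ### Extension of positive functionals; positivity of complete isometries -/

/-- A positive functional on an operator system has a positive extension along a completely
isometric map; here in terms of two embeddings of a vector space. -/
theorem PositiveLinearMap.exists_extension {V : Type*} [AddCommGroup V] [Module ℂ V] {A : Type v}
    [CStarAlgebra A] [PartialOrder A] [StarOrderedRing A] {B : Type u} [CStarAlgebra B]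
    [PartialOrder B] [StarOrderedRing B] (ι : V →ₗ[ℂ] A) (J : V →ₗ[ℂ] B)
    (hJ : ∀ v, ‖J v‖ = ‖ι v‖) (hι : Function.Injective ι) {e : V} (he : ι e = 1) (he' : J e = 1)
    (τ : A →ₚ[ℂ] ℂ) : ∃ g : B →ₚ[ℂ] ℂ, ∀ v, g (J v) = τ (ι v) := by
  have hJi : Function.Injective J := (injective_iff_map_eq_zero J).2 fun v hv => by
    have h := hJ v
    rw [hv, norm_zero, eq_comm, norm_eq_zero] at h
    exact (injective_iff_map_eq_zero ι).1 hι v h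
  let E := LinearEquiv.ofInjective J hJi
  have hE : ∀ v, E.symm ⟨J v, LinearMap.mem_range_self J v⟩ = v := fun v =>
    E.symm_apply_apply v
  let f : LinearMap.range J →ₗ[ℂ] ℂ := τ.toLinearMap ∘ₗ ι ∘ₗ E.symm.toLinearMap
  have hf : ∀ v, f ⟨J v, LinearMap.mem_range_self J v⟩ = τ (ι v) := fun v => by
    change τ (ι (E.symm _)) = _
    rw [hE]
  have hfn : ∀ y, ‖f y‖ ≤ (τ 1).re * ‖y‖ := by
    rintro ⟨_, v, rfl⟩
    rw [hf]
    exact (τ.norm_apply_le _).trans_eq (by rw [← hJ]; rfl)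
  have h1 : 0 ≤ τ 1 := map_nonneg τ zero_le_one
  have h1' : τ 1 = ((τ 1).re : ℝ) := Complex.ext rfl (by simpa using (Complex.le_def.1 h1).2.symm)
  -- A norm-preserving Hahn–Banach extension attains its bound at the unit, and is therefore
  -- positive.
  obtain ⟨g, hg, hgn⟩ := exists_extension_norm_eq (LinearMap.range J) (f.mkContinuous _ hfn)
  have hgf : ∀ v, g (J v) = τ (ι v) := fun v =>
    (hg ⟨J v, LinearMap.mem_range_self J v⟩).trans (hf v)
  have hbound : ∀ x, ‖g x‖ ≤ (τ 1).re * ‖x‖ := fun x => by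
    refine g.le_of_opNorm_le ?_ x
    rw [hgn]
    exact f.mkContinuous_norm_le (Complex.le_def.1 h1).1 hfn
  refine ⟨PositiveLinearMap.mk₀ g.toLinearMap fun x hx => ?_, hgf⟩
  -- If `τ 1 = 0` the extension is zero; otherwise it can be normalized by dividing by `τ 1`.
  rcases (Complex.le_def.1 h1).1.eq_or_lt with h0 | h0
  · have h2 := hbound x
    rw [← h0] at h2
    simp at h2
    exact h2.ge
  · exact LinearMap.nonneg_of_norm_le g.toLinearMap h0
      ((congrArg g he').symm.trans ((hgf e).trans (by rw [he]; exact h1'))) hbound hx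

namespace OperatorSystem

variable {A : Type v} [CStarAlgebra A] [PartialOrder A] [StarOrderedRing A] {S : OperatorSystem A}
  {B : Type u} [CStarAlgebra B] [PartialOrder B] [StarOrderedRing B] {j : S.toSubmodule →ₗ[ℂ] B}

theorem IsCompletelyIsometric.norm_entrywise (hj : S.IsCompletelyIsometric j) {n : ℕ}
    (M : Matrix (Fin n) (Fin n) S.toSubmodule) : ‖CStarMatrix.entrywise j n M‖ =
      ‖CStarMatrix.entrywise S.toSubmodule.subtype n M‖ := hj n M

theorem IsCompletelyIsometric.norm_apply_le (hj : S.IsCompletelyIsometric j) (x : S.toSubmodule) :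
    ‖j x‖ ≤ ‖x‖ := by
  have h1 := CStarMatrix.norm_entry_le_norm
    (M := CStarMatrix.entrywise j 1 (Matrix.of fun _ _ => x)) (i := 0) (j := 0)
  rw [hj.norm_entrywise] at h1
  have h2 : CStarMatrix.entrywise S.toSubmodule.subtype 1 (Matrix.of fun _ _ => x) =
      CStarMatrix.scalarHom A 1 x := CStarMatrix.ext fun i k => by
    rw [Subsingleton.elim k i]
    exact (Matrix.diagonal_apply_eq _ _).symm
  rw [h2] at h1
  exact h1.trans (NonUnitalStarAlgHom.norm_apply_le (CStarMatrix.scalarHom A 1) (x : A))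

theorem entrywise_diagonal_unit {A : Type v} [CStarAlgebra A] {S : OperatorSystem A} {B : Type u}
    [CStarAlgebra B] (f : S.toSubmodule →ₗ[ℂ] B) (hf : f S.unit = 1) (n : ℕ) :
    CStarMatrix.entrywise f n (Matrix.diagonal fun _ => S.unit) = 1 :=
  CStarMatrix.ext fun i k => by
    rw [CStarMatrix.entrywise_apply, CStarMatrix.one_apply, Matrix.diagonal_apply]
    split_ifs
    · exact hf
    · exact map_zero f

theorem IsCompletelyIsometric.entrywise_nonneg (hj : S.IsCompletelyIsometric j)
    (hu : S.IsUnitalMap j) {n : ℕ} {M : Matrix (Fin n) (Fin n) S.toSubmodule}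
    (hM : 0 ≤ CStarMatrix.entrywise S.toSubmodule.subtype n M) :
    0 ≤ CStarMatrix.entrywise j n M :=
  LinearMap.map_nonneg_of_norm_le (CStarMatrix.entrywise S.toSubmodule.subtype n)
    (CStarMatrix.entrywise j n) (fun v => (hj.norm_entrywise v).le)
    (entrywise_diagonal_unit _ rfl n) (entrywise_diagonal_unit j hu n) hM

theorem IsCompletelyIsometric.map_nonneg (hj : S.IsCompletelyIsometric j)
    (hu : S.IsUnitalMap j) {x : S.toSubmodule} (hx : 0 ≤ (x : A)) : 0 ≤ j x :=
  LinearMap.map_nonneg_of_norm_le S.toSubmodule.subtype j hj.norm_apply_le (e := S.unit) rfl hu hx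

theorem IsCompletelyIsometric.map_star (hj : S.IsCompletelyIsometric j)
    (hu : S.IsUnitalMap j) (x : S.toSubmodule) : j ⟨star x, S.star_mem' x.2⟩ = star (j x) := by
  have hsa : ∀ y : S.toSubmodule, IsSelfAdjoint (y : A) → star (j y) = j y := fun y hy => by
    have h1 : 0 ≤ j (((‖y‖ : ℝ) : ℂ) • S.unit - y) := hj.map_nonneg hu (by
      have := hy.le_algebraMap_norm_self
      rw [← CStarAlgebra.coe_smul_one] at this
      exact sub_nonneg.2 this)
    have h2 := (IsSelfAdjoint.of_nonneg h1).star_eq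
    have hu' : j S.unit = 1 := hu
    rw [map_sub, map_smul, hu', star_sub, star_smul, star_one] at h2
    simpa using h2
  set s : S.toSubmodule := ⟨star x, S.star_mem' x.2⟩ with hs
  have h1 := hsa (x + s) (by simp [hs, IsSelfAdjoint, add_comm])
  have h2 := hsa (Complex.I • (x - s)) (by simp [hs, IsSelfAdjoint, ← smul_neg])
  rw [map_add, star_add] at h1
  rw [map_smul, map_sub, star_smul, star_sub] at h2
  have h3 : (2 : ℂ) • j s = (2 : ℂ) • star (j x) := by
    have h4 : star Complex.I = -Complex.I := Complex.conj_I
    rw [h4] at h2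
    have h5 : Complex.I • (Complex.I • (j x - j s)) =
        Complex.I • (-Complex.I • (star (j x) - star (j s))) := by rw [h2]
    rw [smul_smul, smul_smul, Complex.I_mul_I, mul_neg, Complex.I_mul_I, neg_neg, one_smul,
      neg_one_smul] at h5
    rw [two_smul, two_smul]
    have h6 : j s = j x + (star (j x) - star (j s)) := by rw [← h5]; abel
    calc j s + j s = j s + (j x + (star (j x) - star (j s))) := by rw [← h6]
      _ = (j x + j s) + (star (j x) - star (j s)) := by abel
      _ = _ := by rw [← h1]; abel
  exact smul_right_injective B two_ne_zero h3

end OperatorSystem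

/-! ### Dilations of truncations of the identity representation -/

namespace DiscWeight

variable {W : DiscWeight} {B : Type u} [CStarAlgebra B]

/-- A representation of `B` with vectors `ξ i` on which the elements `j x` have the same matrix
coefficients as the elements `x` have on the first `N` basis vectors of `H`. -/
structure TruncatedDilation (j : W.S.toSubmodule →ₗ[ℂ] B) (N : ℕ) where
  K : Type u
  [normed : NormedAddCommGroup K]
  [innerProduct : InnerProductSpace ℂ K]
  [complete : CompleteSpace K]
  σ : B →⋆ₐ[ℂ] (K →L[ℂ] K)
  ξ : ℕ → K
  inner_eq : ∀ (x : W.S.toSubmodule) (i l : ℕ), i < N → l < N →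
    ⟪ξ i, σ (j x) (ξ l)⟫_ℂ = ⟪W.basis i, ((x : W.T) : W.H →L[ℂ] W.H) (W.basis l)⟫_ℂ

attribute [instance] TruncatedDilation.normed
attribute [instance] TruncatedDilation.innerProduct
attribute [instance] TruncatedDilation.complete

/-- The vector functional of `(e 0, …, e N)` on matrices over `T` is carried to matrices over `B`
along `j`. The GNS representation is restricted to scalar matrices, and `ξ i` is the class of the
matrix unit with row 0 and column `i`. -/
theorem nonempty_truncatedDilation [PartialOrder B] [StarOrderedRing B]
    {j : W.S.toSubmodule →ₗ[ℂ] B} (hu : W.S.IsUnitalMap j) (hj : W.S.IsCompletelyIsometric j)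
    (N : ℕ) : Nonempty (TruncatedDilation j N) := by
  obtain ⟨g, hg⟩ := PositiveLinearMap.exists_extension
    (A := CStarMatrix (Fin (N + 1)) (Fin (N + 1)) W.T)
    (B := CStarMatrix (Fin (N + 1)) (Fin (N + 1)) B)
    (CStarMatrix.entrywise W.S.toSubmodule.subtype (N + 1)) (CStarMatrix.entrywise j (N + 1))
    (fun v => hj.norm_entrywise v)
    (fun M M' h => Matrix.ext fun i k => Subtype.ext (congrFun (congrFun h i) k))
    (OperatorSystem.entrywise_diagonal_unit _ rfl _)
    (OperatorSystem.entrywise_diagonal_unit j hu _)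
    (CStarMatrix.vecFunctional W.idRep fun i : Fin (N + 1) => W.basis i)
  -- Size `N + 1` guarantees a row 0 even for `N = 0`; the reduction of `i` modulo `N + 1` is
  -- harmless for `i < N`.
  let E : ℕ → CStarMatrix (Fin (N + 1)) (Fin (N + 1)) B := fun i =>
    CStarMatrix.ofMatrix (Matrix.single 0 (Fin.ofNat (N + 1) i) 1)
  refine ⟨{ K := g.GNS
            σ := g.gnsStarAlgHom.comp (CStarMatrix.scalarHom B (N + 1))
            ξ := fun i => ((g.toPreGNS (E i) : g.PreGNS) : g.GNS)
            inner_eq := fun x i l hi hl => ?_ }⟩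
  have h1 : (g.gnsStarAlgHom.comp (CStarMatrix.scalarHom B (N + 1))) (j x)
      ((g.toPreGNS (E l) : g.PreGNS) : g.GNS) =
      ((g.toPreGNS (CStarMatrix.scalarHom B (N + 1) (j x) * E l) : g.PreGNS) : g.GNS) := by
    have h := g.gnsNonUnitalStarAlgHom_apply_coe (a := CStarMatrix.scalarHom B (N + 1) (j x))
      (b := g.toPreGNS (E l))
    exact h
  rw [h1, UniformSpace.Completion.inner_coe, PositiveLinearMap.preGNS_inner_def,
    PositiveLinearMap.ofPreGNS_toPreGNS, PositiveLinearMap.ofPreGNS_toPreGNS]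
  have h2 : star (E i) * (CStarMatrix.scalarHom B (N + 1) (j x) * E l) =
      CStarMatrix.entrywise j (N + 1)
        (Matrix.single (Fin.ofNat (N + 1) i) (Fin.ofNat (N + 1) l) x) := by
    have h3 : (Matrix.single (0 : Fin (N + 1)) (Fin.ofNat (N + 1) i) (1 : B)).conjTranspose *
        (Matrix.diagonal (fun _ => j x) * Matrix.single 0 (Fin.ofNat (N + 1) l) 1) =
        (Matrix.single (Fin.ofNat (N + 1) i) (Fin.ofNat (N + 1) l) x).map fun x => j x := by
      rw [Matrix.conjTranspose_single, ← Matrix.mul_assoc, Matrix.single_mul_mul_single,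
        Matrix.map_single _ _ _ j]
      simp
    exact h3
  rw [h2, hg, CStarMatrix.vecFunctional_apply, Finset.sum_eq_single (Fin.ofNat (N + 1) i),
    Finset.sum_eq_single (Fin.ofNat (N + 1) l)]
  · rw [CStarMatrix.entrywise_apply, Matrix.single_apply_same, Fin.val_ofNat, Fin.val_ofNat,
      Nat.mod_eq_of_lt (by lia), Nat.mod_eq_of_lt (by lia)]
    rfl
  · intro q _ hq
    rw [CStarMatrix.entrywise_apply, Matrix.single_apply_of_col_ne _ _ hq.symm]
    simp
  · simp
  · intro p _ hp
    refine Finset.sum_eq_zero fun q _ => ?_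
    rw [CStarMatrix.entrywise_apply, Matrix.single_apply_of_row_ne hp.symm]
    simp
  · simp

end DiscWeight

theorem ContinuousLinearMap.ofReal_smul_le_smul {K : Type w} [NormedAddCommGroup K]
    [InnerProductSpace ℂ K] {D E : K →L[ℂ] K} {r : ℝ} (hr : 0 ≤ r) (h : D ≤ E) :
    (r : ℂ) • D ≤ (r : ℂ) • E := by
  rw [le_def, ← smul_sub]
  exact ((le_def D E).1 h).smul_of_nonneg (Complex.zero_le_real.2 hr)

namespace OperatorSystem

variable {A : Type v} [CStarAlgebra A] [PartialOrder A] [StarOrderedRing A] {S : OperatorSystem A}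
  {B : Type u} [CStarAlgebra B] [PartialOrder B] [StarOrderedRing B] {j : S.toSubmodule →ₗ[ℂ] B}

theorem IsCompletelyIsometric.map_le_smul_one (hj : S.IsCompletelyIsometric j)
    (hu : S.IsUnitalMap j) {x : S.toSubmodule} {c : ℂ} (h : (x : A) ≤ c • 1) : j x ≤ c • 1 := by
  have h1 : 0 ≤ j (c • S.unit - x) := hj.map_nonneg hu (sub_nonneg.2 h)
  have hu' : j S.unit = 1 := hu
  rw [map_sub, map_smul, hu'] at h1
  exact sub_nonneg.1 h1

theorem IsCompletelyIsometric.norm_sq_apply_le (hj : S.IsCompletelyIsometric j)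
    (hu : S.IsUnitalMap j) {K : Type w} [NormedAddCommGroup K] [InnerProductSpace ℂ K]
    [CompleteSpace K] (σ : B →⋆ₐ[ℂ] (K →L[ℂ] K)) {M : Matrix (Fin 2) (Fin 2) S.toSubmodule}
    (hM : 0 ≤ CStarMatrix.entrywise S.toSubmodule.subtype 2 M) {c : ℝ} (hc : 0 < c)
    (h : (M 1 1 : A) ≤ (c : ℂ) • 1) (ξ : K) :
    ‖σ (j (M 1 0)) ξ‖ ^ 2 ≤ c * (⟪ξ, σ (j (M 0 0)) ξ⟫_ℂ).re :=
  CStarMatrix.norm_sq_apply_le σ (hj.entrywise_nonneg hu hM) hc (hj.map_le_smul_one hu h) ξ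

end OperatorSystem

namespace DiscWeight

variable {W : DiscWeight} {b : ℕ → ℝ}

/-! ### Bounds for the compressed residual operators -/

/-- Evaluate `e 0 ⊗ e 0 ≤ R_N` at the normalized kernel `k`: since `A* k = k`, the right side is `1
- ∑ b m`, and the left side is strictly positive. -/
theorem sum_pickSeq_lt_one (hb : IsPickSeq W b) (N : ℕ) : ∑ m ∈ Finset.range N, b m < 1 := by
  set k := normalizedKernelOne W with hk
  have h1 := re_inner_le_of_le (rankOne_le_pickRes hb N) k
  have h2 : (⟪k, pickRes W b N k⟫_ℂ).re = 1 - ∑ m ∈ Finset.range N, b m := by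
    have h3 : ∀ m : ℕ, ⟪k, (mulOp W X ^ m * 1 * star (mulOp W X ^ m)) k⟫_ℂ = 1 := fun m => by
      rw [← mulOp_X_pow, inner_conj_mulOp, one_apply_eq_self, star_mulOp_normalizedKernelOne,
        eval_pow, eval_X, one_pow, star_one, one_smul, inner_self_eq_norm_sq_to_K,
        norm_normalizedKernelOne]
      simp
    rw [pickRes, sub_apply, sum_apply, inner_sub_right, inner_sum, one_apply_eq_self,
      inner_self_eq_norm_sq_to_K, norm_normalizedKernelOne]
    simp only [smul_apply, inner_smul_right, h3]
    simp
  have h4 : 0 < (⟪k, rankOne ℂ (W.basis 0) (W.basis 0) k⟫_ℂ).re := by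
    have h5 : ⟪W.basis 0, k⟫_ℂ ≠ 0 := by
      rw [hk, normalizedKernelOne, inner_smul_right, inner_basis_kernelOne]
      exact mul_ne_zero (Complex.ofReal_ne_zero.2 (inv_ne_zero
        (norm_ne_zero_iff.2 kernelOne_ne_zero))) (sqrt_ne_zero 0)
    rw [rankOne_apply, inner_smul_right, ← inner_conj_symm k, Complex.mul_conj']
    have h6 : 0 < ‖⟪W.basis 0, k⟫_ℂ‖ ^ 2 := by positivity
    exact_mod_cast h6
  linarith

theorem a_le_one (hb : IsPickSeq W b) (n : ℕ) : W.a n ≤ 1 := by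
  induction n using Nat.strong_induction_on with
  | _ n ih =>
    cases n with
    | zero => exact W.zero.le
    | succ n =>
      rw [hb.recurrence]
      refine (Finset.sum_le_sum fun m hm => ?_).trans (sum_pickSeq_lt_one hb (n + 1)).le
      exact mul_le_of_le_one_right (hb.nonneg m) (ih _ (by lia))

theorem a_lt_one (hb : IsPickSeq W b) {n : ℕ} (hn : n ≠ 0) : W.a n < 1 := by
  obtain ⟨n, rfl⟩ := Nat.exists_eq_succ_of_ne_zero hn
  rw [Nat.succ_eq_add_one, hb.recurrence]
  refine (Finset.sum_le_sum fun m _ => ?_).trans_lt (sum_pickSeq_lt_one hb (n + 1))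
  exact mul_le_of_le_one_right (hb.nonneg m) (a_le_one hb _)

theorem tendsto_ratio (W : DiscWeight) (k : ℕ) :
    Tendsto (fun q => W.a q / W.a (q + k)) atTop (𝓝 1) := by
  induction k with
  | zero =>
    refine tendsto_const_nhds.congr fun q => ?_
    rw [add_zero, div_self (W.pos q).ne']
  | succ k ih =>
    have h := ih.mul (W.ratio.comp (tendsto_add_atTop_nat k))
    rw [mul_one] at h
    refine h.congr fun q => ?_
    have := (W.pos (q + k)).ne'
    rw [Function.comp_apply, ← add_assoc]
    field_simp

/-- At `e (q + k)` the eigenvalue is `1 / a k` for `q = 0`, zero for `1 ≤ q ≤ L`, and at most `a q /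
a (q + k)` beyond. The last tends to 1, which for `k ≠ 0` is strictly below `1 / a k` by `a_lt_one`.
-/
theorem eventually_conj_pickRes_le (hb : IsPickSeq W b) (k : ℕ) : ∀ᶠ L in atTop,
    mulOp W X ^ k * pickRes W b L * star (mulOp W X ^ k) ≤ (((W.a k)⁻¹ : ℝ) : ℂ) • 1 := by
  have hev : ∀ᶠ q in atTop, W.a q / W.a (q + k) ≤ (W.a k)⁻¹ := by
    rcases eq_or_ne k 0 with rfl | hk
    · refine Eventually.of_forall fun q => ?_
      rw [add_zero, div_self (W.pos q).ne', W.zero, inv_one]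
    · exact ((tendsto_ratio W k).eventually_lt_const
        ((one_lt_inv₀ (W.pos k)).2 (a_lt_one hb hk))).mono fun _ => le_of_lt
  obtain ⟨L₀, hL₀⟩ := eventually_atTop.1 hev
  filter_upwards [eventually_ge_atTop L₀] with L hL
  refine ((isDiag_pickRes b L).conj k).le (isDiag_one.smul (W.a k)⁻¹) fun n => ?_
  rw [mul_one]
  have hpos : 0 ≤ (W.a k)⁻¹ := (inv_pos.2 (W.pos k)).le
  split_ifs with h
  · obtain ⟨q, rfl⟩ := Nat.exists_eq_add_of_le' h
    rw [Nat.add_sub_cancel]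
    rcases eq_or_ne q 0 with rfl | hq
    · rw [pickResVal_zero, W.zero, zero_add, one_mul, one_div]
    · rcases le_or_gt q L with hqL | hqL
      · rw [pickResVal_eq_zero hb hq hqL, zero_mul]
        exact hpos
      · exact (mul_le_of_le_one_left (div_nonneg (W.pos _).le (W.pos _).le)
          (pickResVal_le_one hb L q)).trans (hL₀ q (by lia))
  · exact hpos

/-! ### Truncated dilations intertwine -/

/-- The element `A^m x A*^n` of `S`, where `A = M_z`. -/
def shiftConj (m n : ℕ) : W.S.toSubmodule →ₗ[ℂ] W.S.toSubmodule where
  toFun x := ⟨W.M (X ^ m) * x * star (W.M (X ^ n)), mul_mul_star_mem_S x.2 _ _⟩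
  map_add' x y := Subtype.ext (by simp [mul_add, add_mul])
  map_smul' t x := Subtype.ext (by simp)

theorem coe_shiftConj (m n : ℕ) (x : W.S.toSubmodule) :
    ((shiftConj m n x : W.S.toSubmodule) : W.T) = W.M (X ^ m) * x * star (W.M (X ^ n)) := rfl

theorem shiftConj_apply (m n : ℕ) (x : W.S.toSubmodule) (f : W.H) :
    (((shiftConj m n x : W.S.toSubmodule) : W.T) : W.H →L[ℂ] W.H) f =
      (mulOp W X ^ m) (((x : W.T) : W.H →L[ℂ] W.H) (star (mulOp W X ^ n) f)) := by
  rw [← mulOp_X_pow, ← mulOp_X_pow]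
  rfl

theorem TruncatedDilation.inner_ξ {B : Type u} [CStarAlgebra B]
    {j : W.S.toSubmodule →ₗ[ℂ] B} {N : ℕ} (D : TruncatedDilation j N) (hu : W.S.IsUnitalMap j)
    {i l : ℕ} (hi : i < N) (hl : l < N) : ⟪D.ξ i, D.ξ l⟫_ℂ = if i = l then 1 else 0 := by
  have h := D.inner_eq W.S.unit i l hi hl
  have hu' : j W.S.unit = 1 := hu
  rw [hu', map_one, one_apply_eq_self] at h
  rw [h, ← inner_basis_basis]
  rfl

variable {B : Type u} [CStarAlgebra B] [PartialOrder B] [StarOrderedRing B]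
  {j : W.S.toSubmodule →ₗ[ℂ] B} {N : ℕ}

/-- With `x = s* s`, the matrix of compressions of `x` is `Z* Z` for the row `(s A*^n, s A*^m)`. The
factors need not lie in `S`, but the entries of `Z* Z` do, so `j` preserves its positivity. -/
theorem TruncatedDilation.norm_sq_shiftConj_le (D : TruncatedDilation j N)
    (hu : W.S.IsUnitalMap j) (hj : W.S.IsCompletelyIsometric j) {x : W.S.toSubmodule}
    (hx : 0 ≤ (x : W.T)) (m n : ℕ) {c : ℝ} (hc : 0 < c)
    (h : ((shiftConj m m x : W.S.toSubmodule) : W.T) ≤ (c : ℂ) • 1) (η : D.K) :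
    ‖D.σ (j (shiftConj m n x)) η‖ ^ 2 ≤ c * (⟪η, D.σ (j (shiftConj n n x)) η⟫_ℂ).re := by
  obtain ⟨s, hs⟩ := CStarAlgebra.nonneg_iff_eq_star_mul_self.1 hx
  let M : Matrix (Fin 2) (Fin 2) W.S.toSubmodule :=
    !![shiftConj n n x, shiftConj n m x; shiftConj m n x, shiftConj m m x]
  have hM : 0 ≤ CStarMatrix.entrywise W.S.toSubmodule.subtype 2 M := by
    let Z : CStarMatrix (Fin 2) (Fin 2) W.T := CStarMatrix.ofMatrix
      !![s * star (W.M (X ^ n)), s * star (W.M (X ^ m)); 0, 0]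
    have hZ : CStarMatrix.entrywise W.S.toSubmodule.subtype 2 M = star Z * Z := by
      refine CStarMatrix.ext fun i k => ?_
      rw [CStarMatrix.star_mul_self_apply, Fin.sum_univ_two, CStarMatrix.entrywise_apply]
      fin_cases i <;> fin_cases k <;>
        simp [M, Z, coe_shiftConj, hs, mul_assoc]
    rw [hZ]
    exact star_mul_self_nonneg Z
  exact hj.norm_sq_apply_le hu D.σ hM hc h η

theorem TruncatedDilation.shiftConj_apply_eq_zero (D : TruncatedDilation j N)
    (hu : W.S.IsUnitalMap j) (hj : W.S.IsCompletelyIsometric j) {x : W.S.toSubmodule}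
    (hx : 0 ≤ (x : W.T)) (m n : ℕ) {i : ℕ} (hi : i < N)
    (h : ((x : W.T) : W.H →L[ℂ] W.H) (star (mulOp W X ^ n) (W.basis i)) = 0) :
    D.σ (j (shiftConj m n x)) (D.ξ i) = 0 := by
  have h0 : 0 ≤ ((shiftConj m m x : W.S.toSubmodule) : W.T) := star_right_conjugate_nonneg hx _
  have h1 := D.norm_sq_shiftConj_le hu hj hx m n
    (c := ‖((shiftConj m m x : W.S.toSubmodule) : W.T)‖ + 1) (by positivity) (by
      rw [CStarAlgebra.coe_smul_one]
      exact (IsSelfAdjoint.of_nonneg h0).le_algebraMap_norm_self.trans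
        (algebraMap_mono _ (by linarith))) (D.ξ i)
  rw [D.inner_eq _ _ _ hi hi, shiftConj_apply, h, map_zero, inner_zero_right, Complex.zero_re,
    mul_zero] at h1
  rw [← norm_eq_zero]
  exact pow_eq_zero_iff two_ne_zero |>.1 (le_antisymm h1 (by positivity))

theorem coe_smul_one_T (c : ℂ) : ((c • 1 : W.T) : W.H →L[ℂ] W.H) = c • 1 := rfl

theorem T_le_iff {x y : W.T} : x ≤ y ↔ (x : W.H →L[ℂ] W.H) ≤ y := Iff.rfl

/-- A positive contraction in `S` which fixes the basis vector `e k`, and whose compression by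
`A^m` has the smallest possible norm. -/
theorem exists_fixing_contraction (hb : IsPickSeq W b) (m k : ℕ) : ∃ x : W.S.toSubmodule,
    0 ≤ (x : W.T) ∧ 0 ≤ ((W.S.unit - x : W.S.toSubmodule) : W.T) ∧
      ((x : W.T) : W.H →L[ℂ] W.H) (W.basis k) = W.basis k ∧
      ((shiftConj m m x : W.S.toSubmodule) : W.T) ≤ ((W.a k / W.a (m + k) : ℝ) : ℂ) • 1 := by
  -- One `L` serves both `k`, for the bound `x ≤ 1`, and `m + k`, for the bound on the compression;
  -- here `x = a k A^k R_L A*^k`.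
  obtain ⟨L, hL1, hL2⟩ := ((eventually_conj_pickRes_le hb k).and
    (eventually_conj_pickRes_le hb (m + k))).exists
  obtain ⟨R, hRS, hR⟩ := exists_mem_S_pickRes (W := W) b L
  let x : W.S.toSubmodule := (W.a k : ℂ) • shiftConj k k ⟨R, hRS⟩
  have hx : ((x : W.T) : W.H →L[ℂ] W.H) =
      (W.a k : ℂ) • (mulOp W X ^ k * pickRes W b L * star (mulOp W X ^ k)) := by
    rw [← hR, ← mulOp_X_pow]
    rfl
  have hxd := (((isDiag_pickRes (W := W) b L).conj k).smul (W.a k))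
  refine ⟨x, T_le_iff.2 ?_, ?_, ?_, T_le_iff.2 ?_⟩
  · rw [hx]
    refine hxd.nonneg fun q => mul_nonneg (W.pos k).le ?_
    split_ifs
    · exact mul_nonneg (pickResVal_nonneg hb _ _) (div_nonneg (W.pos _).le (W.pos _).le)
    · exact le_rfl
  · have h : ((x : W.T) : W.H →L[ℂ] W.H) ≤ ((1 : W.T) : W.H →L[ℂ] W.H) := by
      rw [hx]
      refine (ofReal_smul_le_smul (W.pos k).le hL1).trans_eq ?_
      rw [smul_smul, ← Complex.ofReal_mul, mul_inv_cancel₀ (W.pos k).ne', Complex.ofReal_one,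
        one_smul]
      rfl
    exact sub_nonneg.2 (T_le_iff.2 h)
  · rw [hx, hxd]
    simp [pickResVal_zero, W.zero, mul_inv_cancel₀ (W.pos k).ne']
  · have h5 : (((shiftConj m m x : W.S.toSubmodule) : W.T) : W.H →L[ℂ] W.H) =
        (W.a k : ℂ) • (mulOp W X ^ (m + k) * pickRes W b L * star (mulOp W X ^ (m + k))) := by
      refine ContinuousLinearMap.ext fun f => ?_
      rw [shiftConj_apply, hx, pow_add, star_mul]
      simp only [smul_apply, mul_apply_eq_comp, map_smul]
    rw [h5, coe_smul_one_T, div_eq_mul_inv, Complex.ofReal_mul, mul_smul]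
    exact ofReal_smul_le_smul (W.pos k).le hL2

/-- Split the unit as `x + (1 - x)` with `x` fixing `e k`. The part `1 - x` contributes zero; the
part `x` has norm at most `wt k m * wt k n`, and this is also its inner product with the unit vector
`ξ (k + m)`, so it is that multiple of it. -/
theorem TruncatedDilation.shiftConj_unit_apply_add (D : TruncatedDilation j N)
    (hu : W.S.IsUnitalMap j) (hj : W.S.IsCompletelyIsometric j) (hb : IsPickSeq W b) (m n k : ℕ)
    (hn : k + n < N) (hm : k + m < N) :
    D.σ (j (shiftConj m n W.S.unit)) (D.ξ (k + n)) =
      ((W.wt k m * W.wt k n : ℝ) : ℂ) • D.ξ (k + m) := by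
  obtain ⟨x, hx0, hx1, hxk, hxm⟩ := exists_fixing_contraction hb m k
  have hstar := star_pow_basis_add (W := W) n k
  have h1 : D.σ (j (shiftConj m n (W.S.unit - x))) (D.ξ (k + n)) = 0 := by
    refine D.shiftConj_apply_eq_zero hu hj hx1 m n hn ?_
    rw [hstar, map_smul]
    change _ • (W.basis k - ((x : W.T) : W.H →L[ℂ] W.H) (W.basis k)) = _
    rw [hxk, sub_self, smul_zero]
  set u := D.σ (j (shiftConj m n x)) (D.ξ (k + n)) with hudef
  have h2 : D.σ (j (shiftConj m n W.S.unit)) (D.ξ (k + n)) = u := by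
    rw [map_sub, map_sub, map_sub, sub_apply, sub_eq_zero] at h1
    exact h1
  have hval : ∀ m, (((shiftConj m n x : W.S.toSubmodule) : W.T) : W.H →L[ℂ] W.H)
      (W.basis (k + n)) = ((W.wt k m * W.wt k n : ℝ) : ℂ) • W.basis (k + m) := fun m => by
    rw [shiftConj_apply, hstar, map_smul, hxk, map_smul, mulOp_pow_basis, smul_smul, mul_comm]
    push_cast
    rfl
  have h3 : ‖u‖ ^ 2 ≤ W.a k / W.a (m + k) * (W.wt k n * W.wt k n) := by
    have h4 := D.norm_sq_shiftConj_le hu hj hx0 m n (div_pos (W.pos k) (W.pos (m + k))) hxm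
      (D.ξ (k + n))
    rw [D.inner_eq _ _ _ hn hn, hval, inner_smul_right, inner_basis_basis, if_pos rfl, mul_one,
      Complex.ofReal_re] at h4
    exact h4
  have h4 : ⟪D.ξ (k + m), u⟫_ℂ = ((W.wt k m * W.wt k n : ℝ) : ℂ) := by
    rw [hudef, D.inner_eq _ _ _ hm hn, hval, inner_smul_right, inner_basis_basis, if_pos rfl,
      mul_one]
  have h5 : ‖D.ξ (k + m)‖ = 1 := by
    have h := D.inner_ξ hu hm hm
    rw [if_pos rfl, inner_self_eq_norm_sq_to_K] at h
    have h6 : ‖D.ξ (k + m)‖ ^ 2 = 1 := Complex.ofReal_injective (by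
      push_cast
      exact h)
    exact (pow_eq_one_iff_of_nonneg (norm_nonneg _) two_ne_zero).1 h6
  have h6 : W.a k / W.a (m + k) * (W.wt k n * W.wt k n) = (W.wt k m * W.wt k n) ^ 2 := by
    rw [add_comm m k, ← wt_sq]
    ring
  rw [h6] at h3
  rw [h2]
  generalize W.wt k m * W.wt k n = w at h3 h4
  -- Equality in Cauchy–Schwarz: `‖u - w ξ‖^2 = ‖u‖^2 - 2 w^2 + w^2 ≤ 0`.
  rw [← sub_eq_zero, ← norm_eq_zero]
  refine pow_eq_zero_iff two_ne_zero |>.1 (le_antisymm ?_ (by positivity))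
  rw [norm_sub_sq (𝕜 := ℂ), norm_smul, h5, inner_smul_right, ← inner_conj_symm, h4,
    Complex.conj_ofReal, ← Complex.ofReal_mul, Complex.norm_real, Real.norm_eq_abs, mul_one,
    sq_abs]
  change _ - 2 * ((w * w : ℝ) : ℂ).re + _ ≤ 0
  rw [Complex.ofReal_re]
  linarith

theorem TruncatedDilation.shiftConj_unit_apply_of_lt (D : TruncatedDilation j N)
    (hu : W.S.IsUnitalMap j) (hj : W.S.IsCompletelyIsometric j) (m : ℕ) {n i : ℕ}
    (hi : i < N) (hn : i < n) : D.σ (j (shiftConj m n W.S.unit)) (D.ξ i) = 0 := by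
  refine D.shiftConj_apply_eq_zero hu hj zero_le_one m n hi ?_
  rw [star_pow_basis_of_lt hn, map_zero]

end DiscWeight

namespace DiscWeight

variable {W : DiscWeight} {B : Type u} [CStarAlgebra B] {j : W.S.toSubmodule →ₗ[ℂ] B} {N : ℕ}

/-! ### The asymptotic intertwining relation -/

namespace TruncatedDilation

/-- The partial isometry which maps the basis vector `e k` to `ξ k`, for `k < N`. -/
def embed (D : TruncatedDilation j N) : W.H →L[ℂ] D.K :=
  ∑ k ∈ Finset.range N, rankOne ℂ (D.ξ k) (W.basis k)

theorem embed_apply (D : TruncatedDilation j N) (f : W.H) :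
    D.embed f = ∑ k ∈ Finset.range N, ⟪W.basis k, f⟫_ℂ • D.ξ k := by
  simp [embed, sum_apply]

theorem embed_basis (D : TruncatedDilation j N) {k : ℕ} (hk : k < N) :
    D.embed (W.basis k) = D.ξ k := by
  rw [embed_apply, Finset.sum_eq_single k]
  · rw [inner_basis_basis, if_pos rfl, one_smul]
  · intro l _ hl
    rw [inner_basis_basis, if_neg hl, zero_smul]
  · exact fun h => absurd (Finset.mem_range.2 hk) h

theorem norm_embed (D : TruncatedDilation j N) (hu : W.S.IsUnitalMap j) (f : W.H) :
    ‖D.embed f‖ = ‖W.trunc N f‖ := by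
  have h : ⟪D.embed f, D.embed f⟫_ℂ = ⟪W.trunc N f, W.trunc N f⟫_ℂ := by
    rw [embed_apply, trunc_apply, inner_sum, inner_sum]
    refine Finset.sum_congr rfl fun l hl => ?_
    rw [sum_inner, sum_inner]
    refine Finset.sum_congr rfl fun k hk => ?_
    rw [inner_smul_left, inner_smul_left, inner_smul_right, inner_smul_right, inner_basis_basis,
      D.inner_ξ hu (Finset.mem_range.1 hk) (Finset.mem_range.1 hl)]
  rw [inner_self_eq_norm_sq_to_K, inner_self_eq_norm_sq_to_K] at h
  have h2 : ‖D.embed f‖ ^ 2 = ‖W.trunc N f‖ ^ 2 := Complex.ofReal_injective (by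
    push_cast
    exact h)
  exact (pow_left_inj₀ (norm_nonneg _) (norm_nonneg _) two_ne_zero).1 h2

theorem norm_embed_le (D : TruncatedDilation j N) (hu : W.S.IsUnitalMap j) (f : W.H) :
    ‖D.embed f‖ ≤ ‖f‖ := by
  rw [D.norm_embed hu]
  refine le_of_sq_le_sq ?_ (norm_nonneg _)
  refine hasSum_le (fun k => ?_) (hasSum_norm_sq (W.trunc N f)) (hasSum_norm_sq f)
  rw [inner_basis_trunc]
  split_ifs
  · exact le_rfl
  · rw [norm_zero]
    exact pow_le_pow_left₀ le_rfl (norm_nonneg _) 2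

/-- The failure of `embed` to intertwine `p.1` and `p.2`. -/
def defect (D : TruncatedDilation j N) (p : B × W.T) : W.H →L[ℂ] D.K :=
  (D.σ p.1).comp D.embed - D.embed.comp (p.2 : W.H →L[ℂ] W.H)

theorem defect_apply (D : TruncatedDilation j N) (p : B × W.T) (f : W.H) :
    D.defect p f = D.σ p.1 (D.embed f) - D.embed ((p.2 : W.H →L[ℂ] W.H) f) := rfl

theorem norm_σ_apply_le (D : TruncatedDilation j N) (x : B) (η : D.K) :
    ‖D.σ x η‖ ≤ ‖x‖ * ‖η‖ :=
  (le_opNorm _ _).trans (mul_le_mul_of_nonneg_right (NonUnitalStarAlgHom.norm_apply_le D.σ x)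
    (norm_nonneg _))

theorem norm_defect_apply_le (D : TruncatedDilation j N) (hu : W.S.IsUnitalMap j) (p : B × W.T)
    (f : W.H) : ‖D.defect p f‖ ≤ (‖p.1‖ + ‖p.2‖) * ‖f‖ := by
  rw [defect_apply, add_mul]
  refine (norm_sub_le _ _).trans (add_le_add ?_ ?_)
  · exact (D.norm_σ_apply_le _ _).trans
      (mul_le_mul_of_nonneg_left (D.norm_embed_le hu f) (norm_nonneg _))
  · exact (D.norm_embed_le hu _).trans (le_opNorm _ _)

theorem defect_add (D : TruncatedDilation j N) (p q : B × W.T) (f : W.H) :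
    D.defect (p + q) f = D.defect p f + D.defect q f := by
  have h : (((p + q).2 : W.T) : W.H →L[ℂ] W.H) f =
    (p.2 : W.H →L[ℂ] W.H) f + (q.2 : W.H →L[ℂ] W.H) f := rfl
  rw [defect_apply, h, Prod.fst_add, map_add, add_apply, map_add, defect_apply, defect_apply]
  abel

theorem defect_sub (D : TruncatedDilation j N) (p q : B × W.T) (f : W.H) :
    D.defect (p - q) f = D.defect p f - D.defect q f := by
  rw [eq_sub_iff_add_eq, ← defect_add, sub_add_cancel]

theorem defect_smul (D : TruncatedDilation j N) (t : ℂ) (p : B × W.T) (f : W.H) :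
    D.defect (t • p) f = t • D.defect p f := by
  have h : (((t • p).2 : W.T) : W.H →L[ℂ] W.H) f = t • (p.2 : W.H →L[ℂ] W.H) f := rfl
  rw [defect_apply, h, Prod.smul_fst, map_smul, smul_apply, map_smul, defect_apply, smul_sub]

theorem defect_mul (D : TruncatedDilation j N) (p q : B × W.T) (f : W.H) :
    D.defect (p * q) f =
      D.σ p.1 (D.defect q f) + D.defect p ((q.2 : W.H →L[ℂ] W.H) f) := by
  have h : (((p * q).2 : W.T) : W.H →L[ℂ] W.H) f =
    (p.2 : W.H →L[ℂ] W.H) ((q.2 : W.H →L[ℂ] W.H) f) := rfl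
  rw [defect_apply, h, Prod.fst_mul, map_mul, mul_apply_eq_comp, defect_apply, defect_apply,
    map_sub]
  abel

theorem defect_one (D : TruncatedDilation j N) (f : W.H) : D.defect 1 f = 0 := by
  have h : (((1 : B × W.T).2 : W.T) : W.H →L[ℂ] W.H) f = f := rfl
  rw [defect_apply, h, Prod.fst_one, map_one, one_apply_eq_self, sub_self]

end TruncatedDilation

/-- A sequence of truncated dilations asymptotically intertwines `p.1` and `p.2`. -/
def Intertwines (D : ∀ N, TruncatedDilation j N) (p : B × W.T) : Prop :=
  ∀ f : W.H, Tendsto (fun N => ‖(D N).defect p f‖) atTop (𝓝 0)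

variable {D : ∀ N, TruncatedDilation j N}

theorem Intertwines.add {p q : B × W.T} (hp : Intertwines D p) (hq : Intertwines D q) :
    Intertwines D (p + q) := fun f => by
  have h := (hp f).add (hq f)
  rw [add_zero] at h
  refine squeeze_zero (fun _ => norm_nonneg _) (fun N => ?_) h
  rw [TruncatedDilation.defect_add]
  exact norm_add_le _ _

theorem Intertwines.smul {p : B × W.T} (hp : Intertwines D p) (t : ℂ) :
    Intertwines D (t • p) := fun f => by
  have h := (hp f).const_mul ‖t‖
  rw [mul_zero] at h
  refine h.congr fun N => ?_
  rw [TruncatedDilation.defect_smul, norm_smul]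

theorem Intertwines.mul {p q : B × W.T} (hp : Intertwines D p) (hq : Intertwines D q) :
    Intertwines D (p * q) := fun f => by
  have h := ((hq f).const_mul ‖p.1‖).add (hp ((q.2 : W.H →L[ℂ] W.H) f))
  rw [mul_zero, add_zero] at h
  refine squeeze_zero (fun _ => norm_nonneg _) (fun N => ?_) h
  rw [TruncatedDilation.defect_mul]
  refine (norm_add_le _ _).trans ?_
  gcongr
  exact (D N).norm_σ_apply_le _ _

theorem intertwines_one : Intertwines D 1 := fun f => by
  refine tendsto_const_nhds.congr fun N => ?_
  rw [TruncatedDilation.defect_one, norm_zero]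

theorem isClosed_setOf_intertwines (hu : W.S.IsUnitalMap j) :
    IsClosed {p | Intertwines D p} := by
  simp only [Intertwines, Set.ofPred_forall]
  refine isClosed_iInter fun f => ?_
  refine isClosed_setOf_tendsto_zero (2 * ‖f‖) fun N p q => ?_
  refine (abs_norm_sub_norm_le _ _).trans ?_
  rw [← TruncatedDilation.defect_sub]
  refine ((D N).norm_defect_apply_le hu _ f).trans ?_
  have h1 := norm_fst_le (p - q)
  have h2 := norm_snd_le (p - q)
  nlinarith [norm_nonneg f]

/-- The norm of `embed f` is that of `trunc N f`, which tends to `‖f‖`, so no norm of `p.2 f` is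
lost in the limit. -/
theorem Intertwines.norm_snd_le_norm_fst {p : B × W.T} (hp : Intertwines D p)
    (hu : W.S.IsUnitalMap j) : ‖p.2‖ ≤ ‖p.1‖ := by
  refine opNorm_le_bound _ (norm_nonneg _) fun f => ?_
  have h1 : Tendsto (fun N => ‖W.trunc N ((p.2 : W.H →L[ℂ] W.H) f)‖) atTop
      (𝓝 ‖(p.2 : W.H →L[ℂ] W.H) f‖) := (tendsto_trunc _).norm
  have h2 : Tendsto (fun N => ‖p.1‖ * ‖f‖ + ‖(D N).defect p f‖) atTop (𝓝 (‖p.1‖ * ‖f‖)) := by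
    simpa using (hp f).const_add (‖p.1‖ * ‖f‖)
  refine le_of_tendsto_of_tendsto' h1 h2 fun N => ?_
  rw [← (D N).norm_embed hu]
  have h3 : (D N).embed ((p.2 : W.H →L[ℂ] W.H) f) =
      (D N).σ p.1 ((D N).embed f) - (D N).defect p f := by
    rw [TruncatedDilation.defect_apply, sub_sub_cancel]
  rw [h3]
  refine (norm_sub_le _ _).trans ?_
  gcongr
  exact ((D N).norm_σ_apply_le _ _).trans
    (mul_le_mul_of_nonneg_left ((D N).norm_embed_le hu f) (norm_nonneg _))

theorem intertwines_of_basis (hu : W.S.IsUnitalMap j) {p : B × W.T}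
    (h : ∀ i, ∀ᶠ N in atTop, (D N).defect p (W.basis i) = 0) : Intertwines D p := fun f => by
  induction f using basis_induction with
  | hc =>
    refine isClosed_setOf_tendsto_zero (‖p.1‖ + ‖p.2‖) fun N f g => ?_
    refine (abs_norm_sub_norm_le _ _).trans ?_
    rw [← map_sub]
    exact (D N).norm_defect_apply_le hu p _
  | hb i =>
    refine tendsto_const_nhds.congr' ((h i).mono fun N hN => ?_)
    simp only [hN, norm_zero]
  | hadd f g hf hg =>
    have h := hf.add hg
    rw [add_zero] at h
    refine squeeze_zero (fun _ => norm_nonneg _) (fun N => ?_) h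
    rw [map_add]
    exact norm_add_le _ _
  | hsmul t f hf =>
    have h := hf.const_mul ‖t‖
    rw [mul_zero] at h
    refine h.congr fun N => ?_
    rw [map_smul, norm_smul]

/-- The closed *-algebra of all pairs which are asymptotically intertwined together with their
adjoints. -/
def intertwiningAlgebra (D : ∀ N, TruncatedDilation j N) : StarSubalgebra ℂ (B × W.T) where
  carrier := {p | Intertwines D p ∧ Intertwines D (star p)}
  mul_mem' := fun hp hq => ⟨hp.1.mul hq.1, by rw [star_mul]; exact hq.2.mul hp.2⟩
  add_mem' := fun hp hq => ⟨hp.1.add hq.1, by rw [star_add]; exact hp.2.add hq.2⟩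
  algebraMap_mem' := fun t => by
    rw [Algebra.algebraMap_eq_smul_one]
    exact ⟨intertwines_one.smul t, by rw [star_smul, star_one]; exact intertwines_one.smul _⟩
  star_mem' := fun hp => ⟨hp.2, by rw [star_star]; exact hp.1⟩

theorem isClosed_intertwiningAlgebra (hu : W.S.IsUnitalMap j) :
    IsClosed (intertwiningAlgebra D : Set (B × W.T)) :=
  (isClosed_setOf_intertwines hu).inter ((isClosed_setOf_intertwines hu).preimage continuous_star)

variable [PartialOrder B] [StarOrderedRing B] {b : ℕ → ℝ}

/-- On each basis vector the relation is exact once `N` exceeds every index involved; `N > i + m`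
suffices. -/
theorem intertwines_shiftConj (hb : IsPickSeq W b) (hu : W.S.IsUnitalMap j)
    (hj : W.S.IsCompletelyIsometric j) (m n : ℕ) : Intertwines D
      (j (shiftConj m n W.S.unit), ((shiftConj m n W.S.unit : W.S.toSubmodule) : W.T)) := by
  refine intertwines_of_basis hu fun i => ?_
  filter_upwards [eventually_gt_atTop (i + m)] with N hN
  have hone : ((W.S.unit : W.T) : W.H →L[ℂ] W.H) = 1 := rfl
  rw [TruncatedDilation.defect_apply, shiftConj_apply, (D N).embed_basis (by lia), hone,
    one_apply_eq_self]
  rcases lt_or_ge i n with hi | hi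
  · rw [(D N).shiftConj_unit_apply_of_lt hu hj m (by lia) hi, star_pow_basis_of_lt hi, map_zero,
      map_zero, sub_zero]
  · obtain ⟨k, rfl⟩ := Nat.exists_eq_add_of_le' hi
    rw [(D N).shiftConj_unit_apply_add hu hj hb m n k (by lia) (by lia), star_pow_basis_add,
      map_smul, mulOp_pow_basis, smul_smul, map_smul, (D N).embed_basis (by lia), sub_eq_zero,
      mul_comm (W.wt k m)]
    push_cast
    rfl

theorem monomialPair_X_pow (m n : ℕ) :
    monomialPair (W := W) (X ^ m) (X ^ n) = shiftConj m n W.S.unit :=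
  Subtype.ext (by
    rw [coe_shiftConj]
    change _ = _ * 1 * _
    rw [mul_one]
    rfl)

theorem intertwines_monomialPair (hb : IsPickSeq W b) (hu : W.S.IsUnitalMap j)
    (hj : W.S.IsCompletelyIsometric j) (p q : ℂ[X]) : Intertwines D
      (j (monomialPair p q), ((monomialPair p q : W.S.toSubmodule) : W.T)) := by
  induction p using Polynomial.induction_on' with
  | add p r hp hr =>
    have h := hp.add hr
    rw [monomialPair_add_left, map_add]
    exact h
  | monomial m s =>
    induction q using Polynomial.induction_on' with
    | add p r hp hr =>
      have h := hp.add hr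
      rw [monomialPair_add_right, map_add]
      exact h
    | monomial n t =>
      have h := ((intertwines_shiftConj (D := D) hb hu hj m n).smul (star t)).smul s
      rw [← C_mul_X_pow_eq_monomial, ← C_mul_X_pow_eq_monomial, monomialPair_C_mul_left,
        monomialPair_C_mul_right, monomialPair_X_pow, map_smul, map_smul]
      exact h

theorem intertwines_of_mem_S (hb : IsPickSeq W b) (hu : W.S.IsUnitalMap j)
    (hj : W.S.IsCompletelyIsometric j) (x : W.S.toSubmodule) :
    Intertwines D (j x, (x : W.T)) := by
  let V : Submodule ℂ W.S.toSubmodule :=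
    { carrier := {x | Intertwines D (j x, (x : W.T))}
      add_mem' := fun {x y} hx hy => by
        have h := Intertwines.add hx hy
        rw [Set.mem_ofPred_eq, map_add]
        exact h
      zero_mem' := by
        have h := (intertwines_one (D := D)).smul 0
        rw [zero_smul] at h
        rw [Set.mem_ofPred_eq, map_zero]
        exact h
      smul_mem' := fun t x hx => by
        have h := Intertwines.smul hx t
        rw [Set.mem_ofPred_eq, map_smul]
        exact h }
  have hjc : Continuous j :=
    (LinearMap.mkContinuous j 1 fun x => by rw [one_mul]; exact hj.norm_apply_le x).continuous
  have hc : IsClosed (V : Set W.S.toSubmodule) :=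
    (isClosed_setOf_intertwines hu).preimage (hjc.prodMk continuous_subtype_val)
  have hspan : ∀ y ∈ Submodule.span ℂ {x | ∃ p q : ℂ[X], x = W.M p * star (W.M q)},
      ∃ v ∈ V, (v : W.T) = y := by
    intro y hy
    induction hy using Submodule.span_induction with
    | mem y hy =>
      obtain ⟨p, q, rfl⟩ := hy
      exact ⟨monomialPair p q, intertwines_monomialPair hb hu hj p q, rfl⟩
    | zero => exact ⟨0, V.zero_mem, rfl⟩
    | add y z _ _ hy hz =>
      obtain ⟨v, hv, rfl⟩ := hy
      obtain ⟨w, hw, rfl⟩ := hz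
      exact ⟨v + w, V.add_mem hv hw, rfl⟩
    | smul t y _ hy =>
      obtain ⟨v, hv, rfl⟩ := hy
      exact ⟨t • v, V.smul_mem t hv, rfl⟩
  obtain ⟨u, hu', hux⟩ := mem_closure_iff_seq_limit.1 x.2
  choose v hv hvu using fun n => hspan (u n) (hu' n)
  refine hc.mem_of_tendsto (f := v) (b := atTop) (tendsto_subtype_rng.2 ?_)
    (Eventually.of_forall hv)
  exact hux.congr fun n => (hvu n).symm

/-! ### The C*-envelope -/

theorem mem_intertwiningAlgebra (hb : IsPickSeq W b) (hu : W.S.IsUnitalMap j)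
    (hj : W.S.IsCompletelyIsometric j) (x : W.S.toSubmodule) :
    (j x, (x : W.T)) ∈ intertwiningAlgebra D := by
  refine ⟨intertwines_of_mem_S hb hu hj x, ?_⟩
  have h := intertwines_of_mem_S (D := D) hb hu hj ⟨star x, W.S.star_mem' x.2⟩
  rw [hj.map_star hu] at h
  exact h

theorem generates_S (W : DiscWeight) : W.S.Generates := by
  refine eq_top_iff.2 fun x _ => ?_
  have hX : W.M X ∈ StarAlgebra.adjoin ℂ (W.S.toSubmodule : Set W.T) := by
    refine StarAlgebra.subset_adjoin ℂ _ ?_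
    have h := M_mul_star_mem (W := W) X 1
    rwa [M_one, star_one, mul_one] at h
  let G := (StarAlgebra.adjoin ℂ (W.S.toSubmodule : Set W.T)).topologicalClosure
  have hle := StarSubalgebra.le_topologicalClosure
    (StarAlgebra.adjoin ℂ (W.S.toSubmodule : Set W.T))
  exact T_induction (p := fun x => x ∈ G) (StarSubalgebra.isClosed_topologicalClosure _) (hle hX)
    (hle (star_mem hX)) (fun t => algebraMap_mem G t) (fun _ _ => add_mem) (fun _ _ => mul_mem) x

end DiscWeight

theorem StarAlgHom.surjective_of_adjoin {A : Type v} {B : Type w} [CStarAlgebra A] [CStarAlgebra B]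
    (π : A →⋆ₐ[ℂ] B) {s : Set B} (hs : (StarAlgebra.adjoin ℂ s).topologicalClosure = ⊤)
    (h : s ⊆ Set.range π) : Function.Surjective π := by
  refine π.surjective_of_denseRange fun x => ?_
  have hx : x ∈ (StarAlgebra.adjoin ℂ s).topologicalClosure := hs ▸ trivial
  have hle : StarAlgebra.adjoin ℂ s ≤ π.range := StarAlgebra.adjoin_le h
  exact closure_mono (show ((StarAlgebra.adjoin ℂ s : Set B) ⊆ Set.range π) from hle) hx

namespace DiscWeight

/-- The intertwining algebra is the graph of the required map: its first projection is injective by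
`Intertwines.norm_snd_le_norm_fst` and onto because its image contains `j S`, which generates `B`.
-/
theorem isCStarEnvelope_S {W : DiscWeight} {b : ℕ → ℝ} (hb : IsPickSeq W b) :
    OperatorSystem.IsCStarEnvelope.{u} W.S := by
  refine ⟨generates_S W, fun B _ _ _ j hu hj hgen => ?_⟩
  let D : ∀ N, TruncatedDilation j N := fun N => (nonempty_truncatedDilation hu hj N).some
  let G := intertwiningAlgebra D
  have : IsClosed (G : Set (B × W.T)) := isClosed_intertwiningAlgebra hu
  let p₁ : G →⋆ₐ[ℂ] B := (StarAlgHom.fst ℂ B W.T).comp G.subtype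
  let p₂ : G →⋆ₐ[ℂ] W.T := (StarAlgHom.snd ℂ B W.T).comp G.subtype
  have hsurj : Function.Surjective p₁ := p₁.surjective_of_adjoin hgen (by
    rintro _ ⟨x, rfl⟩
    exact ⟨⟨_, mem_intertwiningAlgebra hb hu hj x⟩, rfl⟩)
  have hinj : Function.Injective p₁ := (injective_iff_map_eq_zero p₁).2 fun q hq => by
    have hq1 : (q : B × W.T).1 = 0 := hq
    have h := q.2.1.norm_snd_le_norm_fst hu
    rw [hq1, norm_zero] at h
    exact Subtype.ext (Prod.ext hq1 (norm_le_zero_iff.1 h))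
  let e : G ≃⋆ₐ[ℂ] B := StarAlgEquiv.ofBijective p₁ ⟨hinj, hsurj⟩
  have hπ : ∀ x : W.S.toSubmodule, (p₂.comp (e.symm : B →⋆ₐ[ℂ] G)) (j x) = (x : W.T) := fun x => by
    have h : e ⟨_, mem_intertwiningAlgebra hb hu hj x⟩ = j x := rfl
    have h2 := congrArg p₂ (e.symm_apply_apply ⟨_, mem_intertwiningAlgebra hb hu hj x⟩)
    rw [h] at h2
    exact h2
  refine ⟨p₂.comp (e.symm : B →⋆ₐ[ℂ] G), ?_, hπ⟩
  exact StarAlgHom.surjective_of_adjoin _ (generates_S W) fun x hx => ⟨j ⟨x, hx⟩, hπ ⟨x, hx⟩⟩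

end DiscWeight

namespace DiscWeight

/-! ### The Pick coefficients -/

/-- The coefficients of `1 - 1 / ∑ a n z^n`, shifted by one. -/
def pickCoeff (W : DiscWeight) (m : ℕ) : ℝ :=
  PowerSeries.coeff (m + 1) (1 - (PowerSeries.mk W.a)⁻¹)

/-- With `F = ∑ a n z^n`, compare coefficients in `(1 - 1/F) F = F - 1`; the zeroth coefficient of
`1 - 1/F` vanishes because `a 0 = 1`. -/
theorem pickCoeff_recurrence (W : DiscWeight) (n : ℕ) :
    W.a (n + 1) = ∑ m ∈ Finset.range (n + 1), W.pickCoeff m * W.a (n - m) := by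
  have h0 : PowerSeries.constantCoeff (PowerSeries.mk W.a) ≠ 0 := by
    rw [← PowerSeries.coeff_zero_eq_constantCoeff_apply, PowerSeries.coeff_mk, W.zero]
    exact one_ne_zero
  have h1 : (1 - (PowerSeries.mk W.a)⁻¹) * PowerSeries.mk W.a = PowerSeries.mk W.a - 1 := by
    rw [sub_mul, one_mul, PowerSeries.inv_mul_cancel _ h0]
  have h2 := congrArg (PowerSeries.coeff (n + 1)) h1
  have h3 : PowerSeries.coeff 0 (1 - (PowerSeries.mk W.a)⁻¹) = 0 := by
    rw [map_sub, PowerSeries.coeff_zero_eq_constantCoeff_apply, map_one,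
      PowerSeries.coeff_zero_eq_constantCoeff_apply, PowerSeries.constantCoeff_inv,
      ← PowerSeries.coeff_zero_eq_constantCoeff_apply, PowerSeries.coeff_mk, W.zero, inv_one,
      sub_self]
  rw [PowerSeries.coeff_mul, Finset.Nat.sum_antidiagonal_eq_sum_range_succ_mk,
    Finset.sum_range_succ', h3, zero_mul, add_zero, map_sub, PowerSeries.coeff_mk,
    PowerSeries.coeff_one, if_neg n.succ_ne_zero, sub_zero] at h2
  rw [← h2]
  refine Finset.sum_congr rfl fun m _ => ?_
  rw [PowerSeries.coeff_mk, Nat.add_sub_add_right]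
  rfl

theorem IsCompletePick.isPickSeq {W : DiscWeight} (h : W.IsCompletePick) :
    IsPickSeq W W.pickCoeff :=
  ⟨fun m => h (m + 1) (by lia), W.pickCoeff_recurrence⟩

/-- Kaluza's lemma. -/
theorem isPickSeq_of_monotone_ratio {W : DiscWeight}
    (h : Monotone fun n => W.a (n + 1) / W.a n) : IsPickSeq W W.pickCoeff := by
  refine ⟨fun n => ?_, W.pickCoeff_recurrence⟩
  induction n using Nat.strong_induction_on with
  | _ n ih =>
    have h1 := W.pickCoeff_recurrence n
    rw [Finset.sum_range_succ, Nat.sub_self, W.zero, mul_one] at h1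
    have h2 : ∑ m ∈ Finset.range n, W.pickCoeff m * W.a (n - m) ≤ W.a (n + 1) := by
      cases n with
      | zero => exact (W.pos _).le
      | succ n =>
        -- By monotonicity every ratio `a (n-m+1) / a (n-m)` is at most the last one, which factors
        -- out; the previous recurrence then sums to `a (n + 1)`.
        calc _ ≤ ∑ m ∈ Finset.range (n + 1),
              W.a (n + 1 + 1) / W.a (n + 1) * (W.pickCoeff m * W.a (n - m)) := by
              refine Finset.sum_le_sum fun m hm => ?_
              have hm' := Finset.mem_range.1 hm
              have h3 := h (show n - m ≤ n + 1 by lia)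
              have h4 := (div_le_iff₀ (W.pos (n - m))).1 h3
              rw [mul_left_comm, Nat.sub_add_comm (by lia)]
              exact mul_le_mul_of_nonneg_left h4 (ih m hm')
          _ = W.a (n + 1 + 1) := by
              rw [← Finset.mul_sum, ← W.pickCoeff_recurrence, div_mul_cancel₀ _ (W.pos _).ne']
    linarith

/-- The ratio is `((n + 2) / (n + 1)) ^ s`, with decreasing base and negative exponent. -/
theorem monotone_ratio_powerWeight (s : ℝ) (hs : s < -1) :
    Monotone fun n => (powerWeight s hs).a (n + 1) / (powerWeight s hs).a n := by
  intro m n hmn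
  change ((m + 1 : ℕ) + 1 : ℝ) ^ s / ((m : ℝ) + 1) ^ s ≤
    ((n + 1 : ℕ) + 1 : ℝ) ^ s / ((n : ℝ) + 1) ^ s
  rw [← Real.div_rpow (by positivity) (by positivity), ← Real.div_rpow (by positivity)
    (by positivity)]
  refine Real.rpow_le_rpow_of_nonpos (by positivity) ?_ (by linarith)
  have hmn' : (m : ℝ) ≤ n := Nat.cast_le.2 hmn
  rw [div_le_div_iff₀ (by positivity) (by positivity)]
  push_cast
  nlinarith

theorem isPickSeq_pickCoeff {W : DiscWeight}
    (hW : (∃ (s : ℝ) (hs : s < -1), W = powerWeight s hs) ∨ W.IsCompletePick) :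
    IsPickSeq W W.pickCoeff := by
  rcases hW with ⟨s, hs, rfl⟩ | h
  · exact isPickSeq_of_monotone_ratio (monotone_ratio_powerWeight s hs)
  · exact h.isPickSeq

end DiscWeight

end

theorem theorem1 (W : DiscWeight)
    (hW : (∃ (s : ℝ) (hs : s < -1), W = powerWeight s hs) ∨ W.IsCompletePick) :
    ∃ ρ : W.T →⋆ₐ[ℂ] C(Circle, ℂ),
      -- `ρ` is the unique symbol homomorphism; `δ = evalOne ρ`, `φ = δ|_S`
      W.IsSymbolMap ρ ∧ (∀ ρ', W.IsSymbolMap ρ' → ρ' = ρ) ∧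
      -- (1) `T` is the C*-envelope of `S`
      OperatorSystem.IsCStarEnvelope.{u} W.S ∧
      -- (2) `φ` is a pure state of `S`
      W.S.IsPureState (W.phi ρ) ∧
      -- (3) the states of `T` extending `φ` are exactly the convex combinations of `ψ` and `δ`
      {τ : W.T →ₗ[ℂ] ℂ | IsCStarState τ ∧ τ.comp W.S.toSubmodule.subtype = W.phi ρ} =
        {τ : W.T →ₗ[ℂ] ℂ | ∃ t : ℝ, 0 ≤ t ∧ t ≤ 1 ∧
          ∀ x : W.T, τ x = (t : ℂ) * W.psi x + (1 - (t : ℂ)) * DiscWeight.evalOne ρ x} ∧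
      -- (4) the GNS representation of `ψ` is unitarily equivalent to the identity representation
      -- (with cyclic vectors corresponding), and both are boundary representations for `S`
      (∃ U : W.psi.GNS ≃ₗᵢ[ℂ] W.H,
        U (W.psi.toPreGNS 1 : W.psi.PreGNS) = W.normalizedKernelOne ∧
        ∀ (x : W.T) (ξ : W.psi.GNS), U (W.psi.gnsStarAlgHom x ξ) = W.idRep x (U ξ)) ∧
      IsBoundaryRep W.S W.psi.gnsStarAlgHom ∧
      IsBoundaryRep W.S W.idRep ∧
      -- (5) the character `δ` is not a boundary representation for `S`
      ¬ IsBoundaryRep W.S (characterRep (DiscWeight.evalOne ρ)) := by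
  have hb := DiscWeight.isPickSeq_pickCoeff hW
  obtain ⟨U, hU1, hU⟩ := DiscWeight.exists_gns_unitary (W := W)
  exact ⟨W.symbol, DiscWeight.isSymbolMap_symbol, fun ρ h => h.eq_symbol,
    DiscWeight.isCStarEnvelope_S hb, DiscWeight.isPureState_phi,
    DiscWeight.setOf_isCStarState_extending_phi, ⟨U, hU1, hU⟩,
    DiscWeight.isBoundaryRep_of_unitaryEquiv hb U hU, DiscWeight.isBoundaryRep_idRep hb,
    DiscWeight.not_isBoundaryRep_evalOne⟩
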